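/- **Setting.** Let $\Sigma$ be a compact connected oriented surface, possibly with boundary or punctures, of negative Euler characteristic, cut by pants curves $\sigma_1,\dots,\sigma_\xi$ into pairs of pants. Fix an orientation-preserving identification of the interior of each pair of pants with the standard triply punctured sphere $\mathbb H/\Gamma$, $\Gamma=\langle\begin{pmatrix}1&2\\0&1\end{pmatrix},\begin{pmatrix}1&0\\2&1\end{pmatrix}\rangle$. This labels the boundary components by $0,1,\infty$. The white hexagon is the image of the ideal triangle with vertices $0,1,\infty$, the black hexagon is the image of its reflection in the imaginary axis, and the three seams are their common edges. The marking of $\Sigma$ is the one in which across every pants curve seams are matched with seams and white hexagons with white ones; the dual curve $D_i$ meets $\sigma_i$ twice, in the middle of its white and in the middle of its black half. (If both sides of $\sigma_i$ belong to the same pair of pants, $D_i$ consists of two parallel curves.) For $\tau=(\tau_1,\dots,\tau_\xi)\in\mathbb C^\xi$ let $\rho=\rho_\tau:\pi_1(\Sigma)\to PSL(2,\mathbb C)$ be the holonomy of Kra's plumbing construction: if boundary components labelled $\epsilon,\epsilon'$ are glued along $\sigma_i$, then the coordinates $z,z'$ of the white triangles on the two sides are identified by $\Omega_{\epsilon'}(z')=T_{\tau_i}J\,\Omega_\epsilon(z)$,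 where $J(z)=-z$, $T_{\tau}(z)=z+\tau$ and $\Omega_\epsilon$ is the orientation-preserving symmetry of the triangle $0,1,\infty$ that sends $\epsilon$ to $\infty$; the holonomy of a loop is the product of the overlap maps along the charts it passes through. Let $\gamma$ be a connected simple closed curve on $\Sigma$ that is neither null-homotopic nor parallel to a boundary component or puncture. Let $q_i\ge 0$ be the geometric intersection number of $\gamma$ and $\sigma_i$, and $q=\sum_i q_i$. If $\gamma$ is not parallel to a pants curve, put it in standard position: it meets every $\sigma_i$ in $q_i$ points, and outside annuli $A_i$ around the $\sigma_i$ it is invariant under the reflection that exchanges white and black hexagons. The DT-twist $p_i\in\mathbb Z$ is the algebraic intersection number of $\gamma\cap A_i$ and $D_i\cap A_i$, all arcs oriented across $A_i$ in the same direction (turning to the right counts as positive; $p_i=0$ if $q_i=0$). Let $h$ be the number of scc-arcs, i.e. of arcs of $\gamma$ in the pairs of pants that connect a boundary component to itself. **Theorem A.** (1) If $\gamma$ is not parallel to any of the pants curves $\sigma_i$, then $q>0$, and $\operatorname{Tr}\rho(\gamma)$ (which is defined up to sign) is a polynomial in $\tau_1,\dots,\tau_\xi$ whose top terms are given by $$\operatorname{Tr}\rho(\gamma)=\pm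 i^q2^h\prod_{i=1}^{\xi}\Bigl(\tau_i+\frac{p_i-q_i}{q_i}\Bigr)^{q_i}+R=\pm i^q2^h\Bigl(\tau_1^{q_1}\cdots\tau_\xi^{q_\xi}+\sum_{i=1}^{\xi}(p_i-q_i)\,\tau_1^{q_1}\cdots\tau_i^{q_i-1}\cdots\tau_\xi^{q_\xi}\Bigr)+R',$$ where $R$ and $R'$ are polynomials in $\tau_1,\dots,\tau_\xi$ of total degree at most $q-2$ (so they vanish if $q=1$) and of degree at most $q_i$ in $\tau_i$ for every $i$. (Factors and summands with $q_i=0$ are read as $1$ and $0$, respectively.) (2) If $q=0$, then $\gamma$ is parallel to $\sigma_i$ for some $i$, $\rho(\gamma)$ is parabolic, and $\operatorname{Tr}\rho(\gamma)=\pm2$. -/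

import Mathlib

/-- A pants decomposition of a compact connected oriented surface `Σ` (boundary components and
punctures are not distinguished), together with a marking.

There are `k` pairs of pants; each is a copy of the standard triply punctured sphere, so that its
three boundary components are labelled `0, 1, ∞` (here `0, 1, 2 : Fin 3`, cyclically ordered). There
are `ξ` pants curves; the two sides of the `i`-th pants curve are the boundary components
`side i false` and `side i true`, which are glued to each other. The boundary components of pants
that are not the side of a pants curve are the boundary components (or punctures) of `Σ`.

The three seams cut each pair of pants into a white and a black hexagon. The marking is the one for
which the gluing along every pants curve reverses the boundary orientation, matches the ends of
seams, and matches white hexagons with white and black hexagons with black ones. Thus `Σ` is tiled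
by `2 k` hexagons, which is the hexagonal decomposition that defines the marking. -/
structure PantsDecomposition where
  /-- the number of pairs of pants -/
  k : ℕ
  /-- the number of pants curves -/
  ξ : ℕ
  k_pos : 0 < k
  /-- the boundary component of a pair of pants that is the given side of the `i`-th pants curve -/
  side : Fin ξ → Bool → Fin k × Fin 3
  side_injective : Function.Injective fun x : Fin ξ × Bool => side x.1 x.2
  connected : ∀ P Q : Fin k, Relation.ReflTransGen
    (fun A B => ∃ i b, (side i b).1 = A ∧ (side i (!b)).1 = B) P Q

namespace PantsDecomposition

variable (S : PantsDecomposition)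

/-! ### Paths and free homotopy

Curves are taken in general position with respect to the tiling by hexagons: they avoid its vertices
and cross its edges transversally. As hexagons are simply connected, a path is determined up to
homotopy by the sequence of edges that it crosses, and it is recorded by this sequence. -/

/-- A tile: a pair of pants and a colour (`true` is white, `false` is black). -/
abbrev Tile := Fin S.k × Bool

/-- An oriented crossing of an edge of the tiling. The seam `s` of a pair of pants is the one that
does not meet the boundary component `s`; it is the image of the geodesic from `s + 1` to `s + 2`.
* `seam P s c` leaves the hexagon of `P` of colour `c` across the seam `s`, and enters the hexagon
  of `P` of the other colour;
* `cross i b c` crosses the half of colour `c` of the `i`-th pants curve, from the pair of pants on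
  the side `b` to the one on the side `!b`. -/
inductive Dart
  | seam (P : Fin S.k) (s : Fin 3) (c : Bool)
  | cross (i : Fin S.ξ) (b : Bool) (c : Bool)

variable {S}

/-- The tile that is left. -/
def Dart.src : S.Dart → S.Tile
  | .seam P _ c => (P, c)
  | .cross i b c => ((S.side i b).1, c)

/-- The same crossing in the opposite direction. -/
def Dart.rev : S.Dart → S.Dart
  | .seam P s c => .seam P s (!c)
  | .cross i b c => .cross i (!b) c

/-- The tile that is entered. -/
def Dart.tgt (d : S.Dart) : S.Tile := d.rev.src

/-- Is `d` a crossing of the `i`-th pants curve? -/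
def Dart.crosses (i : Fin S.ξ) : S.Dart → Bool
  | .seam _ _ _ => false
  | .cross j _ _ => j = i

variable (S)

/-- A closed path in general position: a cyclically composable sequence of crossings. -/
def IsLoop (l : List S.Dart) : Prop :=
  Cycle.Chain (fun d e : S.Dart => d.tgt = e.src) (l : Cycle S.Dart)

/-- Closed paths. -/
abbrev Loop := {l : List S.Dart // S.IsLoop l}

/-- The constant closed path. -/
def trivialLoop : S.Loop := ⟨[], by simp [IsLoop]⟩

variable {S}

/-- The boundary component `ε` of a pair of pants meets two seams: the outgoing one `ε + 2` and the
incoming one `ε + 1`. Here `true` means outgoing. -/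
def seamAt (ε : Fin 3) (out : Bool) : Fin 3 := if out then ε + 2 else ε + 1

/-- The closed path once around a vertex of the tiling that lies on the `i`-th pants curve: this
vertex is the end of the outgoing seam on the side `b` and of the incoming seam on the other
side. -/
def vertexLoop (i : Fin S.ξ) (b : Bool) : List S.Dart :=
  [.seam (S.side i b).1 (seamAt (S.side i b).2 true) true,
   .cross i b false,
   .seam (S.side i (!b)).1 (seamAt (S.side i (!b)).2 false) false,
   .cross i (!b) true]

/-- The elementary free homotopies of closed paths: change of the starting point, cancellation of
an edge crossed back and forth, and pushing across a vertex of the tiling. -/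
inductive Step : S.Loop → S.Loop → Prop
  | rotate (l₁ l₂ : List S.Dart) (h : S.IsLoop (l₁ ++ l₂)) (h' : S.IsLoop (l₂ ++ l₁)) :
      Step ⟨l₁ ++ l₂, h⟩ ⟨l₂ ++ l₁, h'⟩
  | backtrack (d : S.Dart) (l : List S.Dart) (h : S.IsLoop (d :: d.rev :: l)) (h' : S.IsLoop l) :
      Step ⟨d :: d.rev :: l, h⟩ ⟨l, h'⟩
  | vertex (i : Fin S.ξ) (b : Bool) (l : List S.Dart) (h : S.IsLoop (vertexLoop i b ++ l))
      (h' : S.IsLoop l) : Step ⟨vertexLoop i b ++ l, h⟩ ⟨l, h'⟩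

/-- Free homotopy of closed paths on `Σ`. -/
def FreelyHomotopic : S.Loop → S.Loop → Prop := Relation.EqvGen Step

variable (S)

/-- The closed path around the boundary component `ε` of the pair of pants `P`, in the positive
(`true`) or negative (`false`) direction. -/
def boundaryLoop (P : Fin S.k) (ε : Fin 3) (dir : Bool) : S.Loop :=
  ⟨[.seam P (seamAt ε dir) true, .seam P (seamAt ε (!dir)) false], by
    simp [IsLoop, Cycle.chain_coe_cons, Dart.tgt, Dart.rev, Dart.src]⟩

variable {S}

/-- `γ` is homotopic, up to orientation, to the boundary component `β = (P, ε)`. -/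
def ParallelToBoundary (γ : S.Loop) (β : Fin S.k × Fin 3) : Prop :=
  ∃ dir, FreelyHomotopic γ (S.boundaryLoop β.1 β.2 dir)

/-- `γ` is homotopic, up to orientation, to the `i`-th pants curve. -/
def ParallelToPantsCurve (γ : S.Loop) (i : Fin S.ξ) : Prop :=
  ParallelToBoundary γ (S.side i true)

/-! ### Simple closed curves -/

/-- A point on the boundary circle of a hexagon: the number of the side, where the six sides are
numbered in cyclic order from `0` to `5`, and a coordinate along this side. -/
abbrev BoundaryPoint := ℕ ×ₗ ℝ

/-- The number of the side across which `d` leaves its hexagon. The boundary components `0, 1, ∞`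
are the sides `0, 2, 4`; the seams `∞` (from `0` to `1`), `0` (from `1` to `∞`) and `1` (from `∞` to
`0`) are the sides `1, 3, 5`. The sides are listed anticlockwise for white hexagons and clockwise
for black ones. -/
def Dart.sideNumber : S.Dart → ℕ
  | .seam _ s _ => (2 * s.val + 3) % 6
  | .cross i b _ => 2 * (S.side i b).2.val

/-- The same point of an edge, in the coordinate used on the other side of the edge: both hexagons
at a seam run along it in the same direction, and the two hexagons at a half of a pants curve run
along it in opposite directions. -/
def Dart.flip : S.Dart → ℝ → ℝ
  | .seam _ _ _, x => x
  | .cross _ _ _, x => -x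

/-- The endpoint, in the tile that `d` leaves, of a path that leaves at coordinate `x`. -/
def Dart.exitPoint (d : S.Dart) (x : ℝ) : BoundaryPoint := toLex (d.sideNumber, x)

/-- The same point, seen in the tile that `d` enters. -/
def Dart.entryPoint (d : S.Dart) (x : ℝ) : BoundaryPoint :=
  toLex (d.rev.sideNumber, d.flip x)

/-- The chord of a disc with endpoints `a`, `b` is disjoint from the one with endpoints `c`, `d`
(cyclic order is read from the linear order obtained by cutting the circle at a point): `c` and `d`
lie in the same open arc of the complement of `a` and `b`. -/
def ChordsDisjoint (a b c d : BoundaryPoint) : Prop :=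
  (c ∈ Set.uIoo a b ∧ d ∈ Set.uIoo a b) ∨ (c ∉ Set.uIcc a b ∧ d ∉ Set.uIcc a b)

/-- The closed path can be drawn as a simple closed curve: the points `x j` at which it crosses the
edges can be chosen such that the arcs into which the edges cut it are pairwise disjoint. The
`j`-th arc runs from the `j`-th crossing to the next one, in the tile between them. -/
def IsEmbedded {n : ℕ} (d : Fin n → S.Dart) : Prop :=
  ∃ x : Fin n → ℝ,
    (∀ j, (d j).entryPoint (x j) ≠ (d (finRotate n j)).exitPoint (x (finRotate n j))) ∧
    ∀ j j', j ≠ j' → (d j).tgt = (d j').tgt →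
      ChordsDisjoint
        ((d j).entryPoint (x j)) ((d (finRotate n j)).exitPoint (x (finRotate n j)))
        ((d j').entryPoint (x j')) ((d (finRotate n j')).exitPoint (x (finRotate n j')))

/-- `γ` is homotopic to a simple closed curve. -/
def IsSimple (γ : S.Loop) : Prop :=
  ∃ c : S.Loop, FreelyHomotopic γ c ∧ IsEmbedded c.1.get

/-- `γ` represents an element of the set `𝒮₀(Σ)` of homotopy classes of connected simple closed
curves that are not null-homotopic and not parallel to a boundary component (or puncture)
of `Σ`. -/
structure IsCurve (γ : S.Loop) : Prop where
  simple : IsSimple γ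
  essential : ¬ FreelyHomotopic γ S.trivialLoop
  nonperipheral : ∀ β : Fin S.k × Fin 3, (∀ i b, S.side i b ≠ β) → ¬ ParallelToBoundary γ β

/-! ### Dehn–Thurston coordinates -/

/-- The geometric intersection number of `γ` with the `i`-th pants curve: the least number of
intersections of a closed path homotopic to `γ` with it. -/
noncomputable def intersectionNumber (γ : S.Loop) (i : Fin S.ξ) : ℕ :=
  sInf {n | ∃ c : S.Loop, FreelyHomotopic γ c ∧ c.1.countP (Dart.crosses i) = n}

/-!
Every pants curve `σ` meets its dual curve `D` in the middle of its white half and in the middle of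
its black half, so that these two rungs cut an annulus around `σ` into two sectors; each
of them contains the ends of one seam on either side. Looked at from the boundary component `ε` of
one of the adjacent pants, the sectors are the outgoing one (`true`) and the incoming one (`false`),
according to the seam they contain.

A curve in standard position with respect to the dual curves runs, outside the annuli, along arcs
that are invariant under the reflection exchanging white and black hexagons. Up to isotopy, these
are the arcs along the seams (connecting distinct boundary components) and, for every boundary
component, one arc that runs from it across the opposite seam back to it. Sliding the
endpoints of the latter into one of the two sectors, it goes along a seam to another boundary
component, once around it, and back along the seam.

To write such curves as paths we push them off the seams into the white hexagons. -/

/-- Move along the boundary component `ε` of `P` across `n` rungs to the right (seen from `P`, when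
facing the boundary), starting from the sector `a`: from the outgoing to the incoming sector through
the white hexagon, and from the incoming to the outgoing one through the black hexagon. -/
def turnRight (P : Fin S.k) (ε : Fin 3) : Bool → ℕ → List S.Dart
  | _, 0 => []
  | true, n + 1 => turnRight P ε false n
  | false, n + 1 =>
      .seam P (seamAt ε false) true :: .seam P (seamAt ε true) false :: turnRight P ε true n

/-- Move along the boundary component `ε` of `P` across `n` rungs to the left. -/
def turnLeft (P : Fin S.k) (ε : Fin 3) : Bool → ℕ → List S.Dart
  | _, 0 => []
  | false, n + 1 => turnLeft P ε true n
  | true, n + 1 =>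
      .seam P (seamAt ε true) true :: .seam P (seamAt ε false) false :: turnLeft P ε false n

/-- Move along the boundary component `ε` of `P` from the sector `a` across `|n|` rungs, to the
right if `n` is positive and to the left if `n` is negative. -/
def turn (P : Fin S.k) (ε : Fin 3) (a : Bool) : ℤ → List S.Dart
  | Int.ofNat n => turnRight P ε a n
  | Int.negSucc n => turnLeft P ε a (n + 1)

/-- The other end of the seam at the sector `a` of the boundary component `ε`; at this end, the
sector is `!a`. -/
def farEnd (ε : Fin 3) (a : Bool) : Fin 3 := if a then ε + 1 else ε + 2

variable (S)

/-- A strand of a curve in standard position, which consists of the passage through the annulus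
around a pants curve, and of the arc that follows it:
* it enters the annulus around the `i`-th pants curve from the side `b` in the sector `a`, moves
  across `twist` rungs (to the right if this is positive), and leaves the annulus;
* then it runs along the seam to another boundary component if `arc = none`; if `arc = some dir`,
  it runs through an arc from the boundary component to itself. -/
structure Strand where
  /-- the pants curve that is crossed -/
  i : Fin S.ξ
  /-- the side from which it is crossed -/
  b : Bool
  /-- the sector in which the annulus is entered -/
  a : Bool
  /-- the signed number of rungs crossed in the annulus, i.e. the algebraic intersection number of
  the strand with the two arcs of the dual curve in the annulus, all of them oriented across the
  annulus in the same way -/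
  twist : ℤ
  /-- the type of the arc after the crossing -/
  arc : Option Bool

variable {S}

namespace Strand

/-- The pair of pants that is entered. -/
def pants (s : S.Strand) : Fin S.k := (S.side s.i (!s.b)).1

/-- The boundary component of `s.pants` through which it is entered. -/
def entry (s : S.Strand) : Fin 3 := (S.side s.i (!s.b)).2

/-- The sector in which the annulus is left, seen from `s.pants`: crossing a rung
exchanges the two sectors, and the outgoing sector on one side of the pants curve is the incoming
sector on the other side. -/
def exitSector (s : S.Strand) : Bool := if Even s.twist then !s.a else s.a

/-- The pair of pants, boundary component and sector at which the strand starts. -/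
def start (s : S.Strand) : (Fin S.k × Fin 3) × Bool := (S.side s.i s.b, s.a)

/-- The pair of pants, boundary component and sector at which the strand ends. -/
def finish (s : S.Strand) : (Fin S.k × Fin 3) × Bool :=
  match s.arc with
  | none => ((s.pants, farEnd s.entry s.exitSector), !s.exitSector)
  | some _ => ((s.pants, s.entry), s.exitSector)

/-- The arc of the strand in `s.pants`, as a path. -/
def arcWord (s : S.Strand) : List S.Dart :=
  match s.arc with
  | none => []
  | some dir =>
      turn s.pants (farEnd s.entry s.exitSector) (!s.exitSector) (if dir then 2 else -2)

/-- The strand as a path between white hexagons. -/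
def word (s : S.Strand) : List S.Dart :=
  turn (S.side s.i s.b).1 (S.side s.i s.b).2 s.a s.twist ++ .cross s.i s.b true :: s.arcWord

end Strand

/-- The cyclic sequence of strands `L` is a standard position of `γ`: consecutive strands fit
together, they form a closed path homotopic to `γ`, and this path intersects every pants curve
minimally. (Whether parallel strands are drawn without crossings is irrelevant for the twists
and for the number of scc-arcs, and is not required.) -/
structure IsStandardPosition (γ : S.Loop) (L : List S.Strand) : Prop where
  chain : Cycle.Chain (fun s t : S.Strand => s.finish = t.start) (L : Cycle S.Strand)
  homotopic : ∃ c : S.Loop, c.1 = L.flatMap Strand.word ∧ FreelyHomotopic γ c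
  minimal : ∀ i, L.countP (fun s => s.i = i) = intersectionNumber γ i

/-- The DT-twist about the `i`-th pants curve of a curve in standard position, i.e. the algebraic
intersection number of the curve and the dual curve in the annulus around the `i`-th pants
curve. If the `i`-th pants curve is not crossed it is zero (the number of components parallel to
the pants curve, for a connected curve that is not parallel to it). -/
def dtTwist (L : List S.Strand) (i : Fin S.ξ) : ℤ :=
  ((L.filter (fun s => s.i = i)).map Strand.twist).sum

/-- The number of arcs of a curve in standard position that connect a boundary component of a pair
of pants to itself. -/
def sccArcs (L : List S.Strand) : ℕ := L.countP (fun s => s.arc.isSome)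

/-- `γ`, which is not parallel to a pants curve, has the DT-twists `p i` about the pants curves, and
`h` is the number of its scc-arcs. -/
def HasTwistsAndSccArcs (γ : S.Loop) (p : Fin S.ξ → ℤ) (h : ℕ) : Prop :=
  ∃ L : List S.Strand, IsStandardPosition γ L ∧ (∀ i, dtTwist L i = p i) ∧ sccArcs L = h

/-! ### The plumbing construction and its holonomy -/

/-- `J`, which acts by `z ↦ -z`. -/
def J : Matrix.SpecialLinearGroup (Fin 2) ℂ := ⟨!![-Complex.I, 0; 0, Complex.I], by simp⟩

/-- `T_τ`, which acts by `z ↦ z + τ`. -/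
def T (τ : ℂ) : Matrix.SpecialLinearGroup (Fin 2) ℂ := ⟨!![1, τ; 0, 1], by simp⟩

/-- `Ω_ε`, the rotation of the ideal triangle with vertices `0, 1, ∞` that sends `ε` to `∞`. -/
def Ω : Fin 3 → Matrix.SpecialLinearGroup (Fin 2) ℂ
  | 0 => ⟨!![1, -1; 1, 0], by simp⟩
  | 1 => ⟨!![0, -1; 1, -1], by simp⟩
  | 2 => 1

/-- The triply punctured sphere is obtained from the white ideal triangle with vertices `0, 1, ∞`
and the black one with vertices `0, -1, ∞`. This is the overlap map from the black to the white
chart at the seam `s`: it sends the black triangle to the neighbour of the white one across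
the side from `s + 1` to `s + 2`. -/
def seamMap : Fin 3 → Matrix.SpecialLinearGroup (Fin 2) ℂ
  | 0 => ⟨!![1, 2; 0, 1], by simp⟩
  | 1 => 1
  | 2 => ⟨!![1, 0; 2, 1], by simp⟩

/-- The boundary components `ε` and `ε'` are glued by `Ω_ε' z' = T_τ J Ω_ε z`, where `z` and `z'`
are the coordinates of the white charts. This is the overlap map from the chart with coordinate
`z'` to the one with coordinate `z`. -/
def gluingMap (τ : ℂ) (ε ε' : Fin 3) : Matrix.SpecialLinearGroup (Fin 2) ℂ :=
  (Ω ε)⁻¹ * J⁻¹ * (T τ)⁻¹ * Ω ε'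

/-- The overlap map from the chart of the hexagon that `d` enters to the chart of the hexagon that
it leaves. Between black hexagons, it is obtained by going through the adjacent white ones. -/
def overlapMap (τ : Fin S.ξ → ℂ) : S.Dart → Matrix.SpecialLinearGroup (Fin 2) ℂ
  | .seam _ s true => seamMap s
  | .seam _ s false => (seamMap s)⁻¹
  | .cross i b true => gluingMap (τ i) (S.side i b).2 (S.side i (!b)).2
  | .cross i b false =>
      (seamMap (seamAt (S.side i b).2 true))⁻¹ *
        gluingMap (τ i) (S.side i b).2 (S.side i (!b)).2 *
        seamMap (seamAt (S.side i (!b)).2 false)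

/-- The holonomy representation with the plumbing parameters `τ`: the holonomy in `PSL(2, ℂ)` of
a closed path `γ` is the product of the overlap maps along the chain of charts through which it
passes. -/
def holonomy (τ : Fin S.ξ → ℂ) (γ : S.Loop) : Matrix.ProjectiveSpecialLinearGroup (Fin 2) ℂ :=
  ((γ.1.map (overlapMap τ)).prod : Matrix.SpecialLinearGroup (Fin 2) ℂ)

/-! The holonomy only depends on the homotopy class. -/

open Matrix.SpecialLinearGroup in
theorem gluingMap_mul_gluingMap (τ : ℂ) (ε ε' : Fin 3) :
    gluingMap τ ε ε' * gluingMap τ ε' ε = -1 := by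
  have hJ : (J : Matrix (Fin 2) (Fin 2) ℂ) = !![-Complex.I, 0; 0, Complex.I] := rfl
  have hT : ∀ t, (T t : Matrix (Fin 2) (Fin 2) ℂ) = !![1, t; 0, 1] := fun _ => rfl
  have h : J⁻¹ * (T τ)⁻¹ * (J⁻¹ * (T τ)⁻¹) = -1 := by
    apply Subtype.ext
    simp only [coe_mul, coe_inv, coe_neg, coe_one, hJ, hT]
    simp [Matrix.adjugate_fin_two, Matrix.one_fin_two]; ring
  calc _ = (Ω ε)⁻¹ * (J⁻¹ * (T τ)⁻¹ * (J⁻¹ * (T τ)⁻¹)) * Ω ε := by simp [gluingMap, mul_assoc]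
    _ = _ := by rw [h]; simp

open Matrix.SpecialLinearGroup in
theorem seamMap_boundary (ε : Fin 3) : Ω ε * (seamMap (ε + 2) * (seamMap (ε + 1))⁻¹) = T (-2) * Ω ε ∨
   Ω ε * (seamMap (ε + 2) * (seamMap (ε + 1))⁻¹) = - (T (-2) * Ω ε) := by
  have hT : ∀ t, (T t : Matrix (Fin 2) (Fin 2) ℂ) = !![1, t; 0, 1] := fun _ => rfl
  have h0 : (Ω 0 : Matrix (Fin 2) (Fin 2) ℂ) = !![1, -1; 1, 0] := rfl
  have h1 : (Ω 1 : Matrix (Fin 2) (Fin 2) ℂ) = !![0, -1; 1, -1] := rfl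
  have h2 : Ω 2 = 1 := rfl
  have s0 : (seamMap 0 : Matrix (Fin 2) (Fin 2) ℂ) = !![1, 2; 0, 1] := rfl
  have s1 : seamMap 1 = 1 := rfl
  have s2 : (seamMap 2 : Matrix (Fin 2) (Fin 2) ℂ) = !![1, 0; 2, 1] := rfl
  fin_cases ε
  · left; change Ω 0 * (seamMap 2 * (seamMap 1)⁻¹) = T (-2) * Ω 0
    rw [s1]; apply Subtype.ext
    simp only [coe_mul, coe_inv, hT, h0, s2]
    simp [Matrix.adjugate_fin_two, Matrix.one_fin_two]
  · right; change Ω 1 * (seamMap 0 * (seamMap 2)⁻¹) = -(T (-2) * Ω 1)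
    apply Subtype.ext
    simp only [coe_mul, coe_inv, coe_neg, hT, h1, s2, s0]
    simp [Matrix.adjugate_fin_two]; norm_num
  · left; change Ω 2 * (seamMap 1 * (seamMap 0)⁻¹) = T (-2) * Ω 2
    rw [s1, h2]; apply Subtype.ext
    simp only [coe_mul, coe_inv, coe_one, hT, s0]
    simp [Matrix.adjugate_fin_two, Matrix.one_fin_two]

open Matrix.SpecialLinearGroup in
theorem J_T_comm (τ : ℂ) : J⁻¹ * (T τ)⁻¹ * (T (-2))⁻¹ = T (-2) * (J⁻¹ * (T τ)⁻¹) := by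
  have hJ : (J : Matrix (Fin 2) (Fin 2) ℂ) = !![-Complex.I, 0; 0, Complex.I] := rfl
  have hT : ∀ t, (T t : Matrix (Fin 2) (Fin 2) ℂ) = !![1, t; 0, 1] := fun _ => rfl
  apply Subtype.ext
  simp only [coe_mul, coe_inv, hJ, hT]
  simp [Matrix.adjugate_fin_two]
  ring

/-- The projection from `SL(2, ℂ)` to `PSL(2, ℂ)`. -/
def pr : Matrix.SpecialLinearGroup (Fin 2) ℂ →*
    Matrix.ProjectiveSpecialLinearGroup (Fin 2) ℂ := QuotientGroup.mk' _

theorem pr_neg (A : Matrix.SpecialLinearGroup (Fin 2) ℂ) : pr (-A) = pr A := by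
  have : pr (-1) = 1 := by
    refine (QuotientGroup.eq_one_iff _).2 ?_
    rw [Subgroup.mem_center_iff]; intro g; simp
  rw [← neg_one_mul, map_mul, this, one_mul]

theorem overlapMap_mul_rev (τ : Fin S.ξ → ℂ) (d : S.Dart) :
    pr (overlapMap τ d) * pr (overlapMap τ d.rev) = 1 := by
  have g : ∀ t ε ε', pr (gluingMap t ε ε') * pr (gluingMap t ε' ε) = 1 := by
    intro t ε ε'; rw [← map_mul, gluingMap_mul_gluingMap, pr_neg, map_one]
  have g' : ∀ t ε ε', pr (gluingMap t ε ε') * (pr (seamMap (ε' + 1)) * (pr (seamMap (ε' + 2)))⁻¹) =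
      pr (seamMap (ε + 2)) * (pr (seamMap (ε + 1)))⁻¹ * pr (gluingMap t ε ε') := by
    intro t ε ε'
    have E : ∀ ε, pr (seamMap (ε + 2)) * (pr (seamMap (ε + 1)))⁻¹ = (pr (Ω ε))⁻¹ * pr (T (-2)) * pr (Ω ε) := by
      intro ε
      rw [mul_assoc, eq_inv_mul_iff_mul_eq]
      rcases seamMap_boundary ε with h | h
      · simpa using congrArg pr h
      · have := congrArg pr h
        rw [pr_neg] at this
        simpa using this
    have E' : pr (seamMap (ε' + 1)) * (pr (seamMap (ε' + 2)))⁻¹ = (pr (Ω ε'))⁻¹ * (pr (T (-2)))⁻¹ * pr (Ω ε') := by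
      rw [← _root_.inv_inj]; simp only [mul_inv_rev, inv_inv]; rw [E, mul_assoc]
    have m := congrArg pr (J_T_comm t)
    simp only [map_mul, map_inv] at m
    rw [E, E']; simp only [gluingMap, map_mul, map_inv]
    calc _ = (pr (Ω ε))⁻¹ * ((pr J)⁻¹ * (pr (T t))⁻¹ * (pr (T (-2)))⁻¹) * pr (Ω ε') := by group
      _ = _ := by rw [m]; group
  rcases d with ⟨P, s, c⟩ | ⟨i, b, c⟩
  · cases c <;> simp [Dart.rev, overlapMap]
  · cases c
    · simp only [Dart.rev, overlapMap, seamAt, Bool.not_not, map_mul, map_inv]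
      set e := (S.side i b).2
      set e' := (S.side i !b).2
      have := g' (τ i) e e'
      simp only [if_true, Bool.false_eq_true, if_false]
      calc _ = (pr (seamMap (e+2)))⁻¹ * (pr (gluingMap (τ i) e e') * (pr (seamMap (e' + 1)) * (pr (seamMap (e' + 2)))⁻¹)) * pr (gluingMap (τ i) e' e) * pr (seamMap (e+1)) := by group
        _ = (pr (seamMap (e+1)))⁻¹ * (pr (gluingMap (τ i) e e') * pr (gluingMap (τ i) e' e)) * pr (seamMap (e+1)) := by rw [this]; group
        _ = 1 := by rw [g]; group
    · simpa [Dart.rev, overlapMap] using g _ _ _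

theorem overlapMap_vertexLoop (τ : Fin S.ξ → ℂ) (i : Fin S.ξ) (b : Bool) :
    ((vertexLoop i b).map (fun d => pr (overlapMap τ d))).prod = 1 := by
  have g : ∀ t ε ε', pr (gluingMap t ε ε') * pr (gluingMap t ε' ε) = 1 := by
    intro t ε ε'; rw [← map_mul, gluingMap_mul_gluingMap, pr_neg, map_one]
  simp [vertexLoop, overlapMap, mul_assoc, g]

theorem holonomy_eq_prod (τ : Fin S.ξ → ℂ) (γ : S.Loop) :
    holonomy τ γ = (γ.1.map (fun d => pr (overlapMap τ d))).prod := by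
  change pr _ = _
  rw [map_list_prod, List.map_map]; rfl

/-- The holonomy is well defined on free homotopy classes, up to conjugation (hence its trace is
well defined up to sign). -/
theorem holonomy_isConj (τ : Fin S.ξ → ℂ) {γ γ' : S.Loop} (h : FreelyHomotopic γ γ') :
    IsConj (holonomy τ γ) (holonomy τ γ') := by
  induction h with
  | rel _ _ h =>
    rcases h with ⟨l₁, l₂⟩ | ⟨d, l⟩ | ⟨i, b, l⟩
    · simp only [holonomy_eq_prod, List.map_append, List.prod_append]
      exact isConj_iff.2 ⟨((l₁.map (fun d => pr (overlapMap τ d))).prod)⁻¹, by group⟩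
    · rw [holonomy_eq_prod, holonomy_eq_prod]
      simp only [List.map_cons, List.prod_cons, ← mul_assoc, overlapMap_mul_rev, one_mul]; exact IsConj.refl _
    · rw [holonomy_eq_prod, holonomy_eq_prod]
      simp only [List.map_append, List.prod_append, overlapMap_vertexLoop, one_mul]; exact IsConj.refl _
  | refl => exact IsConj.refl _
  | symm _ _ _ ih => exact ih.symm
  | trans _ _ _ _ _ ih ih' => exact ih.trans ih'

end PantsDecomposition

/-!
The holonomy of a closed path is a product of one matrix per crossed edge, so the trace of the
holonomy of `γ` is a polynomial in `τ` up to sign (traces squared are invariant under homotopy).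

*Top terms.* Up to sign and conjugating factors that cancel between consecutive strands, the
holonomy of a strand of a curve in standard position is `T x * W κ`, where `x` is `τ i` plus a
constant that involves the twist, `W κ` is the matrix with rows `(0, -1 / κ)` and `(κ, 0)`, and `κ`
is `i`, or `2 i` if the strand ends with an scc-arc (`exists_factors`). In a product of `q > 0` such
matrices, the upper left entry is the product of the linear factors `κ x` plus terms whose degree is
lower by at least two, and the degree of the lower right entry is lower by at least two as well
(`polyProd_mem`). This gives the top terms of the trace (`exists_topTerms`).

*Curves with intersection number zero.* It has to be shown that a simple closed curve `γ` which can
be homotoped off every single pants curve is parallel to one of them. Take an embedded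
representative with the least number of crossings of edges of the tiling. It has no backtracks and
no bigons with the pants curves: an innermost bigon with one or two seams could be pushed across a
vertex of the tiling (`IsTight.no_one_bigon`, `IsTight.no_two_bigon`), and a path that crosses more
seams before it returns would spiral around the boundary component, where each turn is farther away
than the preceding one, so that it could not return (`IsTight.no_spiral`).

If this representative crossed a pants curve, then the product of the leading coefficients of its
matrices would have nonzero trace. In fact, in the product of such a leading coefficient and a row
vector, the vector is evaluated at the cusp through which the path leaves, as a linear form on the
chart; and the form that vanishes at the cusp through which the path has entered does not vanish at
the cusp through which it leaves, unless the path is a bigon (`trace_leading_ne_zero`). On the other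
hand, this trace is the coefficient of `t ^ n`, where `n > 0` is the number of crossings of pants
curves, in the trace at `τ = (t, …, t)`. As the trace is independent of every `τ i` that belongs to
a pants curve off which `γ` can be homotoped, up to sign, this coefficient is zero
(`trace_leading_eq_zero`). Hence the representative lies in a single pair of pants. The two arcs
next to the boundary component opposite to the seam that is crossed least often fit together, so
that the curve is parallel to this boundary component (`IsTight.exists_parallelToBoundary`), whose
holonomy is parabolic.
-/

namespace PantsDecomposition

variable {S : PantsDecomposition}

/-! ### Traces in `PSL(2, ℂ)` -/

theorem eq_or_eq_neg_of_pr_eq {A B : Matrix.SpecialLinearGroup (Fin 2) ℂ} (h : pr A = pr B) :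
    A = B ∨ A = -B := by
  have h' : A⁻¹ * B ∈ Subgroup.center (Matrix.SpecialLinearGroup (Fin 2) ℂ) :=
    QuotientGroup.eq.1 h
  obtain ⟨r, hr, h2⟩ := Matrix.SpecialLinearGroup.mem_center_iff.1 h'
  have hr' : r = 1 ∨ r = -1 := by
    rw [Fintype.card_fin] at hr
    rwa [sq, mul_self_eq_one_iff] at hr
  have hB : A⁻¹ * B = 1 ∨ A⁻¹ * B = -1 := by
    rcases hr' with rfl | rfl
    · left; apply Subtype.ext; rw [← h2]; simp
    · right; apply Subtype.ext; rw [← h2]; ext i j; fin_cases i <;> fin_cases j <;> simp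
  rcases hB with hB | hB
  · left; exact (inv_mul_eq_one.1 hB)
  · right
    have : B = A * -1 := by rw [← hB]; simp
    simp [this]

theorem trace_eq_or_eq_neg_of_isConj {A B : Matrix.SpecialLinearGroup (Fin 2) ℂ}
    (h : IsConj (pr A) (pr B)) : A.1.trace = B.1.trace ∨ A.1.trace = -B.1.trace := by
  obtain ⟨g, hg⟩ := isConj_iff.1 h
  obtain ⟨G, rfl⟩ := QuotientGroup.mk'_surjective _ g
  have h1 : pr (G * A * G⁻¹) = pr B := by rw [map_mul, map_mul, map_inv]; exact hg
  have h2 : (G * A * G⁻¹).1.trace = A.1.trace := by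
    simp only [Matrix.SpecialLinearGroup.coe_mul]
    rw [Matrix.trace_mul_comm, ← Matrix.mul_assoc, ← Matrix.SpecialLinearGroup.coe_mul]
    simp
  rcases eq_or_eq_neg_of_pr_eq h1 with h | h
  · left; rw [← h2, h]
  · right; rw [← h2, h]; simp

/-! ### Paths and their homotopies -/

/-- `l` is a path from the tile `x` to the tile `y`. -/
def IsPath : S.Tile → List S.Dart → S.Tile → Prop
  | x, [], y => x = y
  | x, d :: l, y => d.src = x ∧ IsPath d.tgt l y

theorem isPath_append {x y : S.Tile} {u v : List S.Dart} :
    IsPath x (u ++ v) y ↔ ∃ z, IsPath x u z ∧ IsPath z v y := by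
  induction u generalizing x with
  | nil => simp [IsPath]
  | cons d u ih => simp [IsPath, ih, and_assoc]

theorem isPath_iff_isChain {d : S.Dart} {l : List S.Dart} {y : S.Tile} :
    IsPath d.src (d :: l) y ↔
      List.IsChain (fun d e : S.Dart => d.tgt = e.src) (d :: l) ∧
        ((d :: l).getLast (by simp)).tgt = y := by
  induction l generalizing d with
  | nil => simp [IsPath]
  | cons e l ih =>
    rw [IsPath, List.isChain_cons_cons, List.getLast_cons (by simp), and_assoc, ← ih]
    simp only [true_and]
    constructor
    · intro h
      have := h.1
      exact ⟨this.symm, by rw [this]; exact h⟩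
    · rintro ⟨h1, h2⟩
      rw [h1]; exact h2

theorem isLoop_iff {l : List S.Dart} : S.IsLoop l ↔ ∃ x, IsPath x l x := by
  cases l with
  | nil => simp [IsLoop, IsPath]; exact ⟨⟨0, S.k_pos⟩⟩
  | cons d l =>
    rw [IsLoop, Cycle.chain_coe_cons]
    have h : List.IsChain (fun d e : S.Dart => d.tgt = e.src) (d :: (l ++ [d])) ↔
        IsPath d.src (d :: (l ++ [d])) d.tgt := by
      rw [isPath_iff_isChain]
      simp
    rw [h, ← List.cons_append, isPath_append]
    constructor
    · rintro ⟨z, h1, h2⟩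
      simp only [IsPath, and_true] at h2
      exact ⟨z, h2 ▸ h1⟩
    · rintro ⟨x, h⟩
      have : d.src = x := h.1
      subst this
      exact ⟨_, h, rfl, rfl⟩

theorem IsPath.isLoop {x : S.Tile} {l : List S.Dart} (h : IsPath x l x) : S.IsLoop l :=
  isLoop_iff.2 ⟨x, h⟩

theorem isLoop_append_comm {u v : List S.Dart} (h : S.IsLoop (u ++ v)) : S.IsLoop (v ++ u) := by
  obtain ⟨x, h⟩ := isLoop_iff.1 h
  obtain ⟨z, h1, h2⟩ := isPath_append.1 h
  exact isLoop_iff.2 ⟨z, isPath_append.2 ⟨x, h2, h1⟩⟩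

@[simp] theorem Dart.rev_rev (d : S.Dart) : d.rev.rev = d := by
  cases d <;> simp [Dart.rev]

theorem Dart.tgt_rev (d : S.Dart) : d.rev.tgt = d.src := by simp [Dart.tgt]

theorem Dart.src_rev (d : S.Dart) : d.rev.src = d.tgt := rfl

theorem FreelyHomotopic.refl (c : S.Loop) : FreelyHomotopic c c := Relation.EqvGen.refl c

theorem FreelyHomotopic.symm {c c' : S.Loop} (h : FreelyHomotopic c c') : FreelyHomotopic c' c :=
  Relation.EqvGen.symm _ _ h

theorem FreelyHomotopic.trans {c c' c'' : S.Loop} (h : FreelyHomotopic c c')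
    (h' : FreelyHomotopic c' c'') : FreelyHomotopic c c'' :=
  Relation.EqvGen.trans _ _ _ h h'

theorem freelyHomotopic_append_comm {u v : List S.Dart} (h : S.IsLoop (u ++ v)) :
    FreelyHomotopic ⟨u ++ v, h⟩ ⟨v ++ u, isLoop_append_comm h⟩ :=
  Relation.EqvGen.rel _ _ (Step.rotate u v h _)

/-- Homotopy of paths `u`, `v` from `x` to `y` relative to their endpoints, in the weak form that
suffices here: however they are closed up, the resulting closed paths are freely homotopic. -/
structure PathHomotopic (x y : S.Tile) (u v : List S.Dart) : Prop where
  left : IsPath x u y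
  right : IsPath x v y
  homotopic : ∀ r (h : S.IsLoop (u ++ r)) (h' : S.IsLoop (v ++ r)), IsPath y r x →
    FreelyHomotopic ⟨u ++ r, h⟩ ⟨v ++ r, h'⟩

namespace PathHomotopic

variable {x y z : S.Tile} {u v w : List S.Dart}

theorem symm (h : PathHomotopic x y u v) : PathHomotopic x y v u :=
  ⟨h.right, h.left, fun r h1 h2 hr => (h.homotopic r h2 h1 hr).symm⟩

theorem trans (h : PathHomotopic x y u v) (h' : PathHomotopic x y v w) :
    PathHomotopic x y u w :=
  ⟨h.left, h'.right, fun r h1 h2 hr =>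
    have h3 : S.IsLoop (v ++ r) := isLoop_iff.2 ⟨x, isPath_append.2 ⟨y, h.right, hr⟩⟩
    (h.homotopic r h1 h3 hr).trans (h'.homotopic r h3 h2 hr)⟩

theorem append_right (h : PathHomotopic x y u v) (hw : IsPath y w z) :
    PathHomotopic x z (u ++ w) (v ++ w) :=
  ⟨isPath_append.2 ⟨y, h.left, hw⟩, isPath_append.2 ⟨y, h.right, hw⟩, fun r h1 h2 hr => by
    simpa only [List.append_assoc] using h.homotopic (w ++ r) (by simpa using h1)
      (by simpa using h2) (isPath_append.2 ⟨z, hw, hr⟩)⟩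

theorem append_left (h : PathHomotopic x y u v) (hw : IsPath z w x) :
    PathHomotopic z y (w ++ u) (w ++ v) :=
  ⟨isPath_append.2 ⟨x, hw, h.left⟩, isPath_append.2 ⟨x, hw, h.right⟩, by
    intro r h1 h2 hr
    have h1' : S.IsLoop (w ++ (u ++ r)) := by simpa using h1
    have h2' : S.IsLoop (w ++ (v ++ r)) := by simpa using h2
    have e1 := freelyHomotopic_append_comm h1'
    have e2 := freelyHomotopic_append_comm h2'
    have h3 : S.IsLoop (u ++ (r ++ w)) := by simpa using isLoop_append_comm h1'
    have h4 : S.IsLoop (v ++ (r ++ w)) := by simpa using isLoop_append_comm h2'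
    have e3 := h.homotopic (r ++ w) h3 h4 (isPath_append.2 ⟨z, hr, hw⟩)
    simp only [List.append_assoc] at e1 e2 e3 ⊢
    exact e1.trans (e3.trans e2.symm)⟩

theorem freelyHomotopic (h : PathHomotopic x x u v) (hu : S.IsLoop u) (hv : S.IsLoop v) :
    FreelyHomotopic ⟨u, hu⟩ ⟨v, hv⟩ := by
  simpa using h.homotopic [] (by simpa using hu) (by simpa using hv) rfl

theorem backtrack (d : S.Dart) : PathHomotopic d.src d.src [d, d.rev] [] :=
  ⟨⟨rfl, rfl, d.tgt_rev⟩, rfl, fun r h h' _ => Relation.EqvGen.rel _ _ (Step.backtrack d r h h')⟩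

theorem isPath_vertexLoop (i : Fin S.ξ) (b : Bool) :
    IsPath ((S.side i b).1, true) (vertexLoop i b) ((S.side i b).1, true) := by
  simp [vertexLoop, IsPath, Dart.src, Dart.tgt, Dart.rev]

theorem vertexLoop (i : Fin S.ξ) (b : Bool) :
    PathHomotopic ((S.side i b).1, true) ((S.side i b).1, true) (vertexLoop i b) [] :=
  ⟨isPath_vertexLoop i b, rfl,
    fun r h h' _ => Relation.EqvGen.rel _ _ (Step.vertex i b r h h')⟩

/-- A null-homotopic closed path remains so if its first edge is moved to the end. -/
theorem rotate_null {d : S.Dart} (h : PathHomotopic x x (d :: u) []) :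
    PathHomotopic d.tgt d.tgt (u ++ [d]) [] := by
  obtain ⟨rfl, hu⟩ := h.left
  have e1 := (h.append_right (w := [d]) ⟨rfl, rfl⟩).append_left (w := [d.rev]) (z := d.tgt)
    ⟨rfl, d.tgt_rev⟩
  have e2 := backtrack d.rev
  rw [Dart.rev_rev, Dart.src_rev] at e2
  have e3 := e2.append_right (w := u ++ [d]) (isPath_append.2 ⟨_, hu, rfl, rfl⟩)
  exact e3.symm.trans (by simpa using e1.trans (by simpa using e2))

/-- Two paths with a common last edge are homotopic if they are without it. -/
theorem of_append_rev {d : S.Dart} (hd : d.tgt = y) (hv : IsPath x v y)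
    (h : PathHomotopic x d.src (v ++ [d.rev]) u) : PathHomotopic x y v (u ++ [d]) := by
  subst hd
  have e1 := h.append_right (w := [d]) ⟨rfl, rfl⟩
  have e2 := backtrack d.rev
  rw [Dart.rev_rev, Dart.src_rev] at e2
  have e3 := e2.append_left hv
  simp only [List.append_assoc, List.append_nil, List.cons_append, List.nil_append] at e1 e3
  exact e3.symm.trans e1

end PathHomotopic

/-- Pushing a path across a vertex of the tiling on the `i`-th pants curve: instead of crossing the
pants curve first and then a seam adjacent to the vertex, it crosses the seam on the other side
first. -/
theorem pathHomotopic_push (i : Fin S.ξ) (b c o : Bool) :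
    PathHomotopic ((S.side i b).1, c) ((S.side i !b).1, !c)
      [.cross i b c, .seam (S.side i !b).1 (seamAt (S.side i !b).2 o) c]
      [.seam (S.side i b).1 (seamAt (S.side i b).2 !o) c, .cross i b !c] := by
  have key : ∀ d₁ d₂ d₃ d₄ : S.Dart, ∀ x, PathHomotopic x x [d₁, d₂, d₃, d₄] [] →
      PathHomotopic x d₂.tgt [d₁, d₂] [d₄.rev, d₃.rev] := by
    intro d₁ d₂ d₃ d₄ x h
    obtain ⟨rfl, h2, h3, h4, h5⟩ := h.left
    have e : PathHomotopic d₁.src d₃.tgt [d₁, d₂, d₃] [d₄.rev] := by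
      refine PathHomotopic.of_append_rev (d := d₄.rev) (u := []) (by rw [Dart.tgt_rev, h4])
        ⟨rfl, h2, h3, rfl⟩ ?_
      rw [Dart.src_rev, Dart.rev_rev, h5]
      exact h
    have e' := PathHomotopic.of_append_rev (d := d₃.rev) (u := [d₄.rev]) (v := [d₁, d₂])
      (x := d₁.src) (y := d₂.tgt)
      (by rw [Dart.tgt_rev, h3]) ⟨rfl, h2, rfl⟩ (by rw [Dart.src_rev, Dart.rev_rev]; exact e)
    exact e'
  have null : ∀ i b, PathHomotopic ((S.side i b).1, true) ((S.side i b).1, true)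
    [.seam (S.side i b).1 (seamAt (S.side i b).2 true) true,
     .cross i b false,
     .seam (S.side i (!b)).1 (seamAt (S.side i (!b)).2 false) false,
     .cross i (!b) true] [] := PathHomotopic.vertexLoop (S := S)
  have null₁ := null i b
  have null₂ := null i !b
  rw [Bool.not_not] at null₂
  cases c <;> cases o
  · have h := (key _ _ _ _ _ null₁.rotate_null)
    simpa [Dart.tgt, Dart.src, Dart.rev] using h
  · have h := (key _ _ _ _ _ null₂.rotate_null.rotate_null).symm
    simpa [Dart.tgt, Dart.src, Dart.rev] using h
  · have h := (key _ _ _ _ _ null₁).symm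
    simpa [Dart.tgt, Dart.src, Dart.rev] using h
  · have h := (key _ _ _ _ _ null₂.rotate_null.rotate_null.rotate_null)
    simpa [Dart.tgt, Dart.src, Dart.rev] using h

/-- The two sides of a pants curve are freely homotopic, with opposite directions. -/
theorem freelyHomotopic_boundaryLoop (i : Fin S.ξ) (b dir : Bool) :
    FreelyHomotopic (S.boundaryLoop (S.side i b).1 (S.side i b).2 dir)
      (S.boundaryLoop (S.side i !b).1 (S.side i !b).2 !dir) := by
  have h₁ := pathHomotopic_push i b true !dir
  have h₂ := pathHomotopic_push i (!b) false !dir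
  simp only [Bool.not_not, Bool.not_true, Bool.not_false] at h₁ h₂
  set A : S.Dart := .seam (S.side i b).1 (seamAt (S.side i b).2 dir) true
  set B : S.Dart := .seam (S.side i b).1 (seamAt (S.side i b).2 !dir) false
  set A' : S.Dart := .seam (S.side i !b).1 (seamAt (S.side i !b).2 !dir) true
  set B' : S.Dart := .seam (S.side i !b).1 (seamAt (S.side i !b).2 dir) false
  have e₁ : PathHomotopic A.src A.src ([A] ++ [.cross i b false, .cross i (!b) false] ++ [B])
      ([A] ++ [] ++ [B]) :=
    ((PathHomotopic.backtrack (.cross i b false)).append_left (w := [A])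
      ⟨rfl, rfl⟩).append_right (w := [B]) ⟨rfl, rfl⟩
  have e₂ : PathHomotopic A.src A.src ([.cross i b true, A'] ++ [.cross i (!b) false, B])
      ([A, .cross i b false] ++ [.cross i (!b) false, B]) :=
    h₁.append_right ⟨rfl, by simp [IsPath, B, A, Dart.src, Dart.tgt, Dart.rev]⟩
  have e₃ : PathHomotopic A.src A.src ([.cross i b true, A'] ++ [.cross i (!b) false, B])
      ([.cross i b true, A'] ++ [B', .cross i (!b) true]) :=
    h₂.append_left ⟨rfl, by simp [IsPath, A', Dart.src, Dart.tgt, Dart.rev]⟩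
  have e : PathHomotopic A.src A.src [A, B] [.cross i b true, A', B', .cross i (!b) true] := by
    simpa using e₁.symm.trans (e₂.symm.trans e₃)
  have f₁ := e.freelyHomotopic e.left.isLoop e.right.isLoop
  have f₂ := freelyHomotopic_append_comm (u := [Dart.cross i b true, A', B'])
    (v := [Dart.cross i (!b) true]) e.right.isLoop
  have f₃ : PathHomotopic A'.src A'.src [.cross i (!b) true, .cross i b true] [] := by
    have h := PathHomotopic.backtrack (S := S) (.cross i (!b) true)
    simp only [Dart.rev, Bool.not_not] at h
    exact h
  have f₄ := f₃.append_right (w := [A', B']) (z := A'.src)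
    ⟨rfl, by simp [IsPath, A', B', Dart.src, Dart.tgt, Dart.rev]⟩
  refine (f₁.trans (f₂.trans (f₄.freelyHomotopic f₄.left.isLoop f₄.right.isLoop))).trans ?_
  simp only [boundaryLoop, Bool.not_not]
  exact FreelyHomotopic.refl _

theorem ParallelToBoundary.parallelToPantsCurve {γ : S.Loop} {i : Fin S.ξ} {b : Bool}
    (h : ParallelToBoundary γ (S.side i b)) : ParallelToPantsCurve γ i := by
  cases b
  · obtain ⟨dir, h⟩ := h
    exact ⟨!dir, h.trans (freelyHomotopic_boundaryLoop i false dir)⟩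
  · exact h

/-! ### The trace of the holonomy -/

/-- The product of the overlap maps along a path, as an element of `SL(2, ℂ)`. -/
def overlapProd (τ : Fin S.ξ → ℂ) (l : List S.Dart) : Matrix.SpecialLinearGroup (Fin 2) ℂ :=
  (l.map (overlapMap τ)).prod

/-- The square of the trace of the holonomy is a homotopy invariant. -/
theorem trace_sq_eq {γ γ' : S.Loop} (h : FreelyHomotopic γ γ') (τ : Fin S.ξ → ℂ) :
    (overlapProd τ γ.1).1.trace ^ 2 = (overlapProd τ γ'.1).1.trace ^ 2 :=
  sq_eq_sq_iff_eq_or_eq_neg.2 (trace_eq_or_eq_neg_of_isConj (holonomy_isConj τ h))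

theorem pr_seamMap_boundary (ε : Fin 3) :
    pr (seamMap (ε + 2)) * (pr (seamMap (ε + 1)))⁻¹ =
      (pr (Ω ε))⁻¹ * pr (T (-2)) * pr (Ω ε) := by
  rw [mul_assoc, eq_inv_mul_iff_mul_eq]
  rcases seamMap_boundary ε with h | h
  · simpa using congrArg pr h
  · have := congrArg pr h
    rw [pr_neg] at this
    simpa using this

/-- The holonomy of a boundary component is a translation, up to conjugation and sign. -/
theorem isParabolic_of_parallelToBoundary {γ : S.Loop} {β : Fin S.k × Fin 3}
    (h : ParallelToBoundary γ β) (τ : Fin S.ξ → ℂ) (A : Matrix.SpecialLinearGroup (Fin 2) ℂ)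
    (hA : (A : Matrix.ProjectiveSpecialLinearGroup (Fin 2) ℂ) = holonomy τ γ) :
    A.1.IsParabolic ∧ (A.1.trace = 2 ∨ A.1.trace = -2) := by
  obtain ⟨dir, h⟩ := h
  have hc := holonomy_isConj τ h
  obtain ⟨x, hx, hT⟩ : ∃ x : ℂ, x ≠ 0 ∧ IsConj (pr (T x)) (holonomy τ γ) := by
    have key := pr_seamMap_boundary β.2
    cases dir
    · refine ⟨2, two_ne_zero, IsConj.trans ?_ hc.symm⟩
      have h2 : pr (T 2) = (pr (T (-2)))⁻¹ := by
        rw [eq_inv_iff_mul_eq_one, ← map_mul]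
        have : T 2 * T (-2) = 1 := by
          apply Subtype.ext
          rw [Matrix.SpecialLinearGroup.coe_mul]
          simp [T, Matrix.one_fin_two]
        rw [this, map_one]
      rw [h2, holonomy_eq_prod]
      simp only [boundaryLoop, overlapMap, seamAt, List.map_cons, List.map_nil, List.prod_cons,
        List.prod_nil, mul_one, map_inv]
      simp only [Bool.false_eq_true, if_false, Bool.not_false, if_true]
      have key' := congrArg (·⁻¹) key
      simp only [mul_inv_rev, inv_inv] at key'
      rw [key']
      exact isConj_iff.2 ⟨(pr (Ω β.2))⁻¹, by group⟩
    · refine ⟨-2, by simp, IsConj.trans ?_ hc.symm⟩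
      rw [holonomy_eq_prod]
      simp only [boundaryLoop, overlapMap, seamAt, List.map_cons, List.map_nil, List.prod_cons,
        List.prod_nil, mul_one, map_inv]
      simp only [Bool.not_true, Bool.false_eq_true, if_false, if_true]
      rw [key]
      exact isConj_iff.2 ⟨(pr (Ω β.2))⁻¹, by group⟩
  rw [← hA] at hT
  obtain ⟨g, hg⟩ := isConj_iff.1 hT
  obtain ⟨G, rfl⟩ := QuotientGroup.mk'_surjective _ g
  have h1 : pr (G * T x * G⁻¹) = pr A := by rw [map_mul, map_mul, map_inv]; exact hg
  have hp : (T x).1.IsParabolic := by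
    rw [Matrix.isParabolic_iff_of_upperTriangular (by simp [T])]
    exact ⟨by simp [T], by simpa [T] using hx⟩
  have htr : (T x).1.trace = 2 := by simp [T, Matrix.trace_fin_two]; norm_num
  have h2 : (G * T x * G⁻¹).1.trace = 2 := by
    simp only [Matrix.SpecialLinearGroup.coe_mul]
    rw [Matrix.trace_mul_comm, ← Matrix.mul_assoc, ← Matrix.SpecialLinearGroup.coe_mul]
    simpa using htr
  have h3 : (G * T x * G⁻¹).1.IsParabolic := by
    have := (Matrix.isParabolic_conj_iff (m := (T x).1)
      (Matrix.SpecialLinearGroup.toGL G)).2 hp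
    rw [← Matrix.coe_units_inv] at this
    exact this
  rcases eq_or_eq_neg_of_pr_eq h1 with h | h
  · rw [← h]; exact ⟨h3, Or.inl h2⟩
  · have hA' : A = -(G * T x * G⁻¹) := by rw [h, neg_neg]
    rw [hA']
    exact ⟨h3.neg, Or.inr (by rw [Matrix.SpecialLinearGroup.coe_neg, Matrix.trace_neg, h2])⟩

/-! ### Top terms of traces of products of linear matrices -/

section TopTerms

open MvPolynomial

variable {σ : Type*}

/-- The polynomials all of whose monomials divide the monomial with exponents `n`, and have total
degree at least `e` less than it. -/
noncomputable def lowerTerms (n : σ →₀ ℕ) (e : ℕ) : Submodule ℂ (MvPolynomial σ ℂ) :=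
  restrictSupport ℂ {m | m ≤ n ∧ m.degree + e ≤ n.degree}

theorem lowerTerms_anti (n : σ →₀ ℕ) {e e' : ℕ} (h : e ≤ e') :
    lowerTerms n e' ≤ lowerTerms n e :=
  restrictSupport_mono _ fun _ hm => ⟨hm.1, by have := hm.2; omega⟩

theorem X_mul_mem_lowerTerms {n : σ →₀ ℕ} {e : ℕ} {p : MvPolynomial σ ℂ} (i : σ)
    (hp : p ∈ lowerTerms n e) : X i * p ∈ lowerTerms (Finsupp.single i 1 + n) e := by
  rw [lowerTerms, mem_restrictSupport_iff] at hp ⊢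
  rw [support_X_mul]
  intro m hm
  simp only [Finset.coe_map, addLeftEmbedding_apply, Set.mem_image, SetLike.mem_coe] at hm
  obtain ⟨m, hm, rfl⟩ := hm
  obtain ⟨h1, h2⟩ := hp hm
  refine ⟨by gcongr, ?_⟩
  simp only [map_add, Finsupp.degree_single] at h2 ⊢
  omega

theorem lowerTerms_le_add (n : σ →₀ ℕ) (e : ℕ) (i : σ) :
    lowerTerms n e ≤ lowerTerms (Finsupp.single i 1 + n) (e + 1) :=
  restrictSupport_mono _ fun m hm =>
    ⟨hm.1.trans le_add_self, by
      have := hm.2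
      simp only [map_add, Finsupp.degree_single] at this ⊢
      omega⟩

theorem C_mul_mem_lowerTerms {n : σ →₀ ℕ} {e : ℕ} {p : MvPolynomial σ ℂ} (a : ℂ)
    (hp : p ∈ lowerTerms n e) : C a * p ∈ lowerTerms n e := by
  rw [C_mul']; exact Submodule.smul_mem _ _ hp

theorem monomial_mem_lowerTerms (n : σ →₀ ℕ) (a : ℂ) : monomial n a ∈ lowerTerms n 0 :=
  (monomial_mem_restrictSupport ℂ).2 (Or.inl ⟨le_rfl, le_rfl⟩)

/-- The exponents of the product of the variables that occur in a list. -/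
noncomputable def exponents : List (σ × ℂˣ × ℂ) → σ →₀ ℕ
  | [] => 0
  | x :: l => Finsupp.single x.1 1 + exponents l

theorem exponents_apply [DecidableEq σ] (l : List (σ × ℂˣ × ℂ)) (i : σ) :
    exponents l i = l.countP (fun x => x.1 = i) := by
  induction l with
  | nil => simp [exponents]
  | cons x l ih =>
    simp only [exponents, Finsupp.add_apply, ih, List.countP_cons, Finsupp.single_apply]
    simp [add_comm]

/-- The sum of the translation lengths that belong to the variable `i`. -/
noncomputable def totalShift [DecidableEq σ] (l : List (σ × ℂˣ × ℂ)) (i : σ) : ℂ :=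
  (l.map fun x => if x.1 = i then x.2.2 else 0).sum

/-- The product of the matrices `(1, X i + u; 0, 1) (0, -1/c; c, 0)`. -/
noncomputable def polyProd (l : List (σ × ℂˣ × ℂ)) : Matrix (Fin 2) (Fin 2) (MvPolynomial σ ℂ) :=
  (l.map fun x => !![C (x.2.1 : ℂ) * (X x.1 + C x.2.2), -C ((x.2.1 : ℂ)⁻¹);
    C (x.2.1 : ℂ), 0]).prod

/-- The product of the upper left entries of the matrices in `polyProd`. -/
noncomputable def linearProd (l : List (σ × ℂˣ × ℂ)) : MvPolynomial σ ℂ :=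
  (l.map fun x => X x.1 + C x.2.2).prod

/-- The product of the constants `c`. -/
noncomputable def constProd (l : List (σ × ℂˣ × ℂ)) : ℂ := (l.map fun x => (x.2.1 : ℂ)).prod

theorem linearProd_mem (l : List (σ × ℂˣ × ℂ)) : linearProd l ∈ lowerTerms (exponents l) 0 := by
  induction l with
  | nil => simpa [linearProd, exponents] using monomial_mem_lowerTerms (0 : σ →₀ ℕ) 1
  | cons x l ih =>
    have : linearProd (x :: l) = X x.1 * linearProd l + C x.2.2 * linearProd l := by
      simp [linearProd, add_mul]
    rw [this]
    exact add_mem (X_mul_mem_lowerTerms _ ih) (lowerTerms_anti _ (Nat.zero_le _)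
      (lowerTerms_le_add _ _ _ (C_mul_mem_lowerTerms _ ih)))

theorem polyProd_mem (l : List (σ × ℂˣ × ℂ)) :
    polyProd l 0 0 - C (constProd l) * linearProd l ∈ lowerTerms (exponents l) 2 ∧
    polyProd l 0 1 ∈ lowerTerms (exponents l) 1 ∧
    polyProd l 1 0 ∈ lowerTerms (exponents l) 1 ∧
    polyProd l 1 1 ∈ lowerTerms (exponents l) (if l = [] then 0 else 2) := by
  induction l with
  | nil => simpa [polyProd, constProd, linearProd, exponents] using
      monomial_mem_lowerTerms (0 : σ →₀ ℕ) 1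
  | cons x l ih =>
    obtain ⟨h00, h01, h10, h11⟩ := ih
    have h11 := lowerTerms_anti _ (Nat.zero_le _) h11
    have hA : polyProd l 0 0 ∈ lowerTerms (exponents l) 0 := by
      have := add_mem (lowerTerms_anti _ (Nat.zero_le _) h00)
        (C_mul_mem_lowerTerms (constProd l) (linearProd_mem l))
      simpa using this
    obtain ⟨i, c, u⟩ := x
    have e : polyProd ((i, c, u) :: l) =
        !![C (c : ℂ) * (X i + C u), -C ((c : ℂ)⁻¹); C (c : ℂ), 0] * polyProd l := by
      simp [polyProd]
    have hc : constProd ((i, c, u) :: l) = c * constProd l := by simp [constProd]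
    have hl : linearProd ((i, c, u) :: l) = (X i + C u) * linearProd l := by simp [linearProd]
    have hn : exponents ((i, c, u) :: l) = Finsupp.single i 1 + exponents l := rfl
    have lin : ∀ {e p}, p ∈ lowerTerms (exponents l) e →
        C (c : ℂ) * (X i + C u) * p ∈ lowerTerms (Finsupp.single i 1 + exponents l) e := by
      intro e p hp
      rw [mul_assoc, add_mul]
      exact C_mul_mem_lowerTerms _ (add_mem (X_mul_mem_lowerTerms _ hp)
        (lowerTerms_anti _ (Nat.le_succ _) (lowerTerms_le_add _ _ _ (C_mul_mem_lowerTerms _ hp))))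
    have const : ∀ {e p} (a : ℂ), p ∈ lowerTerms (exponents l) e →
        C a * p ∈ lowerTerms (Finsupp.single i 1 + exponents l) (e + 1) :=
      fun a hp => lowerTerms_le_add _ _ _ (C_mul_mem_lowerTerms _ hp)
    rw [e, hc, hl, hn]
    simp only [Matrix.mul_apply, Fin.sum_univ_two, Matrix.of_apply, Matrix.cons_val_zero,
      Matrix.cons_val_one, Matrix.cons_val', Matrix.cons_val_fin_one, zero_mul,
      add_zero, reduceCtorEq, if_false]
    refine ⟨?_, ?_, const _ hA, const _ h01⟩
    · have := sub_mem (lin h00) (const ((c : ℂ)⁻¹) h10)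
      convert this using 1
      rw [C_mul]; ring
    · have := sub_mem (lin h01) (const ((c : ℂ)⁻¹) h11)
      convert this using 1
      ring

theorem exponents_map (l : List (σ × ℂˣ × ℂ)) (g : σ × ℂˣ × ℂ → ℂ) :
    exponents (l.map fun x => (x.1, x.2.1, g x)) = exponents l := by
  induction l with
  | nil => rfl
  | cons x l ih => simp only [List.map_cons, exponents, ih]

theorem totalShift_eq_zero [DecidableEq σ] {l : List (σ × ℂˣ × ℂ)} {i : σ} (h : exponents l i = 0) :
    totalShift l i = 0 := by
  rw [exponents_apply, List.countP_eq_zero] at h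
  refine List.sum_eq_zero fun y hy => ?_
  obtain ⟨x, hx, rfl⟩ := List.mem_map.1 hy
  have := h x hx
  simp_all

variable [DecidableEq σ] [Fintype σ]

/-- The two top terms of a product of linear polynomials. -/
theorem linearProd_sub_mem (l : List (σ × ℂˣ × ℂ)) :
    linearProd l - (monomial (exponents l) 1 +
      ∑ i, monomial (exponents l - Finsupp.single i 1) (totalShift l i)) ∈
        lowerTerms (exponents l) 2 := by
  induction l with
  | nil => simp [linearProd, exponents, totalShift]
  | cons x l ih =>
    obtain ⟨j, c, u⟩ := x
    have hl : linearProd ((j, c, u) :: l) = (X j + C u) * linearProd l := by simp [linearProd]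
    have hn : exponents ((j, c, u) :: l) = Finsupp.single j 1 + exponents l := rfl
    set n := exponents l with hn'
    set s := ∑ i, monomial (n - Finsupp.single i 1) (totalShift l i) with hs
    have hs1 : s ∈ lowerTerms n 1 := by
      refine Submodule.sum_mem _ fun i _ => (monomial_mem_restrictSupport ℂ).2 ?_
      by_cases hi : n i = 0
      · exact Or.inr (totalShift_eq_zero hi)
      · refine Or.inl ⟨tsub_le_self, ?_⟩
        have : n - Finsupp.single i 1 + Finsupp.single i 1 = n :=
          tsub_add_cancel_of_le (Finsupp.single_le_iff.2 (Nat.one_le_iff_ne_zero.2 hi))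
        have := congrArg Finsupp.degree this
        rw [map_add, Finsupp.degree_single] at this
        exact this.le
    have key : monomial (Finsupp.single j 1 + n) 1 +
        ∑ i, monomial (Finsupp.single j 1 + n - Finsupp.single i 1)
          (totalShift ((j, c, u) :: l) i) =
        X j * (monomial n 1 + s) + C u * monomial n 1 := by
      have h1 : ∀ i, monomial (Finsupp.single j 1 + n - Finsupp.single i 1)
          (totalShift ((j, c, u) :: l) i) =
          X j * monomial (n - Finsupp.single i 1) (totalShift l i) +
            if j = i then monomial n u else 0 := by
        intro i
        have h2 : totalShift ((j, c, u) :: l) i = totalShift l i + if j = i then u else 0 := by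
          simp [totalShift, add_comm]
        rw [h2, map_add, X, monomial_mul, one_mul]
        congr 1
        · by_cases hi : n i = 0
          · rw [totalShift_eq_zero hi]; simp
          · rw [add_tsub_assoc_of_le (Finsupp.single_le_iff.2 (Nat.one_le_iff_ne_zero.2 hi))]
        · split_ifs with h
          · rw [h, add_tsub_cancel_left]
          · simp
      simp only [h1, Finset.sum_add_distrib, Finset.sum_ite_eq, Finset.mem_univ, if_true,
        ← Finset.mul_sum]
      rw [← hs, mul_add, C_mul_monomial, mul_one, X, monomial_mul, one_mul]
      ring
    rw [hl, hn, key]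
    have := add_mem (X_mul_mem_lowerTerms j ih) (add_mem
      (lowerTerms_anti _ (by norm_num) (lowerTerms_le_add _ _ j (C_mul_mem_lowerTerms u ih)))
      (lowerTerms_le_add _ _ j (C_mul_mem_lowerTerms u hs1)))
    convert this using 1
    ring

theorem linearProd_map (l : List (σ × ℂˣ × ℂ)) (g : σ → ℂ) :
    linearProd (l.map fun x => (x.1, x.2.1, g x.1)) =
      ∏ i, (X i + C (g i)) ^ l.countP (fun x => x.1 = i) := by
  induction l with
  | nil => simp [linearProd]
  | cons x l ih =>
    have : linearProd ((x :: l).map fun x => (x.1, x.2.1, g x.1)) =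
        (X x.1 + C (g x.1)) * linearProd (l.map fun x => (x.1, x.2.1, g x.1)) := by
      simp [linearProd]
    rw [this, ih]
    simp only [List.countP_cons, pow_add, Finset.prod_mul_distrib]
    rw [mul_comm]
    congr 1
    simp [pow_ite]

theorem monomial_eq_prod_erase (n : σ →₀ ℕ) (i : σ) (a : ℂ) :
    monomial (n - Finsupp.single i 1) a =
      C a * (X i ^ (n i - 1) * ∏ j ∈ Finset.univ.erase i, X j ^ n j) := by
  rw [monomial_eq, Finsupp.prod_fintype _ _ (by simp),
    ← Finset.mul_prod_erase _ _ (Finset.mem_univ i)]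
  congr 2
  · simp
  · refine Finset.prod_congr rfl fun j hj => ?_
    rw [Finsupp.tsub_apply, Finsupp.single_eq_of_ne (Finset.ne_of_mem_erase hj), tsub_zero]

/-- The two top terms of the trace of `polyProd l`, in both of the usual forms. -/
theorem trace_polyProd {l : List (σ × ℂˣ × ℂ)} (hl : l ≠ []) {q : σ → ℕ} {s : σ → ℂ}
    (hq : ∀ i, l.countP (fun x => x.1 = i) = q i) (hs : ∀ i, totalShift l i = s i) :
    ∃ R R' : MvPolynomial σ ℂ,
      (polyProd l).trace = C (constProd l) * ∏ i, (X i + C (s i / q i)) ^ q i + R ∧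
      (polyProd l).trace = C (constProd l) * (∏ i, X i ^ q i +
        ∑ i, C (s i) * (X i ^ (q i - 1) * ∏ j ∈ Finset.univ.erase i, X j ^ q j)) + R' ∧
      (∀ m ∈ R.support, (∑ i, m i) + 2 ≤ ∑ i, q i ∧ ∀ i, m i ≤ q i) ∧
      (∀ m ∈ R'.support, (∑ i, m i) + 2 ≤ ∑ i, q i ∧ ∀ i, m i ≤ q i) := by
  have hn : ∀ i, exponents l i = q i := fun i => (exponents_apply l i).trans (hq i)
  have supp : ∀ R ∈ lowerTerms (exponents l) 2, ∀ m ∈ R.support,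
      (∑ i, m i) + 2 ≤ ∑ i, q i ∧ ∀ i, m i ≤ q i := by
    intro R hR m hm
    obtain ⟨h1, h2⟩ := (mem_restrictSupport_iff ℂ).1 hR hm
    rw [Finsupp.degree_eq_sum, Finsupp.degree_eq_sum] at h2
    simp only [hn] at h2
    exact ⟨h2, fun i => (h1 i).trans (hn i).le⟩
  have htr : (polyProd l).trace - C (constProd l) * linearProd l ∈
      lowerTerms (exponents l) 2 := by
    obtain ⟨h00, -, -, h11⟩ := polyProd_mem l
    rw [if_neg hl] at h11
    rw [Matrix.trace_fin_two, add_sub_right_comm]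
    exact add_mem h00 h11
  have hlin := linearProd_sub_mem l
  set l' := l.map fun x => (x.1, x.2.1, s x.1 / q x.1) with hl'
  have hlin' := linearProd_sub_mem l'
  have hshift : ∀ i, totalShift l' i = totalShift l i := by
    intro i
    have : totalShift l' i = l.countP (fun x => x.1 = i) * (s i / q i) := by
      rw [hl']
      clear hq hs hn supp htr hlin hlin' hl' hl l'
      induction l with
      | nil => simp [totalShift]
      | cons x l ih =>
        simp only [totalShift, List.map_cons, List.sum_cons, List.countP_cons] at ih ⊢
        rw [ih]
        by_cases h : x.1 = i
        · simp [h]; ring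
        · simp [h]
    rw [this, hs, hq]
    by_cases h : q i = 0
    · rw [h, ← hs, totalShift_eq_zero (by rw [hn, h])]; simp
    · field_simp
  rw [exponents_map] at hlin'
  simp only [hshift] at hlin'
  have hprod : linearProd l' = ∏ i, (X i + C (s i / q i)) ^ q i := by
    rw [hl', linearProd_map l fun i => s i / q i]
    simp only [hq]
  have hmon : monomial (exponents l) 1 +
      ∑ i, monomial (exponents l - Finsupp.single i 1) (totalShift l i) =
      ∏ i, X i ^ q i +
        ∑ i, C (s i) * (X i ^ (q i - 1) * ∏ j ∈ Finset.univ.erase i, X j ^ q j) := by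
    simp only [monomial_eq_prod_erase, hn, hs]
    congr 1
    rw [monomial_eq, Finsupp.prod_fintype _ _ (by simp)]
    simp [hn]
  refine ⟨_, _, (add_sub_cancel _ _).symm, (add_sub_cancel _ _).symm, supp _ ?_, supp _ ?_⟩
  · have := add_mem htr (C_mul_mem_lowerTerms (constProd l) (sub_mem hlin hlin'))
    rw [← hprod]
    convert this using 1
    ring
  · have := add_mem htr (C_mul_mem_lowerTerms (constProd l) hlin)
    rw [← hmon]
    convert this using 1
    ring

end TopTerms

/-! ### The holonomy of a curve in standard position -/

theorem coe_T (x : ℂ) : (T x : Matrix (Fin 2) (Fin 2) ℂ) = !![1, x; 0, 1] := rfl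

theorem coe_J_inv : ((J⁻¹ : Matrix.SpecialLinearGroup (Fin 2) ℂ) : Matrix (Fin 2) (Fin 2) ℂ) =
    !![Complex.I, 0; 0, -Complex.I] := by
  rw [Matrix.SpecialLinearGroup.coe_inv]
  simp [J, Matrix.adjugate_fin_two]

theorem T_add (x y : ℂ) : T (x + y) = T x * T y := by
  apply Subtype.ext
  simp [Matrix.SpecialLinearGroup.coe_mul, coe_T, add_comm]

theorem T_zero : T 0 = 1 := by
  apply Subtype.ext
  simp [coe_T, Matrix.one_fin_two]

theorem T_neg (x : ℂ) : T (-x) = (T x)⁻¹ := by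
  rw [eq_inv_iff_mul_eq_one, ← T_add, neg_add_cancel, T_zero]

theorem T_mul_J_inv (x : ℂ) : T x * J⁻¹ = J⁻¹ * (T x)⁻¹ := by
  rw [← T_neg]
  apply Subtype.ext
  rw [Matrix.SpecialLinearGroup.coe_mul, Matrix.SpecialLinearGroup.coe_mul, coe_T, coe_T, coe_J_inv]
  simp [mul_comm]

theorem pr_seamMap_boundary_inv (ε : Fin 3) :
    pr (seamMap (ε + 1)) * (pr (seamMap (ε + 2)))⁻¹ =
      (pr (Ω ε))⁻¹ * pr (T 2) * pr (Ω ε) := by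
  have := congrArg (·⁻¹) (pr_seamMap_boundary ε)
  simp only [mul_inv_rev, inv_inv, T_neg, map_inv, ← mul_assoc] at this
  exact this

theorem overlapProd_append (τ : Fin S.ξ → ℂ) (u v : List S.Dart) :
    overlapProd τ (u ++ v) = overlapProd τ u * overlapProd τ v := by
  simp [overlapProd]

/-- The translation length, in the coordinate where the boundary component is at `∞`, of the
motion across `n` rungs from the sector `a`. In the coordinates of the white triangle only the
passages through the black hexagon count, by `2` each. -/
def turnShift (a : Bool) (n : ℤ) : ℤ :=
  n + (if a then 0 else 1) - if (if Even n then !a else a) then 1 else 0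

theorem turnShift_true_add_one (n : ℤ) : turnShift true (n + 1) = turnShift false n := by
  rcases Int.even_or_odd n with h | h
  · simp [turnShift, h]
  · have h' := Int.not_even_iff_odd.2 h
    simp [turnShift, h']

theorem turnShift_false_add_one (n : ℤ) : turnShift false (n + 1) = 2 + turnShift true n := by
  have h : turnShift false (n + 1) = turnShift true (n + 1 + 1) := (turnShift_true_add_one _).symm
  rw [h]
  have h2 : Even (n + 1 + 1) ↔ Even n := by simp
  simp only [turnShift, h2]
  ring

theorem pr_overlapProd_turnRight (τ : Fin S.ξ → ℂ) (P : Fin S.k) (ε : Fin 3) (a : Bool) (n : ℕ) :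
    pr (overlapProd τ (turnRight P ε a n)) =
      (pr (Ω ε))⁻¹ * pr (T (turnShift a n : ℤ)) * pr (Ω ε) := by
  induction n generalizing a with
  | zero => cases a <;> simp [turnRight, overlapProd, turnShift, T_zero]
  | succ n ih =>
    rw [Nat.cast_succ]
    cases a
    · have e : overlapProd τ (turnRight P ε false (n + 1)) =
          seamMap (ε + 1) * (seamMap (ε + 2))⁻¹ * overlapProd τ (turnRight P ε true n) := by
        simp [turnRight, overlapProd, overlapMap, seamAt, mul_assoc]
      rw [e, map_mul, map_mul, map_inv, pr_seamMap_boundary_inv, ih, turnShift_false_add_one]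
      push_cast
      rw [T_add, map_mul]
      group
    · rw [turnShift_true_add_one, turnRight, ih]

theorem pr_overlapProd_turnLeft (τ : Fin S.ξ → ℂ) (P : Fin S.k) (ε : Fin 3) (a : Bool) (n : ℕ) :
    pr (overlapProd τ (turnLeft P ε a n)) =
      (pr (Ω ε))⁻¹ * pr (T (turnShift a (-n) : ℤ)) * pr (Ω ε) := by
  induction n generalizing a with
  | zero => cases a <;> simp [turnLeft, overlapProd, turnShift, T_zero]
  | succ n ih =>
    have hn : (-n : ℤ) = -(n + 1 : ℕ) + 1 := by push_cast; ring
    cases a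
    · rw [← turnShift_true_add_one, ← hn, turnLeft, ih]
    · have h : turnShift true (-(n + 1 : ℕ)) = -2 + turnShift false (-n) := by
        rw [hn, turnShift_false_add_one]; ring
      have e : overlapProd τ (turnLeft P ε true (n + 1)) =
          seamMap (ε + 2) * (seamMap (ε + 1))⁻¹ * overlapProd τ (turnLeft P ε false n) := by
        simp [turnLeft, overlapProd, overlapMap, seamAt, mul_assoc]
      rw [e, map_mul, map_mul, map_inv, pr_seamMap_boundary, ih, h]
      push_cast
      rw [T_add, map_mul]
      group

theorem pr_overlapProd_turn (τ : Fin S.ξ → ℂ) (P : Fin S.k) (ε : Fin 3) (a : Bool) (n : ℤ) :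
    pr (overlapProd τ (turn P ε a n)) =
      (pr (Ω ε))⁻¹ * pr (T (turnShift a n : ℤ)) * pr (Ω ε) := by
  cases n with
  | ofNat n => exact pr_overlapProd_turnRight τ P ε a n
  | negSucc n => exact pr_overlapProd_turnLeft τ P ε a (n + 1)

/-- The matrix of `z ↦ -1 / (c ^ 2 z)`. -/
noncomputable def W (c : ℂˣ) : Matrix.SpecialLinearGroup (Fin 2) ℂ :=
  ⟨!![0, -(c : ℂ)⁻¹; c, 0], by simp⟩

/-- The coordinate in which the boundary component `ε` is at `∞`, corrected by a translation that
depends on the sector `a`. In these coordinates, running along a seam is the same map for all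
seams. -/
def sectorMap (x : (Fin S.k × Fin 3) × Bool) : Matrix.SpecialLinearGroup (Fin 2) ℂ :=
  T (if x.2 then 0 else -1) * Ω x.1.2

namespace Strand

/-- The lower left entry of the matrix of an arc, where this matrix includes the inversion `J⁻¹` of
the gluing map before it. -/
noncomputable def const (s : S.Strand) : ℂˣ :=
  match s.arc with
  | none => Units.mk0 Complex.I Complex.I_ne_zero
  | some _ => Units.mk0 (2 * Complex.I) (by simp)

/-- The translation length by which the end of an arc contributes to the linear factor of the next
strand. It is nonzero only if the arc connects a boundary component to itself. -/
noncomputable def carry (s : S.Strand) : ℂ :=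
  match s.arc with
  | none => 0
  | some dir => if dir then -2⁻¹ else 2⁻¹

/-- The translation length of the linear factor that belongs to a strand. -/
noncomputable def shift (s : S.Strand) : ℂ := s.twist - 1 - s.carry

end Strand

/-- The holonomy along an arc, up to sign, as a product of two translations and an inversion. -/
theorem pr_arc (s : S.Strand) (τ : Fin S.ξ → ℂ) :
    pr (J⁻¹ * Ω s.entry) * pr (overlapProd τ s.arcWord) =
      pr (T ((if s.exitSector then 1 else 0) - 1 - s.carry) * W s.const * T s.carry) *
        pr (sectorMap s.finish) := by
  have sign : ∀ {A B : Matrix.SpecialLinearGroup (Fin 2) ℂ}, A.1 = B.1 ∨ A.1 = -B.1 →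
      pr A = pr B := by
    rintro A B (h | h)
    · rw [Subtype.ext h]
    · rw [show A = -B from Subtype.ext h, pr_neg]
  have h0 : (Ω 0 : Matrix (Fin 2) (Fin 2) ℂ) = !![1, -1; 1, 0] := rfl
  have h1 : (Ω 1 : Matrix (Fin 2) (Fin 2) ℂ) = !![0, -1; 1, -1] := rfl
  have h2 : (Ω 2 : Matrix (Fin 2) (Fin 2) ℂ) = !![1, 0; 0, 1] := by
    rw [← Matrix.one_fin_two]; rfl
  have hW : ∀ c, (W c : Matrix (Fin 2) (Fin 2) ℂ) = !![0, -(c : ℂ)⁻¹; c, 0] := fun _ => rfl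
  obtain ⟨arc, harc⟩ : ∃ arc, s.arc = arc := ⟨_, rfl⟩
  cases arc with
  | none =>
    simp only [Strand.arcWord, Strand.finish, Strand.const, Strand.carry, harc]
    rw [← map_mul]
    simp only [overlapProd, List.map_nil, List.prod_nil, mul_one]
    generalize s.exitSector = e
    generalize s.entry = ε
    refine sign ?_
    cases e <;> fin_cases ε <;>
    simp only [sectorMap, farEnd, Matrix.SpecialLinearGroup.coe_mul, coe_T, coe_J_inv, hW] <;>
    simp [h0, h1, h2]
  | some dir =>
    simp only [Strand.arcWord, Strand.finish, Strand.const, Strand.carry, harc]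
    rw [pr_overlapProd_turn]
    have ht : turnShift (!s.exitSector) (if dir then 2 else -2) = if dir then 2 else -2 := by
      cases s.exitSector <;> cases dir <;> simp [turnShift]
    rw [ht, ← map_inv, ← map_mul, ← map_mul, ← map_mul, ← map_mul]
    generalize s.exitSector = e
    generalize s.entry = ε
    refine sign ?_
    cases e <;> fin_cases ε <;> cases dir <;>
    simp only [sectorMap, farEnd, Matrix.SpecialLinearGroup.coe_mul, coe_T, coe_J_inv, hW] <;>
    simp [h0, h1, h2, Matrix.adjugate_fin_two, Matrix.SpecialLinearGroup.coe_inv] <;>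
    ring_nf <;> simp

theorem pr_overlapProd_word (τ : Fin S.ξ → ℂ) (s : S.Strand) :
    pr (overlapProd τ s.word) = (pr (sectorMap s.start))⁻¹ *
      pr (T (τ s.i + s.shift) * W s.const * T s.carry) * pr (sectorMap s.finish) := by
  have e : overlapProd τ s.word =
      overlapProd τ (turn (S.side s.i s.b).1 (S.side s.i s.b).2 s.a s.twist) *
        gluingMap (τ s.i) (S.side s.i s.b).2 s.entry * overlapProd τ s.arcWord := by
    rw [Strand.word, overlapProd_append]
    simp [overlapProd, overlapMap, Strand.entry, mul_assoc]
  have h := pr_arc s τ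
  rw [e, map_mul, map_mul, pr_overlapProd_turn]
  have e1 : T (turnShift s.a s.twist : ℤ) * J⁻¹ * (T (τ s.i))⁻¹ =
      T (τ s.i + s.shift - (if s.a then 0 else -1) -
        ((if s.exitSector then 1 else 0) - 1 - s.carry)) * J⁻¹ := by
    rw [T_mul_J_inv, T_mul_J_inv, mul_assoc, ← mul_inv_rev, ← T_add]
    congr 3
    simp only [turnShift, Strand.shift, Strand.exitSector]
    push_cast
    rcases Bool.eq_false_or_eq_true s.a with ha | ha <;> simp only [ha] <;>
      split_ifs <;> simp_all <;> ring
  have e2 : pr (T (turnShift s.a s.twist : ℤ)) * pr J⁻¹ * (pr (T (τ s.i)))⁻¹ =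
      pr (T (τ s.i + s.shift - (if s.a then 0 else -1) -
        ((if s.exitSector then 1 else 0) - 1 - s.carry))) * pr J⁻¹ := by
    rw [← map_inv, ← map_mul, ← map_mul, ← map_mul, e1]
  have e3 : pr (Ω (S.side s.i s.b).2) = (pr (T (if s.a then 0 else -1)))⁻¹ *
      pr (sectorMap s.start) := by
    rw [sectorMap, map_mul]; exact (inv_mul_cancel_left _ _).symm
  have e4 : pr (T (τ s.i + s.shift)) = pr (T (if s.a then 0 else -1)) *
      pr (T (τ s.i + s.shift - (if s.a then 0 else -1) -
        ((if s.exitSector then 1 else 0) - 1 - s.carry))) *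
      pr (T ((if s.exitSector then 1 else 0) - 1 - s.carry)) := by
    rw [← map_mul, ← map_mul, ← T_add, ← T_add]
    congr 2
    ring
  calc _ = (pr (Ω (S.side s.i s.b).2))⁻¹ * (pr (T (turnShift s.a s.twist : ℤ)) * pr J⁻¹ *
        (pr (T (τ s.i)))⁻¹) * (pr (Ω s.entry) * pr (overlapProd τ s.arcWord)) := by
        simp only [gluingMap, map_mul, map_inv]; group
    _ = (pr (sectorMap s.start))⁻¹ * (pr (T (if s.a then 0 else -1)) *
        pr (T (τ s.i + s.shift - (if s.a then 0 else -1) -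
          ((if s.exitSector then 1 else 0) - 1 - s.carry)))) *
        (pr (J⁻¹ * Ω s.entry) * pr (overlapProd τ s.arcWord)) := by
        rw [e2, e3, map_mul]; group
    _ = (pr (sectorMap s.start))⁻¹ * (pr (T (τ s.i + s.shift)) * pr (W s.const) *
        pr (T s.carry)) * pr (sectorMap s.finish) := by
        rw [h, e4]
        simp only [map_mul]
        group
    _ = _ := by rw [map_mul, map_mul]

/-- The linear factors of a sequence of strands: variables, constants and translation lengths, where
the translation at the end of every strand is carried over to the next one. -/
noncomputable def factors : ℂ → List S.Strand → List (Fin S.ξ × ℂˣ × ℂ)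
  | _, [] => []
  | v, s :: L => (s.i, s.const, s.shift + v) :: factors s.carry L

/-- The matrix in `SL(2, ℂ)` that belongs to a linear factor. -/
noncomputable def factorMap (τ : Fin S.ξ → ℂ) (x : Fin S.ξ × ℂˣ × ℂ) :
    Matrix.SpecialLinearGroup (Fin 2) ℂ :=
  T (τ x.1 + x.2.2) * W x.2.1

theorem pr_overlapProd_flatMap (τ : Fin S.ξ → ℂ) (s : S.Strand) (L : List S.Strand)
    (hL : List.IsChain (fun s t : S.Strand => s.finish = t.start) (s :: L)) (v : ℂ) :
    pr (T v) * pr (sectorMap s.start) * pr (overlapProd τ ((s :: L).flatMap Strand.word)) =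
      pr (((factors v (s :: L)).map (factorMap τ)).prod) *
        (pr (T ((s :: L).getLast (by simp)).carry) *
          pr (sectorMap ((s :: L).getLast (by simp)).finish)) := by
  have hT : ∀ (s : S.Strand) v, pr (T (τ s.i + (s.shift + v))) =
      pr (T v) * pr (T (τ s.i + s.shift)) := by
    intro s v
    rw [← map_mul, ← T_add]
    congr 2
    ring
  induction L generalizing s v with
  | nil =>
    simp only [List.flatMap_cons, List.flatMap_nil, List.append_nil, pr_overlapProd_word, factors,
      List.map_cons, List.map_nil, List.prod_cons, List.prod_nil, mul_one, factorMap,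
      List.getLast_singleton, map_mul, hT]
    group
  | cons t L ih =>
    rw [List.isChain_cons_cons] at hL
    have ih := ih t hL.2 s.carry
    rw [List.flatMap_cons, overlapProd_append, map_mul, pr_overlapProd_word, hL.1,
      List.getLast_cons (by simp), factors, List.map_cons, List.prod_cons, map_mul]
    refine Eq.trans ?_ ((congrArg (pr (factorMap τ (s.i, s.const, s.shift + v)) * ·) ih).trans
      (mul_assoc _ _ _).symm)
    simp only [factorMap, map_mul, hT]
    group

theorem countP_factors (v : ℂ) (L : List S.Strand) (i : Fin S.ξ) :
    (factors v L).countP (fun x => x.1 = i) = L.countP (fun s => s.i = i) := by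
  induction L generalizing v with
  | nil => rfl
  | cons s L ih => simp only [factors, List.countP_cons, ih]

theorem constProd_factors (v : ℂ) (L : List S.Strand) :
    constProd (factors v L) = Complex.I ^ L.length * 2 ^ sccArcs L := by
  induction L generalizing v with
  | nil => simp [constProd, factors, sccArcs]
  | cons s L ih =>
    have h := ih s.carry
    simp only [constProd, sccArcs] at h
    simp only [constProd, factors, List.map_cons, List.prod_cons, h, sccArcs, List.countP_cons,
      List.length_cons, Strand.const]
    cases s.arc
    · simp; ring
    · simp; ring

/-- A strand that carries over a translation returns to the pants curve from which it comes. -/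
theorem Strand.i_eq_of_carry_ne_zero {s t : S.Strand} (h : s.finish = t.start)
    (hs : s.carry ≠ 0) : s.i = t.i := by
  cases harc : s.arc with
  | none => simp [Strand.carry, harc] at hs
  | some dir =>
    simp only [Strand.finish, harc, Strand.start, Prod.mk.injEq, Strand.pants, Strand.entry] at h
    have h' : (fun x : Fin S.ξ × Bool => S.side x.1 x.2) (s.i, !s.b) =
        (fun x : Fin S.ξ × Bool => S.side x.1 x.2) (t.i, t.b) := h.1
    exact congrArg Prod.fst (S.side_injective h')

theorem totalShift_factors (s : S.Strand) (L : List S.Strand)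
    (hL : List.IsChain (fun s t : S.Strand => s.finish = t.start) (s :: L)) (v : ℂ)
    (i : Fin S.ξ) :
    totalShift (factors v (s :: L)) i = (if s.i = i then v else 0) +
      (dtTwist (s :: L) i - (s :: L).countP (fun s => s.i = i)) -
      if ((s :: L).getLast (by simp)).i = i then ((s :: L).getLast (by simp)).carry else 0 := by
  induction L generalizing s v with
  | nil =>
    by_cases h : s.i = i
    · simp [totalShift, factors, dtTwist, h, Strand.shift]; ring
    · simp [totalShift, factors, dtTwist, h]
  | cons t L ih =>
    rw [List.isChain_cons_cons] at hL
    have ih := ih t hL.2 s.carry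
    have e1 : totalShift (factors v (s :: t :: L)) i =
        (if s.i = i then s.shift + v else 0) + totalShift (factors s.carry (t :: L)) i := by
      simp [totalShift, factors]
    have e2 : ((dtTwist (s :: t :: L) i : ℤ) : ℂ) =
        (if s.i = i then (s.twist : ℂ) else 0) + dtTwist (t :: L) i := by
      rw [dtTwist, List.filter_cons]
      by_cases h : s.i = i <;> simp [h, dtTwist]
    have e3 : ((s :: t :: L).countP (fun s => s.i = i) : ℂ) =
        (if s.i = i then 1 else 0) + (t :: L).countP (fun s => s.i = i) := by
      rw [List.countP_cons]
      by_cases h : s.i = i <;> simp [h, add_comm]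
    have e4 : (if t.i = i then s.carry else 0) = if s.i = i then s.carry else 0 := by
      by_cases h : s.carry = 0
      · simp [h]
      · rw [Strand.i_eq_of_carry_ne_zero hL.1 h]
    rw [List.getLast_cons (by simp), e1, ih, e2, e3, e4]
    by_cases h : s.i = i
    · simp only [h, if_true, Strand.shift]; ring
    · simp only [h, if_false]; ring

theorem trace_prod_factorMap (τ : Fin S.ξ → ℂ) (l : List (Fin S.ξ × ℂˣ × ℂ)) :
    ((l.map (factorMap τ)).prod).1.trace = MvPolynomial.eval τ (polyProd l).trace := by
  have h : ((l.map (factorMap τ)).prod).1 = (MvPolynomial.eval τ).mapMatrix (polyProd l) := by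
    rw [polyProd, map_list_prod, List.map_map]
    induction l with
    | nil => simp
    | cons x l ih =>
      rw [List.map_cons, List.prod_cons, List.map_cons, List.prod_cons, ← ih,
        Matrix.SpecialLinearGroup.coe_mul, factorMap, Matrix.SpecialLinearGroup.coe_mul]
      congr 1
      ext i j
      fin_cases i <;> fin_cases j <;> simp [T, W, mul_comm]
  rw [h, RingHom.mapMatrix_apply, Matrix.trace_fin_two, Matrix.trace_fin_two, map_add]
  rfl

/-- The trace of a curve in standard position is, up to sign, the trace of a product of linear
matrices whose constants and translation lengths are given by the numbers of intersections, the
twists and the number of arcs that return. -/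
theorem exists_factors {γ : S.Loop} {L : List S.Strand} (h : IsStandardPosition γ L) :
    ∃ l : List (Fin S.ξ × ℂˣ × ℂ),
      (∀ i, l.countP (fun x => x.1 = i) = intersectionNumber γ i) ∧
      (∀ i, totalShift l i = dtTwist L i - intersectionNumber γ i) ∧
      constProd l = Complex.I ^ (∑ i, intersectionNumber γ i) * 2 ^ sccArcs L ∧
      ∀ τ, (overlapProd τ γ.1).1.trace ^ 2 = MvPolynomial.eval τ (polyProd l).trace ^ 2 := by
  obtain ⟨c, hc, hγ⟩ := h.homotopic
  have hlen : L.length = ∑ i, intersectionNumber γ i := by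
    simp only [← h.minimal]
    clear h hc hγ
    induction L with
    | nil => simp
    | cons s L ih => simp [List.countP_cons, Finset.sum_add_distrib, ← ih]
  cases L with
  | nil =>
    refine ⟨[], fun i => ?_, fun i => ?_, ?_, fun τ => ?_⟩
    · simp [← h.minimal]
    · simp [← h.minimal, totalShift, dtTwist]
    · simp [← h.minimal, constProd, sccArcs]
    · rw [trace_sq_eq hγ, hc]
      simp [overlapProd, polyProd]
  | cons s L =>
    have hchain := h.chain
    rw [Cycle.chain_coe_cons] at hchain
    have hchain' : List.IsChain (fun s t : S.Strand => s.finish = t.start) (s :: L) := by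
      rw [← List.cons_append] at hchain
      exact hchain.left_of_append
    have hlast : ((s :: L).getLast (by simp)).finish = s.start := by
      rw [← List.cons_append, List.isChain_append] at hchain
      exact hchain.2.2 _ (List.getLast_mem_getLast? _) s (by simp)
    set t := (s :: L).getLast (by simp) with ht
    refine ⟨factors t.carry (s :: L), fun i => ?_, fun i => ?_, ?_, fun τ => ?_⟩
    · rw [countP_factors, h.minimal]
    · have e : (if s.i = i then t.carry else 0) = if t.i = i then t.carry else 0 := by
        by_cases h : t.carry = 0
        · simp [h]
        · rw [Strand.i_eq_of_carry_ne_zero hlast h]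
      rw [totalShift_factors s L hchain', ← ht, e, h.minimal]
      ring
    · rw [constProd_factors, hlen]
    · rw [trace_sq_eq hγ, hc, ← trace_prod_factorMap]
      refine sq_eq_sq_iff_eq_or_eq_neg.2 (trace_eq_or_eq_neg_of_isConj ?_)
      have key := pr_overlapProd_flatMap τ s L hchain' t.carry
      rw [← ht, hlast] at key
      exact isConj_iff.2 ⟨_, mul_inv_eq_of_eq_mul key⟩

/-! ### The trace polynomial -/

open MvPolynomial in
/-- The trace of the holonomy along a path is a polynomial in the plumbing parameters. -/
theorem exists_tracePolynomial (l : List S.Dart) :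
    ∃ f : MvPolynomial (Fin S.ξ) ℂ, ∀ τ, (overlapProd τ l).1.trace = eval τ f := by
  have hdart : ∀ d : S.Dart, ∃ M : Matrix (Fin 2) (Fin 2) (MvPolynomial (Fin S.ξ) ℂ),
      ∀ τ, (overlapMap τ d).1 = (eval τ).mapMatrix M := by
    have hconst : ∀ A : Matrix (Fin 2) (Fin 2) ℂ, ∀ τ,
        A = (eval τ).mapMatrix (C.mapMatrix A : Matrix _ _ (MvPolynomial (Fin S.ξ) ℂ)) := by
      intro A τ; ext; simp
    have hgluing : ∀ i ε ε', ∃ M : Matrix (Fin 2) (Fin 2) (MvPolynomial (Fin S.ξ) ℂ),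
        ∀ τ : Fin S.ξ → ℂ, (gluingMap (τ i) ε ε').1 = (eval τ).mapMatrix M := by
      intro i ε ε'
      refine ⟨C.mapMatrix ((Ω ε)⁻¹ * J⁻¹).1 * !![1, -X i; 0, 1] * C.mapMatrix (Ω ε').1,
        fun τ => ?_⟩
      rw [map_mul, map_mul, ← hconst, ← hconst, gluingMap, Matrix.SpecialLinearGroup.coe_mul,
        Matrix.SpecialLinearGroup.coe_mul _ (T (τ i))⁻¹]
      congr 2
      rw [← T_neg, coe_T]
      ext a b
      fin_cases a <;> fin_cases b <;> simp
    rintro (⟨P, s, _ | _⟩ | ⟨i, b, _ | _⟩)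
    · exact ⟨_, fun τ => hconst (seamMap s)⁻¹.1 τ⟩
    · exact ⟨_, fun τ => hconst (seamMap s).1 τ⟩
    · obtain ⟨M, hM⟩ := hgluing i (S.side i b).2 (S.side i !b).2
      refine ⟨C.mapMatrix ((seamMap (seamAt (S.side i b).2 true))⁻¹).1 * M *
        C.mapMatrix (seamMap (seamAt (S.side i !b).2 false)).1, fun τ => ?_⟩
      rw [map_mul, map_mul, ← hconst, ← hconst, ← hM]
      simp only [overlapMap, Matrix.SpecialLinearGroup.coe_mul]
    · exact hgluing i _ _
  have hlist : ∃ M : Matrix (Fin 2) (Fin 2) (MvPolynomial (Fin S.ξ) ℂ),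
      ∀ τ, (overlapProd τ l).1 = (eval τ).mapMatrix M := by
    induction l with
    | nil => exact ⟨1, fun τ => by simp [overlapProd]⟩
    | cons d l ih =>
      obtain ⟨M, hM⟩ := ih
      obtain ⟨N, hN⟩ := hdart d
      refine ⟨N * M, fun τ => ?_⟩
      rw [map_mul, ← hN, ← hM, ← Matrix.SpecialLinearGroup.coe_mul]
      rfl
  obtain ⟨M, hM⟩ := hlist
  refine ⟨M.trace, fun τ => ?_⟩
  rw [hM, RingHom.mapMatrix_apply, Matrix.trace_fin_two, Matrix.trace_fin_two, map_add]
  rfl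

open MvPolynomial in
/-- The top terms of the trace polynomial of a curve that crosses some pants curve. -/
theorem exists_topTerms (γ : S.Loop) (hq : 0 < ∑ i, intersectionNumber γ i) :
    ∃ f : MvPolynomial (Fin S.ξ) ℂ,
      (∀ (τ : Fin S.ξ → ℂ) (A : Matrix.SpecialLinearGroup (Fin 2) ℂ),
        (A : Matrix.ProjectiveSpecialLinearGroup (Fin 2) ℂ) = holonomy τ γ →
          A.1.trace = eval τ f ∨ A.1.trace = - eval τ f) ∧
      ∀ (p : Fin S.ξ → ℤ) (h : ℕ), HasTwistsAndSccArcs γ p h →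
        ∃ s : ℂ, (s = 1 ∨ s = -1) ∧ ∃ R R' : MvPolynomial (Fin S.ξ) ℂ,
          f = C (s * Complex.I ^ (∑ i, intersectionNumber γ i) * 2 ^ h) *
              ∏ i, (X i + C (((p i : ℂ) - intersectionNumber γ i) / intersectionNumber γ i)) ^
                intersectionNumber γ i + R ∧
          f = C (s * Complex.I ^ (∑ i, intersectionNumber γ i) * 2 ^ h) *
              (∏ i, X i ^ intersectionNumber γ i +
                ∑ i, C ((p i : ℂ) - intersectionNumber γ i) *
                  (X i ^ (intersectionNumber γ i - 1) *
                    ∏ j ∈ Finset.univ.erase i, X j ^ intersectionNumber γ j)) + R' ∧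
          (∀ m ∈ R.support, (∑ i, m i) + 2 ≤ ∑ i, intersectionNumber γ i ∧
            ∀ i, m i ≤ intersectionNumber γ i) ∧
          (∀ m ∈ R'.support, (∑ i, m i) + 2 ≤ ∑ i, intersectionNumber γ i ∧
            ∀ i, m i ≤ intersectionNumber γ i) := by
  obtain ⟨f, hf⟩ := exists_tracePolynomial γ.1
  refine ⟨f, fun τ A hA => ?_, ?_⟩
  · have hA' : pr A = pr (overlapProd τ γ.1) := hA
    rw [← hf]
    rcases eq_or_eq_neg_of_pr_eq hA' with h | h
    · left; rw [h]
    · right; rw [h, Matrix.SpecialLinearGroup.coe_neg, Matrix.trace_neg]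
  · rintro p _ ⟨L, hL, hp, rfl⟩
    obtain ⟨l, hl, hs, hc, htr⟩ := exists_factors hL
    have hne : l ≠ [] := by
      rintro rfl
      simp only [List.countP_nil] at hl
      simp [← hl] at hq
    have hs' : ∀ i, totalShift l i = p i - intersectionNumber γ i := fun i => by rw [hs, hp]
    obtain ⟨R, R', h1, h2, h3, h4⟩ := trace_polyProd hne hl hs'
    rw [hc] at h1 h2
    have hsq : f ^ 2 = (polyProd l).trace ^ 2 := by
      refine MvPolynomial.funext fun τ => ?_
      rw [map_pow, map_pow, ← hf, htr]
    rcases sq_eq_sq_iff_eq_or_eq_neg.1 hsq with h | h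
    · refine ⟨1, Or.inl rfl, R, R', ?_, ?_, h3, h4⟩
      · rw [h, one_mul]; exact h1
      · rw [h, one_mul]; exact h2
    · refine ⟨-1, Or.inr rfl, -R, -R', ?_, ?_, by simpa using h3, by simpa using h4⟩
      · rw [h, h1]; simp only [map_mul, map_neg, map_one]; ring
      · rw [h, h2]; simp only [map_mul, map_neg, map_one]; ring

/-! ### The leading coefficient of the trace -/

/-- The overlap map of a crossing of a pants curve with `T_τ` replaced by `(s, t; 0, s)`. -/
noncomputable def homogeneousMap (s t : ℂ) : S.Dart → Matrix (Fin 2) (Fin 2) ℂ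
  | .seam P j c => (overlapMap 0 (.seam P j c : S.Dart)).1
  | .cross i b true =>
      ((Ω (S.side i b).2)⁻¹ * J⁻¹).1 * !![s, -t; 0, s] * (Ω (S.side i !b).2).1
  | .cross i b false =>
      ((seamMap (seamAt (S.side i b).2 true))⁻¹ * (Ω (S.side i b).2)⁻¹ * J⁻¹).1 *
        !![s, -t; 0, s] * (Ω (S.side i !b).2 * seamMap (seamAt (S.side i !b).2 false)).1

theorem homogeneousMap_one (t : ℂ) (d : S.Dart) :
    homogeneousMap 1 t d = (overlapMap (fun _ => t) d).1 := by
  have h : !![1, -t; 0, 1] = ((T t)⁻¹).1 := by rw [← T_neg, coe_T]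
  rcases d with ⟨P, s, _ | _⟩ | ⟨i, b, _ | _⟩ <;>
    simp only [homogeneousMap, overlapMap, gluingMap, h, ← Matrix.SpecialLinearGroup.coe_mul,
      mul_assoc]

/-- Is `d` a crossing of a pants curve? -/
def Dart.isCross : S.Dart → Bool
  | .seam _ _ _ => false
  | .cross _ _ _ => true

theorem homogeneousMap_eq_smul {s : ℂ} (hs : s ≠ 0) (d : S.Dart) :
    homogeneousMap s 1 d =
      (if d.isCross then s else 1) • (overlapMap (fun _ => s⁻¹) d).1 := by
  have h : !![s, -1; 0, s] = s • !![1, -s⁻¹; 0, 1] := by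
    simp [hs]
  rw [← homogeneousMap_one]
  rcases d with ⟨P, s, _ | _⟩ | ⟨i, b, _ | _⟩ <;>
    simp only [homogeneousMap, h, Dart.isCross, if_true, Bool.false_eq_true, if_false, one_smul,
      Matrix.mul_smul, Matrix.smul_mul]

theorem prod_homogeneousMap {s : ℂ} (hs : s ≠ 0) (l : List S.Dart) :
    (l.map (homogeneousMap s 1)).prod =
      s ^ l.countP Dart.isCross • (overlapProd (fun _ => s⁻¹) l).1 := by
  induction l with
  | nil => simp [overlapProd]
  | cons d l ih =>
    have h : overlapProd (fun _ => s⁻¹) (d :: l) =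
        overlapMap (fun _ => s⁻¹) d * overlapProd (fun _ => s⁻¹) l := by simp [overlapProd]
    rw [List.map_cons, List.prod_cons, ih, homogeneousMap_eq_smul hs, h,
      Matrix.SpecialLinearGroup.coe_mul, Matrix.smul_mul, Matrix.mul_smul, smul_smul,
      List.countP_cons, pow_add]
    congr 1
    cases d.isCross <;> simp [mul_comm]

theorem continuous_homogeneousMap (d : S.Dart) :
    Continuous fun s : ℂ => homogeneousMap s 1 d := by
  have h : Continuous fun s : ℂ => !![s, -1; 0, s] := by
    refine continuous_matrix fun i j => ?_
    fin_cases i <;> fin_cases j <;> simp <;> fun_prop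
  rcases d with ⟨P, s, _ | _⟩ | ⟨i, b, _ | _⟩ <;> simp only [homogeneousMap] <;> fun_prop

/-- If two plumbing parameters agree except at `i`, and the path can be made disjoint from the
`i`-th pants curve, the traces agree up to sign. -/
theorem trace_sq_update {γ : S.Loop} {i : Fin S.ξ} (h : intersectionNumber γ i = 0)
    (τ : Fin S.ξ → ℂ) (a : ℂ) :
    (overlapProd (Function.update τ i a) γ.1).1.trace ^ 2 =
      (overlapProd τ γ.1).1.trace ^ 2 := by
  have hne : {n | ∃ c : S.Loop, FreelyHomotopic γ c ∧
      c.1.countP (Dart.crosses i) = n}.Nonempty := ⟨_, γ, FreelyHomotopic.refl γ, rfl⟩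
  obtain ⟨c, hc, hn⟩ := Nat.sInf_mem hne
  rw [show sInf _ = 0 from h, List.countP_eq_zero] at hn
  have e : overlapProd (Function.update τ i a) c.1 = overlapProd τ c.1 := by
    refine congrArg List.prod (List.map_congr_left fun d hd => ?_)
    rcases d with ⟨P, s, _ | _⟩ | ⟨j, b, _ | _⟩
    · rfl
    · rfl
    all_goals
      have hj : j ≠ i := by simpa [Dart.crosses] using hn _ hd
      simp [overlapMap, hj]
  rw [trace_sq_eq hc, trace_sq_eq hc, e]

theorem trace_sq_eq_of_intersectionNumber_eq_zero {γ : S.Loop}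
    (h : ∀ i, intersectionNumber γ i = 0) (τ τ' : Fin S.ξ → ℂ) :
    (overlapProd τ γ.1).1.trace ^ 2 = (overlapProd τ' γ.1).1.trace ^ 2 := by
  have key : ∀ s : Finset (Fin S.ξ), (overlapProd (s.piecewise τ τ') γ.1).1.trace ^ 2 =
      (overlapProd τ' γ.1).1.trace ^ 2 := by
    intro s
    induction s using Finset.induction_on with
    | empty => simp
    | insert i s _ ih => rw [Finset.piecewise_insert, trace_sq_update (h i), ih]
  simpa using key Finset.univ

/-- If a closed path can be made disjoint from every single pants curve, the leading coefficient of
its trace vanishes, unless it is disjoint from all of them. -/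
theorem trace_leading_eq_zero {γ c : S.Loop} (h : ∀ i, intersectionNumber γ i = 0)
    (hc : FreelyHomotopic γ c) (hcross : c.1.countP Dart.isCross ≠ 0) :
    (c.1.map (homogeneousMap 0 1)).prod.trace = 0 := by
  set a := (overlapProd 0 γ.1).1.trace ^ 2
  set g : ℂ → ℂ := fun s => (c.1.map (homogeneousMap s 1)).prod.trace ^ 2
  have hg : ∀ s : ℂ, s ≠ 0 → g s = (s ^ c.1.countP Dart.isCross) ^ 2 * a := by
    intro s hs
    simp only [g]
    rw [prod_homogeneousMap hs, Matrix.trace_smul, smul_eq_mul, mul_pow, ← trace_sq_eq hc,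
      trace_sq_eq_of_intersectionNumber_eq_zero h _ 0]
  have hcont : Continuous g := by
    have : Continuous fun s : ℂ => (c.1.map (homogeneousMap s 1)).prod :=
      continuous_list_prod _ fun d _ => continuous_homogeneousMap d
    exact this.matrix_trace.pow 2
  have hcont' : Continuous fun s : ℂ => (s ^ c.1.countP Dart.isCross) ^ 2 * a := by fun_prop
  have heq : g = fun s : ℂ => (s ^ c.1.countP Dart.isCross) ^ 2 * a :=
    Continuous.ext_on (dense_compl_singleton (0 : ℂ)) hcont hcont' fun s hs => hg s hs
  have h0 : g 0 = 0 := by rw [heq]; simp [hcross]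
  exact pow_eq_zero_iff two_ne_zero |>.1 h0

/-! ### Closed paths without bigons -/

/-- A vector that represents the cusp `ε` in the chart of a hexagon of colour `c`. -/
def cusp : Fin 3 → Bool → ℤ × ℤ
  | 0, _ => (0, 1)
  | 1, true => (1, 1)
  | 1, false => (-1, 1)
  | 2, _ => (1, 0)

/-- The value at the cusp `ε` of a linear form in the chart of a hexagon of colour `c`. -/
def cuspValue (r : ℤ × ℤ) (ε : Fin 3) (c : Bool) : ℤ :=
  r.1 * (cusp ε c).1 + r.2 * (cusp ε c).2

/-- A linear form in the chart of a hexagon of colour `c` that vanishes at the cusp `ε`. -/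
def vanishingForm : Fin 3 → Bool → ℤ × ℤ
  | 0, _ => (1, 0)
  | 1, true => (1, -1)
  | 1, false => (-1, -1)
  | 2, _ => (0, 1)

/-- The same linear form in the chart on the other side of the seam `s`. -/
def seamForm (r : ℤ × ℤ) : Fin 3 → Bool → ℤ × ℤ
  | 0, true => (r.1, 2 * r.1 + r.2)
  | 0, false => (r.1, r.2 - 2 * r.1)
  | 1, _ => r
  | 2, true => (r.1 + 2 * r.2, r.2)
  | 2, false => (r.1 - 2 * r.2, r.2)

/-- The complex row or column vector with the given entries. -/
def toVec (r : ℤ × ℤ) : Fin 2 → ℂ := ![r.1, r.2]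

theorem toVec_dotProduct_cusp (r : ℤ × ℤ) (ε : Fin 3) (c : Bool) :
    toVec r ⬝ᵥ toVec (cusp ε c) = cuspValue r ε c := by
  simp [toVec, cuspValue]

/-- The leading coefficient of the overlap map at a pants curve has rank one: its rows vanish at the
cusp that is entered, and its columns represent the cusp that is left. -/
theorem homogeneousMap_cross (i : Fin S.ξ) (b c : Bool) : ∃ μ : ℂ, μ ≠ 0 ∧
    homogeneousMap 0 1 (.cross i b c : S.Dart) =
      Matrix.vecMulVec (μ • toVec (cusp (S.side i b).2 c))
        (toVec (vanishingForm (S.side i !b).2 c)) := by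
  have h0 : (Ω 0 : Matrix (Fin 2) (Fin 2) ℂ) = !![1, -1; 1, 0] := rfl
  have h1 : (Ω 1 : Matrix (Fin 2) (Fin 2) ℂ) = !![0, -1; 1, -1] := rfl
  have h2 : (Ω 2 : Matrix (Fin 2) (Fin 2) ℂ) = !![1, 0; 0, 1] := by
    rw [← Matrix.one_fin_two]; rfl
  have s0 : (seamMap 0 : Matrix (Fin 2) (Fin 2) ℂ) = !![1, 2; 0, 1] := rfl
  have s1 : (seamMap 1 : Matrix (Fin 2) (Fin 2) ℂ) = !![1, 0; 0, 1] := by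
    rw [← Matrix.one_fin_two]; rfl
  have s2 : (seamMap 2 : Matrix (Fin 2) (Fin 2) ℂ) = !![1, 0; 2, 1] := rfl
  have rank : ∀ (A B : Matrix (Fin 2) (Fin 2) ℂ) (μ : ℂ) (v w : ℤ × ℤ),
      A 0 0 = -(μ * v.1) → A 1 0 = -(μ * v.2) → B 1 0 = w.1 → B 1 1 = w.2 →
      A * !![0, -1; 0, 0] * B = Matrix.vecMulVec (μ • toVec v) (toVec w) := by
    intro A B μ v w e1 e2 e3 e4
    ext a b
    fin_cases a <;> fin_cases b <;>
      simp [Matrix.mul_apply, Matrix.vecMulVec, toVec, e1, e2, e3, e4]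
  generalize hε : (S.side i b).2 = ε
  generalize hε' : (S.side i !b).2 = ε'
  have hrow : (Ω ε').1 1 0 = (vanishingForm ε' true).1 ∧
      (Ω ε').1 1 1 = (vanishingForm ε' true).2 := by
    fin_cases ε' <;> simp [h0, h1, h2, vanishingForm]
  have hrow' : (Ω ε' * seamMap (ε' + 1)).1 1 0 = (vanishingForm ε' false).1 ∧
      (Ω ε' * seamMap (ε' + 1)).1 1 1 = (vanishingForm ε' false).2 := by
    rw [Matrix.SpecialLinearGroup.coe_mul]
    fin_cases ε' <;> simp [h0, h1, h2, s0, s1, s2, vanishingForm] <;> norm_num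
  have hcol : ∃ μ : ℂ, μ ≠ 0 ∧ ((Ω ε)⁻¹ * J⁻¹).1 0 0 = -(μ * (cusp ε true).1) ∧
      ((Ω ε)⁻¹ * J⁻¹).1 1 0 = -(μ * (cusp ε true).2) := by
    rw [Matrix.SpecialLinearGroup.coe_mul, Matrix.SpecialLinearGroup.coe_inv, coe_J_inv]
    fin_cases ε
    · exact ⟨Complex.I, Complex.I_ne_zero, by simp [h0, cusp], by simp [h0, cusp]⟩
    · exact ⟨Complex.I, Complex.I_ne_zero, by simp [h1, cusp], by simp [h1, cusp]⟩
    · exact ⟨-Complex.I, neg_ne_zero.2 Complex.I_ne_zero, by simp [h2, cusp], by simp [h2, cusp]⟩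
  have hcol' : ∃ μ : ℂ, μ ≠ 0 ∧
      ((seamMap (ε + 2))⁻¹ * (Ω ε)⁻¹ * J⁻¹).1 0 0 = -(μ * (cusp ε false).1) ∧
      ((seamMap (ε + 2))⁻¹ * (Ω ε)⁻¹ * J⁻¹).1 1 0 = -(μ * (cusp ε false).2) := by
    rw [Matrix.SpecialLinearGroup.coe_mul, Matrix.SpecialLinearGroup.coe_mul,
      Matrix.SpecialLinearGroup.coe_inv, Matrix.SpecialLinearGroup.coe_inv, coe_J_inv]
    fin_cases ε
    · exact ⟨Complex.I, Complex.I_ne_zero, by simp [h0, s2, cusp, Matrix.adjugate_fin_two],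
        by simp [h0, s2, cusp, Matrix.adjugate_fin_two]⟩
    · exact ⟨Complex.I, Complex.I_ne_zero,
        by simp [h1, s0, cusp, Matrix.adjugate_fin_two]; ring,
        by simp [h1, s0, cusp, Matrix.adjugate_fin_two]⟩
    · exact ⟨-Complex.I, neg_ne_zero.2 Complex.I_ne_zero,
        by simp [h2, s1, cusp, Matrix.adjugate_fin_two],
        by simp [h2, s1, cusp, Matrix.adjugate_fin_two]⟩
  cases c
  · obtain ⟨μ, hμ, e1, e2⟩ := hcol'
    refine ⟨μ, hμ, ?_⟩
    simp only [homogeneousMap, hε, hε']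
    exact rank _ _ _ _ _ e1 e2 hrow'.1 hrow'.2
  · obtain ⟨μ, hμ, e1, e2⟩ := hcol
    refine ⟨μ, hμ, ?_⟩
    simp only [homogeneousMap, hε, hε']
    exact rank _ _ _ _ _ e1 e2 hrow.1 hrow.2

theorem vecMul_homogeneousMap_seam (r : ℤ × ℤ) (P : Fin S.k) (s : Fin 3) (c : Bool) :
    Matrix.vecMul (toVec r) (homogeneousMap 0 1 (.seam P s c : S.Dart)) =
      toVec (seamForm r s c) := by
  have s0 : (seamMap 0 : Matrix (Fin 2) (Fin 2) ℂ) = !![1, 2; 0, 1] := rfl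
  have s1 : (seamMap 1 : Matrix (Fin 2) (Fin 2) ℂ) = !![1, 0; 0, 1] := by
    rw [← Matrix.one_fin_two]; rfl
  have s2 : (seamMap 2 : Matrix (Fin 2) (Fin 2) ℂ) = !![1, 0; 2, 1] := rfl
  ext a
  cases c <;> fin_cases s <;> fin_cases a <;>
    simp [homogeneousMap, overlapMap, s0, s1, s2, toVec, seamForm, Matrix.vecMul, dotProduct,
      Matrix.adjugate_fin_two] <;> ring

/-- The linear form vanishes at the cusp `ε` of the triangle, and is `± 1` at the others. -/
def VanishesAt (r : ℤ × ℤ) (c : Bool) (ε : Fin 3) : Prop :=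
  ∀ s, (cuspValue r s c).natAbs = if s = ε then 0 else 1

/-- The linear form does not vanish at any cusp of the triangle, and the cusp `s` is farthest from
its zero. In the Farey tessellation, this holds after a path has turned away from the zero across
the seam `s`. -/
def FarthestAt (r : ℤ × ℤ) (c : Bool) (s : Fin 3) : Prop :=
  (∀ t, cuspValue r t c ≠ 0) ∧ (cuspValue r s c).natAbs =
    (cuspValue r (s + 1) c).natAbs + (cuspValue r (s + 2) c).natAbs

theorem vanishesAt_vanishingForm (ε : Fin 3) (c : Bool) :
    VanishesAt (vanishingForm ε c) c ε := by
  intro s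
  cases c <;> fin_cases ε <;> fin_cases s <;> rfl

theorem VanishesAt.seamForm {r : ℤ × ℤ} {c : Bool} {ε s : Fin 3} (h : VanishesAt r c ε)
    (hs : s ≠ ε) : VanishesAt (seamForm r s c) (!c) ε := by
  have h0 := h 0
  have h1 := h 1
  have h2 := h 2
  obtain ⟨x, y⟩ := r
  intro t
  cases c <;> fin_cases ε <;> fin_cases s <;> (try exact absurd rfl hs) <;> fin_cases t <;>
    simp [cuspValue, cusp, PantsDecomposition.seamForm] at * <;> omega

theorem VanishesAt.seamForm_self {r : ℤ × ℤ} {c : Bool} {ε : Fin 3} (h : VanishesAt r c ε) :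
    FarthestAt (PantsDecomposition.seamForm r ε c) (!c) ε := by
  have h0 := h 0
  have h1 := h 1
  have h2 := h 2
  obtain ⟨x, y⟩ := r
  refine ⟨fun t => ?_, ?_⟩
  · cases c <;> fin_cases ε <;> fin_cases t <;>
      simp [cuspValue, cusp, PantsDecomposition.seamForm] at * <;> omega
  · cases c <;> fin_cases ε <;>
      simp [cuspValue, cusp, PantsDecomposition.seamForm] at * <;> omega

theorem FarthestAt.seamForm {r : ℤ × ℤ} {c : Bool} {s t : Fin 3} (h : FarthestAt r c s)
    (hs : t ≠ s) : FarthestAt (PantsDecomposition.seamForm r t c) (!c) t := by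
  obtain ⟨h, h3⟩ := h
  have h0 := h 0
  have h1 := h 1
  have h2 := h 2
  clear h
  obtain ⟨x, y⟩ := r
  refine ⟨fun u => ?_, ?_⟩
  · cases c <;> fin_cases s <;> fin_cases t <;> (try exact absurd rfl hs) <;> fin_cases u <;>
      simp [cuspValue, cusp, PantsDecomposition.seamForm] at * <;> omega
  · cases c <;> fin_cases s <;> fin_cases t <;> (try exact absurd rfl hs) <;>
      simp [cuspValue, cusp, PantsDecomposition.seamForm] at * <;> omega

/-- The part of the sequence of crossings `D` from `t` to `n` enters a pair of pants, runs around
the boundary component through which it has entered, and returns through it. -/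
def IsBigon (D : ℕ → S.Dart) (t n : ℕ) : Prop :=
  ∃ i b c c', D t = .cross i b c ∧ D n = .cross i (!b) c' ∧
    ∀ u, t < u → u < n → ∃ P s c'', D u = .seam P s c'' ∧ s ≠ (S.side i !b).2

/-- A closed path without bigons and without backtracking that crosses some pants curve has a
nonzero leading coefficient. -/
theorem trace_leading_ne_zero (D : ℕ → S.Dart) (m : ℕ) (hcross : (D 0).isCross)
    (hper : D (m + 1) = D 0) (hD : ∀ k, (D k).tgt = (D (k + 1)).src)
    (hback : ∀ k, D (k + 1) ≠ (D k).rev) (hbigon : ∀ t n, t < n → ¬ IsBigon D t n) :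
    (((List.range (m + 1)).map fun k => homogeneousMap 0 1 (D k)).prod).trace ≠ 0 := by
  obtain ⟨i₀, b₀, c₀, h₀⟩ : ∃ i b c, D 0 = .cross i b c := by
    rcases h : D 0 with ⟨P, s, c⟩ | ⟨i, b, c⟩
    · simp [h, Dart.isCross] at hcross
    · exact ⟨i, b, c, rfl⟩
  set w := vanishingForm (S.side i₀ !b₀).2 c₀ with hw
  have key : ∀ n, ∃ (κ : ℂ) (r : ℤ × ℤ), κ ≠ 0 ∧
      Matrix.vecMul (toVec w) ((List.range n).map fun k => homogeneousMap 0 1 (D (k + 1))).prod =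
        κ • toVec r ∧
      ((∃ t ≤ n, ∃ i b c, D t = .cross i b c ∧
        (∀ u, t < u → u ≤ n → ∃ P s c', D u = .seam P s c' ∧ s ≠ (S.side i !b).2) ∧
        (D n).tgt.1 = (S.side i !b).1 ∧ VanishesAt r (D n).tgt.2 (S.side i !b).2) ∨
      (∃ P s c, D n = .seam P s c ∧ FarthestAt r (D n).tgt.2 s)) := by
    intro n
    induction n with
    | zero =>
      refine ⟨1, w, one_ne_zero, by simp, Or.inl ⟨0, le_rfl, i₀, b₀, c₀, h₀, ?_, ?_, ?_⟩⟩
      · intro u hu hu'; omega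
      · rw [h₀]; rfl
      · rw [h₀]; exact vanishesAt_vanishingForm _ _
    | succ n ih =>
      obtain ⟨κ, r, hκ, hr, hstate⟩ := ih
      have hprod : Matrix.vecMul (toVec w)
          ((List.range (n + 1)).map fun k => homogeneousMap 0 1 (D (k + 1))).prod =
          κ • Matrix.vecMul (toVec r) (homogeneousMap 0 1 (D (n + 1))) := by
        rw [List.range_succ, List.map_append, List.prod_append, ← Matrix.vecMul_vecMul, hr]
        simp [Matrix.smul_vecMul]
      have hsrc := hD n
      rw [hprod]
      rcases hdart : D (n + 1) with ⟨P, s, c⟩ | ⟨i, b, c⟩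
      · have hc : (D n).tgt = (P, c) := by rw [hsrc, hdart]; rfl
        have ht : (Dart.seam P s c).tgt = (P, !c) := rfl
        refine ⟨κ, seamForm r s c, hκ, by rw [vecMul_homogeneousMap_seam], ?_⟩
        rw [hc] at hstate
        rw [ht]
        rcases hstate with ⟨t, htn, i, b, c', h1, h2, h3, h4⟩ | ⟨P', s', c', h1, h2⟩
        · by_cases hs : s = (S.side i !b).2
          · exact Or.inr ⟨P, s, c, rfl, by rw [hs]; exact h4.seamForm_self⟩
          · refine Or.inl ⟨t, by omega, i, b, c', h1, fun u hu hu' => ?_, h3, h4.seamForm hs⟩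
            rcases Nat.lt_or_ge n u with h | h
            · obtain rfl : u = n + 1 := by omega
              exact ⟨P, s, c, hdart, hs⟩
            · exact h2 u hu h
        · refine Or.inr ⟨P, s, c, rfl, h2.seamForm ?_⟩
          rintro rfl
          apply hback n
          rw [h1] at hc ⊢
          rw [hdart]
          have h3 : P' = P := congrArg Prod.fst hc
          have h4 : (!c') = c := congrArg Prod.snd hc
          rw [← h3, ← h4]
          rfl
      · have hc : (D n).tgt = ((S.side i b).1, c) := by rw [hsrc, hdart]; rfl
        rw [hc] at hstate
        have hne : cuspValue r (S.side i b).2 c ≠ 0 := by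
          rcases hstate with ⟨t, htn, i', b', c', h1, h2, h3, h4⟩ | ⟨P', s', c', h1, h2⟩
          · intro h0
            have h5 := h4 (S.side i b).2
            simp only at h5 h3
            rw [h0] at h5
            have h6 : (S.side i b).2 = (S.side i' !b').2 := by
              by_contra h6
              simp [h6] at h5
            have h7 : (i, b) = (i', !b') := S.side_injective (Prod.ext h3 h6)
            obtain ⟨rfl, rfl⟩ := Prod.mk.inj h7
            exact hbigon t (n + 1) (by omega)
              ⟨i, b', c', c, h1, hdart, fun u hu hu' => h2 u hu (by omega)⟩
          · exact h2.1 _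
        obtain ⟨μ, hμ, hM⟩ := homogeneousMap_cross (S := S) i b c
        refine ⟨κ * (μ * cuspValue r (S.side i b).2 c), vanishingForm (S.side i !b).2 c, ?_, ?_, ?_⟩
        · exact mul_ne_zero hκ (mul_ne_zero hμ (Int.cast_ne_zero.2 hne))
        · rw [hM, Matrix.vecMul_vecMulVec, dotProduct_smul, toVec_dotProduct_cusp, smul_eq_mul,
            smul_smul]
        · refine Or.inl ⟨n + 1, le_rfl, i, b, c, hdart, fun u hu hu' => by omega, rfl, ?_⟩
          exact vanishesAt_vanishingForm _ _
  obtain ⟨κ, r, hκ, hr, hstate⟩ := key (m + 1)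
  obtain ⟨μ, hμ, hM⟩ := homogeneousMap_cross (S := S) i₀ b₀ c₀
  intro htr
  rw [List.range_succ_eq_map, List.map_cons, List.prod_cons, List.map_map, h₀, hM,
    Matrix.vecMulVec_mul, Matrix.trace_vecMulVec] at htr
  rw [List.range_succ, List.map_append, List.prod_append, ← Matrix.vecMul_vecMul] at hr
  simp only [List.map_cons, List.map_nil, List.prod_cons, List.prod_nil, mul_one, hper, h₀, hM,
    Matrix.vecMul_vecMulVec] at hr
  rw [dotProduct_comm] at htr
  simp only [Function.comp_def, Nat.succ_eq_add_one] at htr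
  rw [htr, zero_smul] at hr
  have hr0 : r = 0 := by
    have := (smul_eq_zero.1 hr.symm).resolve_left hκ
    have h1 := congrFun this 0
    have h2 := congrFun this 1
    simp [toVec] at h1 h2
    exact Prod.ext h1 h2
  subst hr0
  rcases hstate with ⟨t, htn, i', b', c', h1, h2, h3, h4⟩ | ⟨P', s', c', h1, h2⟩
  · have h5 := h4 ((S.side i' !b').2 + 1)
    simp [cuspValue] at h5
  · exact h2.1 0 (by simp [cuspValue])

/-! ### Chords and corners of hexagons -/

theorem chordsDisjoint_iff (a b c d : BoundaryPoint) :
    ChordsDisjoint a b c d ↔ (c ≠ a ∧ c ≠ b ∧ d ≠ a ∧ d ≠ b) ∧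
      ((c < a ↔ c < b) ↔ (d < a ↔ d < b)) := by
  rw [ChordsDisjoint]
  rcases le_total a b with h | h
  · rw [Set.uIoo_of_le h, Set.uIcc_of_le h]
    simp only [Set.mem_Ioo, Set.mem_Icc]
    grind
  · rw [Set.uIoo_of_ge h, Set.uIcc_of_ge h]
    simp only [Set.mem_Ioo, Set.mem_Icc]
    grind

theorem ChordsDisjoint.symm {a b c d : BoundaryPoint} (h : ChordsDisjoint a b c d) :
    ChordsDisjoint c d a b := by
  rw [chordsDisjoint_iff] at h ⊢
  grind

theorem ChordsDisjoint.swap_left {a b c d : BoundaryPoint} (h : ChordsDisjoint a b c d) :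
    ChordsDisjoint b a c d := by
  rw [chordsDisjoint_iff] at h ⊢
  grind

theorem ChordsDisjoint.swap_right {a b c d : BoundaryPoint} (h : ChordsDisjoint a b c d) :
    ChordsDisjoint a b d c := by
  rw [chordsDisjoint_iff] at h ⊢
  grind

/-- `y` comes after `u` when moving upwards (`true`) or downwards (`false`). -/
def Beyond (o : Bool) (u y : ℝ) : Prop := if o then u < y else y < u

/-- The number of the side of a hexagon formed by the seam `s`. -/
def seamNumber (s : Fin 3) : ℕ := (2 * s.val + 3) % 6

/-- The point `q` lies in the corner cut off by the chord from the coordinate `u` on the boundary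
component `ε` to the coordinate `v` on the seam `seamAt ε o`. -/
def InCorner (ε : Fin 3) (o : Bool) (u v : ℝ) (q : BoundaryPoint) : Prop :=
  ((ofLex q).1 = 2 * ε.val ∧ Beyond o u (ofLex q).2) ∨
    ((ofLex q).1 = seamNumber (seamAt ε o) ∧ Beyond (!o) v (ofLex q).2)

/-- The point `q` lies on the side of the boundary component `ε` of the chord from the coordinate
`u` on its outgoing seam to the coordinate `v` on its incoming seam. -/
def InRegion (ε : Fin 3) (u v : ℝ) (q : BoundaryPoint) : Prop :=
  (ofLex q).1 = 2 * ε.val ∨ ((ofLex q).1 = seamNumber (seamAt ε true) ∧ (ofLex q).2 < u) ∨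
    ((ofLex q).1 = seamNumber (seamAt ε false) ∧ v < (ofLex q).2)

theorem boundaryPoint_lt_iff (q : BoundaryPoint) (n : ℕ) (u : ℝ) :
    q < toLex (n, u) ↔ (ofLex q).1 < n ∨ (ofLex q).1 = n ∧ (ofLex q).2 < u := by
  rw [Prod.Lex.lt_iff]; simp

theorem boundaryPoint_ne_iff (q : BoundaryPoint) (n : ℕ) (u : ℝ) :
    q ≠ toLex (n, u) ↔ ((ofLex q).1 = n → (ofLex q).2 ≠ u) := by
  rw [Ne, ← not_iff_not, not_not]
  push Not
  constructor
  · rintro rfl; simp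
  · rintro ⟨rfl, rfl⟩; simp

/-- The corner consists of the points on one side of the chord. Which order relations characterize
it depends on whether the corner contains the point at which the circle is cut. -/
theorem not_inCorner_iff (ε : Fin 3) (o : Bool) (u v : ℝ) (q : BoundaryPoint)
    (hq : (ofLex q).1 < 6) (h₁ : q ≠ toLex (2 * ε.val, u))
    (h₂ : q ≠ toLex (seamNumber (seamAt ε o), v)) :
    ¬ InCorner ε o u v q ↔
      ((q < toLex (2 * ε.val, u) ↔ q < toLex (seamNumber (seamAt ε o), v)) ↔
        ¬ (ε = 0 ∧ o = false)) := by
  rw [boundaryPoint_ne_iff] at h₁ h₂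
  rw [boundaryPoint_lt_iff, boundaryPoint_lt_iff, InCorner]
  generalize (ofLex q).1 = n at *
  generalize (ofLex q).2 = y at *
  cases o <;> fin_cases ε <;> simp [seamNumber, seamAt, Beyond] at * <;>
    interval_cases n <;> simp at * <;> grind

theorem not_inRegion_iff (ε : Fin 3) (u v : ℝ) (q : BoundaryPoint)
    (hq : (ofLex q).1 < 6) (h₁ : q ≠ toLex (seamNumber (seamAt ε true), u))
    (h₂ : q ≠ toLex (seamNumber (seamAt ε false), v)) :
    ¬ InRegion ε u v q ↔
      ((q < toLex (seamNumber (seamAt ε true), u) ↔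
        q < toLex (seamNumber (seamAt ε false), v)) ↔ ¬ ε = 0) := by
  rw [boundaryPoint_ne_iff] at h₁ h₂
  rw [boundaryPoint_lt_iff, boundaryPoint_lt_iff, InRegion]
  generalize (ofLex q).1 = n at *
  generalize (ofLex q).2 = y at *
  fin_cases ε <;> simp [seamNumber, seamAt] at * <;>
    interval_cases n <;> simp at * <;> grind

/-! ### Embedded closed paths -/

/-- A crossing of an edge at a given coordinate, where the coordinate is the one used in the tile
that is left. It is also the end, in this tile, of an arc. -/
abbrev End (S : PantsDecomposition) := S.Dart × ℝ

/-- The same point of the edge, seen from the tile on the other side. -/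
def End.rev (e : End S) : End S := (e.1.rev, e.1.flip e.2)

/-- The point on the boundary circle of the tile. -/
def End.pt (e : End S) : BoundaryPoint := e.1.exitPoint e.2

@[simp] theorem End.rev_rev (e : End S) : e.rev.rev = e := by
  obtain ⟨D, y⟩ := e
  cases D <;> simp [End.rev, Dart.rev, Dart.flip]

theorem Dart.sideNumber_lt (D : S.Dart) : D.sideNumber < 6 := by
  cases D with
  | seam P s c => exact Nat.mod_lt _ (by norm_num)
  | cross i b c => simp only [Dart.sideNumber]; omega

theorem Dart.eq_of_sideNumber {D D' : S.Dart} (h : D.src = D'.src)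
    (h' : D.sideNumber = D'.sideNumber) : D = D' := by
  rcases D with ⟨P, s, c⟩ | ⟨i, b, c⟩ <;> rcases D' with ⟨P', s', c'⟩ | ⟨i', b', c'⟩ <;>
    simp only [Dart.src, Prod.mk.injEq, Dart.sideNumber] at h h'
  · obtain ⟨rfl, rfl⟩ := h
    congr 1
    omega
  · omega
  · omega
  · obtain ⟨h, rfl⟩ := h
    have h' : (S.side i b).2 = (S.side i' b').2 := by omega
    have : (i, b) = (i', b') := S.side_injective (Prod.ext h h')
    simp_all

/-- The closed path with the crossings `p` is embedded. -/
structure Drawn {m : ℕ} (p : Fin (m + 1) → End S) : Prop where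
  closed : ∀ j, (p j).1.tgt = (p (j + 1)).1.src
  nondegenerate : ∀ j, (p j).rev.pt ≠ (p (j + 1)).pt
  disjoint : ∀ j j', j ≠ j' → (p j).1.tgt = (p j').1.tgt →
    ChordsDisjoint (p j).rev.pt (p (j + 1)).pt (p j').rev.pt (p (j' + 1)).pt

/-- `e` and `e'` are the ends of one of the arcs into which the edges cut the closed path `p`. -/
def Arc {m : ℕ} (p : Fin (m + 1) → End S) (e e' : End S) : Prop :=
  ∃ j, (e = (p j).rev ∧ e' = p (j + 1)) ∨ (e' = (p j).rev ∧ e = p (j + 1))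

/-- `e` is an end of an arc of `p`. -/
def IsEnd {m : ℕ} (p : Fin (m + 1) → End S) (e : End S) : Prop :=
  ∃ j, e = p j ∨ e = (p j).rev

section

variable {m : ℕ} {p : Fin (m + 1) → End S}

theorem Arc.symm {e e' : End S} (h : Arc p e e') : Arc p e' e := by
  obtain ⟨j, h⟩ := h
  exact ⟨j, h.symm⟩

theorem Arc.isEnd {e e' : End S} (h : Arc p e e') : IsEnd p e := by
  obtain ⟨j, ⟨h, -⟩ | ⟨-, h⟩⟩ := h
  · exact ⟨j, Or.inr h⟩
  · exact ⟨j + 1, Or.inl h⟩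

theorem IsEnd.rev {e : End S} (h : IsEnd p e) : IsEnd p e.rev := by
  obtain ⟨j, rfl | rfl⟩ := h
  · exact ⟨j, Or.inr rfl⟩
  · exact ⟨j, Or.inl (by simp)⟩

theorem IsEnd.exists_arc {e : End S} (h : IsEnd p e) : ∃ e', Arc p e e' := by
  obtain ⟨j, rfl | rfl⟩ := h
  · exact ⟨(p (j - 1)).rev, j - 1, Or.inr ⟨rfl, by simp⟩⟩
  · exact ⟨p (j + 1), j, Or.inl ⟨rfl, rfl⟩⟩

namespace Drawn

theorem src_eq (hp : Drawn p) {e e' : End S} (h : Arc p e e') : e.1.src = e'.1.src := by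
  obtain ⟨j, ⟨rfl, rfl⟩ | ⟨rfl, rfl⟩⟩ := h
  · exact hp.closed j
  · exact (hp.closed j).symm

/-- An arc is determined by an end. -/
theorem index_eq (hp : Drawn p) {j j' : Fin (m + 1)} {e : End S} (h : e = (p j).rev ∨ e = p (j + 1))
    (h' : e = (p j').rev ∨ e = p (j' + 1)) : j = j' := by
  by_contra hne
  have ht : ∀ j, (e = (p j).rev ∨ e = p (j + 1)) → e.1.src = (p j).1.tgt := by
    rintro j (rfl | rfl)
    · rfl
    · exact (hp.closed j).symm
  have hd := (chordsDisjoint_iff _ _ _ _).1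
    (hp.disjoint j j' hne ((ht j h).symm.trans (ht j' h')))
  rcases h with rfl | rfl <;> rcases h' with h' | h' <;> simp [h'] at hd

theorem rev_ne (hp : Drawn p) (j j' : Fin (m + 1)) : (p j).rev ≠ p j' := by
  intro h
  have : j = j' - 1 := hp.index_eq (e := (p j).rev) (Or.inl rfl) (Or.inr (by simpa using h))
  apply hp.nondegenerate j
  rw [h, this]; simp

theorem injective (hp : Drawn p) : Function.Injective p := by
  intro j j' h
  have : j - 1 = j' - 1 := hp.index_eq (e := p j) (Or.inr (by simp)) (Or.inr (by simpa using h))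
  simpa using this

theorem arc_unique (hp : Drawn p) {e e₁ e₂ : End S} (h₁ : Arc p e e₁) (h₂ : Arc p e e₂) :
    e₁ = e₂ := by
  obtain ⟨j, h₁⟩ := h₁
  obtain ⟨j', h₂⟩ := h₂
  have hj : j = j' := hp.index_eq (e := e) (h₁.imp And.left And.right) (h₂.imp And.left And.right)
  subst hj
  rcases h₁ with ⟨h, h₁⟩ | ⟨h₁, h⟩ <;> rcases h₂ with ⟨h', h₂⟩ | ⟨h₂, h'⟩
  · rw [h₁, h₂]
  · exact absurd (h.symm.trans h') (hp.rev_ne _ _)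
  · exact absurd (h'.symm.trans h) (hp.rev_ne _ _)
  · rw [h₁, h₂]

/-- Distinct arcs in the same tile are disjoint. -/
theorem chordsDisjoint (hp : Drawn p) {e₁ e₂ e₃ e₄ : End S} (h : Arc p e₁ e₂) (h' : Arc p e₃ e₄)
    (ht : e₁.1.src = e₃.1.src) (h₁ : e₃ ≠ e₁) (h₂ : e₃ ≠ e₂) :
    ChordsDisjoint e₁.pt e₂.pt e₃.pt e₄.pt := by
  have ht₂ := hp.src_eq h
  have ht₄ := hp.src_eq h'
  obtain ⟨j, hj⟩ := h
  obtain ⟨j', hj'⟩ := h'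
  have hne : j ≠ j' := by
    rintro rfl
    rcases hj with ⟨h, h'⟩ | ⟨h, h'⟩ <;> rcases hj' with ⟨h'', h'''⟩ | ⟨h'', h'''⟩ <;> simp_all
  have htj : (p j).1.tgt = e₁.1.src := by
    rcases hj with ⟨rfl, h'⟩ | ⟨rfl, h'⟩
    · rfl
    · rw [ht₂]; rfl
  have htj' : (p j').1.tgt = e₃.1.src := by
    rcases hj' with ⟨rfl, h'⟩ | ⟨rfl, h'⟩
    · rfl
    · rw [ht₄]; rfl
  have key := hp.disjoint j j' hne (by rw [htj, htj', ht])
  rcases hj with ⟨rfl, rfl⟩ | ⟨rfl, rfl⟩ <;> rcases hj' with ⟨rfl, rfl⟩ | ⟨rfl, rfl⟩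
  · exact key
  · exact key.swap_right
  · exact key.swap_left
  · exact key.swap_left.swap_right

/-- Consecutive arcs are consecutive in one of the two directions of the path. -/
theorem exists_index (hp : Drawn p) {e₁ e₂ e₃ : End S} (h : Arc p e₁ e₂) (h' : Arc p e₂.rev e₃) :
    ∃ j, (p j = e₁.rev ∧ p (j + 1) = e₂ ∧ p (j + 1 + 1) = e₃) ∨
      (p j = e₃.rev ∧ p (j + 1) = e₂.rev ∧ p (j + 1 + 1) = e₁) := by
  obtain ⟨j, ⟨rfl, rfl⟩ | ⟨rfl, rfl⟩⟩ := h
  · refine ⟨j, Or.inl ⟨by simp, rfl, ?_⟩⟩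
    rw [← hp.arc_unique (e := (p (j + 1)).rev) ⟨j + 1, Or.inl ⟨rfl, rfl⟩⟩ h']
  · rw [End.rev_rev] at h'
    have : e₃ = (p (j - 1)).rev :=
      hp.arc_unique h' ⟨j - 1, Or.inr ⟨rfl, by simp⟩⟩
    refine ⟨j - 1, Or.inr ⟨by simp [this], by simp, ?_⟩⟩
    rw [sub_add_cancel]

end Drawn

end

/-! ### Surgery on embedded closed paths -/

/-- The closed path with the crossings `p` is freely homotopic to `γ`. -/
def Represents (γ : S.Loop) {m : ℕ} (p : Fin (m + 1) → End S) : Prop :=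
  ∃ h : S.IsLoop (List.ofFn fun j => (p j).1),
    FreelyHomotopic γ ⟨List.ofFn fun j => (p j).1, h⟩

theorem ofFn_add_one {α : Type*} {m : ℕ} (f : Fin (m + 1) → α) :
    (List.ofFn fun j => f (j + 1)) = (List.ofFn fun j : Fin m => f j.succ) ++ [f 0] := by
  rw [List.ofFn_succ_last]
  simp

theorem Represents.add_one {γ : S.Loop} {m : ℕ} {p : Fin (m + 1) → End S} (h : Represents γ p) :
    Represents γ (fun j => p (j + 1)) := by
  obtain ⟨h, hγ⟩ := h
  have e : (List.ofFn fun j => (p j).1) = [(p 0).1] ++ List.ofFn fun j : Fin m => (p j.succ).1 := by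
    rw [List.ofFn_succ]; rfl
  have e' : (List.ofFn fun j => (p (j + 1)).1) =
      (List.ofFn fun j : Fin m => (p j.succ).1) ++ [(p 0).1] := ofFn_add_one fun j => (p j).1
  have h' : S.IsLoop ([(p 0).1] ++ List.ofFn fun j : Fin m => (p j.succ).1) := e ▸ h
  refine ⟨e' ▸ isLoop_append_comm h', hγ.trans ?_⟩
  convert freelyHomotopic_append_comm h' using 2

theorem Drawn.add_one {m : ℕ} {p : Fin (m + 1) → End S} (h : Drawn p) :
    Drawn (fun j => p (j + 1)) :=
  ⟨fun _ => h.closed _, fun _ => h.nondegenerate _,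
    fun _ _ hj => h.disjoint _ _ (fun e => hj (add_right_cancel e))⟩

theorem drawn_represents_add {γ : S.Loop} {m : ℕ} {p : Fin (m + 1) → End S} (hp : Drawn p)
    (h : Represents γ p) (k : Fin (m + 1)) :
    Drawn (fun j => p (j + k)) ∧ Represents γ (fun j => p (j + k)) := by
  obtain ⟨k, hk⟩ := k
  induction k with
  | zero =>
    have : (⟨0, hk⟩ : Fin (m + 1)) = 0 := rfl
    simpa [this] using ⟨hp, h⟩
  | succ k ih =>
    obtain ⟨h1, h2⟩ := ih (by omega)
    have e : ∀ j : Fin (m + 1), j + 1 + ⟨k, by omega⟩ = j + ⟨k + 1, hk⟩ := by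
      intro j
      rw [add_assoc]
      congr 1
      apply Fin.ext
      rw [Fin.val_add]
      cases m with
      | zero => omega
      | succ m => simp [add_comm 1 k, Nat.mod_eq_of_lt hk]
    have h1 := h1.add_one
    have h2 := h2.add_one
    simp only [e] at h1 h2
    exact ⟨h1, h2⟩

/-- The chord obtained by joining two chords with adjacent ends is disjoint from every chord that is
disjoint from both. -/
theorem ChordsDisjoint.join {a x y b c d : BoundaryPoint} (h : ChordsDisjoint a x c d)
    (h' : ChordsDisjoint y b c d) (hc : c < x ↔ c < y) (hd : d < x ↔ d < y) :
    ChordsDisjoint a b c d := by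
  rw [chordsDisjoint_iff] at *
  grind

/-- Moving the end of a chord to an adjacent point. Here `F` is false if the points are adjacent
across the point where the circle is cut. -/
theorem ChordsDisjoint.move {a x y c d : BoundaryPoint} {F : Prop} (h : ChordsDisjoint a x c d)
    (hcy : c ≠ y) (hdy : d ≠ y) (hc : (c < x ↔ c < y) ↔ F) (hd : (d < x ↔ d < y) ↔ F) :
    ChordsDisjoint a y c d := by
  rw [chordsDisjoint_iff] at *
  grind

theorem chordsDisjoint_of_adjacent {x y c d : BoundaryPoint} {F : Prop}
    (hcx : c ≠ x) (hcy : c ≠ y) (hdx : d ≠ x) (hdy : d ≠ y)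
    (hc : (c < x ↔ c < y) ↔ F) (hd : (d < x ↔ d < y) ↔ F) :
    ChordsDisjoint x y c d := by
  rw [chordsDisjoint_iff]
  grind

section Fin

variable {n : ℕ}

theorem succ_succ_add_one {k : Fin (n + 1)} (hk : k ≠ Fin.last n) :
    (k + 1).succ.succ = (k.succ.succ + 1 : Fin (n + 3)) := by
  have hk' : k.val < n := Fin.val_lt_last hk
  apply Fin.ext
  rw [Fin.val_add_one_of_lt (Fin.lt_def.2 (by simp; omega))]
  simp [Fin.val_add_one_of_lt (Fin.lt_last_iff_ne_last.2 hk)]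

theorem last_succ_succ : (Fin.last n).succ.succ = Fin.last (n + 2) := rfl

theorem eq_zero_or_one_or_succ_succ (j : Fin (n + 3)) :
    j = 0 ∨ j = 1 ∨ ∃ k : Fin (n + 1), j = k.succ.succ := by
  refine Fin.cases (Or.inl rfl) (fun j => Or.inr ?_) j
  refine Fin.cases (Or.inl rfl) (fun j => Or.inr ⟨j, rfl⟩) j

theorem succ_succ_ne_zero (k : Fin (n + 1)) : (k.succ.succ : Fin (n + 3)) ≠ 0 :=
  Fin.succ_ne_zero _

theorem succ_succ_ne_one (k : Fin (n + 1)) : (k.succ.succ : Fin (n + 3)) ≠ 1 := by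
  intro h
  have := congrArg Fin.val h
  simp at this

theorem one_add_one_fin : (1 + 1 : Fin (n + 3)) = (0 : Fin (n + 1)).succ.succ := by
  apply Fin.ext
  rw [Fin.val_add_one_of_lt (Fin.lt_def.2 (by simp))]
  rfl

end Fin

/-- Deleting two consecutive crossings of the same edge, if there are no other crossings between
them. -/
theorem Drawn.delete {n : ℕ} {p : Fin (n + 3) → End S} (hp : Drawn p)
    (h : (p 1).1 = (p 0).1.rev)
    (hclear : ∀ z, IsEnd p ((p 0).1, z) → z ∉ Set.uIoo (p 0).2 (p 1).rev.2) :
    Drawn (fun k : Fin (n + 1) => p k.succ.succ) := by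
  have e0 : Fin.last (n + 2) + 1 = 0 := Fin.last_add_one _
  have h01 : (p 1).rev.1 = (p 0).1 := by simp [End.rev, h]
  have hadj : ∀ e : End S, IsEnd p e → e.pt ≠ (p 0).pt → e.pt ≠ (p 1).rev.pt →
      e.1.src = (p 0).1.src → (e.pt < (p 0).pt ↔ e.pt < (p 1).rev.pt) := by
    intro e he h0 h1 hsrc
    simp only [End.pt, Dart.exitPoint, h01] at h0 h1 ⊢
    rw [boundaryPoint_ne_iff] at h0 h1
    rw [boundaryPoint_lt_iff, boundaryPoint_lt_iff]
    simp only [ofLex_toLex] at h0 h1 ⊢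
    by_cases hs : e.1.sideNumber = (p 0).1.sideNumber
    · have hD := Dart.eq_of_sideNumber hsrc hs
      have hc := hclear e.2 (by rw [← hD]; exact he)
      have h0 := h0 hs
      have h1 := h1 hs
      simp only [hs, lt_irrefl, false_or, true_and]
      rcases le_total (p 0).2 (p 1).rev.2 with hle | hle
      · rw [Set.uIoo_of_le hle, Set.mem_Ioo] at hc
        grind
      · rw [Set.uIoo_of_ge hle, Set.mem_Ioo] at hc
        grind
    · simp [hs]
  have hlast : (p (Fin.last (n + 2))).1.tgt = (p 1).1.tgt := by
    rw [hp.closed, e0, h, Dart.tgt_rev]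
  have hlast1 : Fin.last (n + 2) ≠ 1 := by
    rw [← last_succ_succ]; exact succ_succ_ne_one _
  have hjoin : ∀ k : Fin (n + 1), k ≠ Fin.last n →
      (p (Fin.last (n + 2))).1.tgt = (p k.succ.succ).1.tgt →
      ChordsDisjoint (p (Fin.last (n + 2))).rev.pt (p (0 : Fin (n + 1)).succ.succ).pt
        (p k.succ.succ).rev.pt (p (k.succ.succ + 1)).pt := by
    intro k hk ht
    have h1 := hp.disjoint (Fin.last (n + 2)) k.succ.succ
      (fun e => hk (by rw [← last_succ_succ] at e; simpa using e.symm)) ht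
    have h2 := hp.disjoint 1 k.succ.succ (succ_succ_ne_one k).symm (hlast.symm.trans ht)
    rw [e0] at h1
    rw [one_add_one_fin] at h2
    have h1' := ((chordsDisjoint_iff _ _ _ _).1 h1).1
    have h2' := ((chordsDisjoint_iff _ _ _ _).1 h2).1
    have ht0 : (p k.succ.succ).1.tgt = (p 0).1.src := by
      rw [← ht, hp.closed, e0]
    exact h1.join h2 (hadj _ ⟨_, Or.inr rfl⟩ h1'.2.1 h2'.1 ht0)
      (hadj _ ⟨_, Or.inl rfl⟩ h1'.2.2.2 h2'.2.2.1 ((hp.closed _).symm.trans ht0))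
  have hstep : ∀ k : Fin (n + 1), k ≠ Fin.last n → p (k + 1).succ.succ = p (k.succ.succ + 1) :=
    fun k hk => by rw [succ_succ_add_one hk]
  have hstep' : p (Fin.last n + 1).succ.succ = p (0 : Fin (n + 1)).succ.succ := by
    rw [Fin.last_add_one]
  refine ⟨fun k => ?_, fun k => ?_, fun k k' hne ht => ?_⟩
  · by_cases hk : k = Fin.last n
    · subst hk
      rw [hstep', last_succ_succ, hlast, hp.closed, one_add_one_fin]
    · rw [hstep k hk]; exact hp.closed _
  · by_cases hk : k = Fin.last n
    · subst hk
      rw [hstep', last_succ_succ]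
      have := hp.disjoint (Fin.last (n + 2)) 1 hlast1 hlast
      rw [one_add_one_fin] at this
      exact ((chordsDisjoint_iff _ _ _ _).1 this).1.2.2.1.symm
    · rw [hstep k hk]; exact hp.nondegenerate _
  · by_cases hk : k = Fin.last n
    · subst hk
      rw [hstep', hstep k' hne.symm]
      exact hjoin k' hne.symm ht
    · by_cases hk' : k' = Fin.last n
      · subst hk'
        rw [hstep', hstep k hk]
        exact (hjoin k hk ht.symm).symm
      · rw [hstep k hk, hstep k' hk']
        exact hp.disjoint _ _ (by simpa using hne) ht

theorem represents_delete {γ : S.Loop} {n : ℕ} {p : Fin (n + 3) → End S} (hγ : Represents γ p)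
    (h : (p 1).1 = (p 0).1.rev) : Represents γ (fun k : Fin (n + 1) => p k.succ.succ) := by
  obtain ⟨hl, hγ⟩ := hγ
  have e : (List.ofFn fun j => (p j).1) =
      [(p 0).1, (p 0).1.rev] ++ List.ofFn fun k : Fin (n + 1) => (p k.succ.succ).1 := by
    rw [List.ofFn_succ, List.ofFn_succ, ← h]; rfl
  simp only [e] at hγ hl
  have hpath : ∃ x, IsPath x ([(p 0).1, (p 0).1.rev] ++
      List.ofFn fun k : Fin (n + 1) => (p k.succ.succ).1) x := isLoop_iff.1 hl
  obtain ⟨x, hx⟩ := hpath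
  obtain ⟨y, hy, hr⟩ := isPath_append.1 hx
  have hx' : (p 0).1.src = x := hy.1
  subst hx'
  have hy' : y = (p 0).1.src := by
    have := hy.2.2
    simp only [IsPath, Dart.tgt_rev] at this
    exact this.symm
  subst hy'
  refine ⟨hr.isLoop, hγ.trans ?_⟩
  have := (PathHomotopic.backtrack (p 0).1).homotopic _ hl hr.isLoop hr
  exact this

/-- Pushing an arc across the vertex at a corner that contains no other ends of arcs. The two new
crossings are chosen closer to the vertex than all crossings of the old path. -/
theorem Drawn.push {n : ℕ} {p : Fin (n + 3) → End S} (hp : Drawn p) {i : Fin S.ξ} {b c o : Bool}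
    (h₀ : (p 0).1 = .cross i b c)
    (h₁ : (p 1).1 = .seam (S.side i !b).1 (seamAt (S.side i !b).2 o) c)
    (hclear : ∀ e, IsEnd p e → e.1.src = ((S.side i !b).1, c) →
      ¬ InCorner (S.side i !b).2 o (p 0).rev.2 (p 1).2 e.pt) :
    ∃ z w : ℝ, Drawn (Fin.cons (.seam (S.side i b).1 (seamAt (S.side i b).2 !o) c, z)
      (Fin.cons (.cross i b !c, w) fun k : Fin (n + 1) => p k.succ.succ) :
        Fin (n + 3) → End S) := by
  -- a bound for the coordinates of all crossings
  obtain ⟨M, hM⟩ : ∃ M : ℝ, ∀ e, IsEnd p e → |e.2| < M := by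
    refine ⟨1 + ∑ j, |(p j).2|, ?_⟩
    have h : ∀ j, |(p j).2| < 1 + ∑ j, |(p j).2| := fun j =>
      lt_of_le_of_lt (Finset.single_le_sum (f := fun j => |(p j).2|) (fun j _ => abs_nonneg _)
        (Finset.mem_univ j)) (by linarith)
    rintro e ⟨j, rfl | rfl⟩
    · exact h j
    · have : |(p j).rev.2| = |(p j).2| := by
        rw [End.rev]
        cases (p j).1 <;> simp [Dart.flip]
      rw [this]; exact h j
  have hM' : ∀ e, IsEnd p e → -M < e.2 ∧ e.2 < M := fun e he => abs_lt.1 (hM e he)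
  set z : ℝ := if o then M else -M with hz
  set w : ℝ := if o then -M else M with hw
  refine ⟨z, w, ?_⟩
  set Z : End S := (.seam (S.side i b).1 (seamAt (S.side i b).2 !o) c, z) with hZ
  set V : End S := (.cross i b !c, w) with hV
  set p' : Fin (n + 3) → End S :=
    Fin.cons Z (Fin.cons V fun k : Fin (n + 1) => p k.succ.succ) with hp'
  have p0 : p' 0 = Z := rfl
  have p1 : p' 1 = V := rfl
  have pk : ∀ k : Fin (n + 1), p' k.succ.succ = p k.succ.succ := fun _ => rfl
  have e0 : Fin.last (n + 2) + 1 = 0 := Fin.last_add_one _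
  -- the ends of arcs in the adjacent tiles do not lie in the relevant corners
  have clear₁ : ∀ e, IsEnd p e → e.1.src = ((S.side i b).1, c) →
      ¬ InCorner (S.side i b).2 (!o) (p 0).2 z e.pt := by
    rintro ⟨D, y⟩ he hsrc (⟨h1, h2⟩ | ⟨h1, h2⟩)
    · have hD : D = .cross i b c := Dart.eq_of_sideNumber hsrc h1
      subst hD
      refine hclear _ he.rev rfl (Or.inl ⟨rfl, ?_⟩)
      simp only [End.pt, Dart.exitPoint, ofLex_toLex, End.rev, h₀, Dart.flip, Beyond] at h2 ⊢
      cases o <;> simpa using h2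
    · have := hM' _ he
      simp only [End.pt, Dart.exitPoint, ofLex_toLex, Beyond, hz] at h2 this
      cases o <;> simp at h2 <;> linarith
  have clear₂ : ∀ e, IsEnd p e → e.1.src = ((S.side i b).1, !c) →
      ¬ InCorner (S.side i b).2 (!o) w z e.pt := by
    rintro ⟨D, y⟩ he hsrc (⟨h1, h2⟩ | ⟨h1, h2⟩)
    all_goals
      have := hM' _ he
      simp only [End.pt, Dart.exitPoint, ofLex_toLex, Beyond, hz, hw] at h2 this
      cases o <;> simp at h2 <;> linarith
  have clear₃ : ∀ e, IsEnd p e → e.1.src = ((S.side i !b).1, !c) →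
      ¬ InCorner (S.side i !b).2 o (-w) (p 1).2 e.pt := by
    rintro ⟨D, y⟩ he hsrc (⟨h1, h2⟩ | ⟨h1, h2⟩)
    · have := hM' _ he
      simp only [End.pt, Dart.exitPoint, ofLex_toLex, Beyond, hw] at h2 this
      cases o <;> simp at h2 <;> linarith
    · have hD : D = .seam (S.side i !b).1 (seamAt (S.side i !b).2 o) (!c) :=
        Dart.eq_of_sideNumber hsrc h1
      subst hD
      refine hclear _ he.rev (by simp [End.rev, Dart.rev, Dart.src]) (Or.inr ⟨rfl, h2⟩)
  -- the new ends are distinct from the old ones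
  have neZ : ∀ e, IsEnd p e → e.pt ≠ Z.pt := by
    intro e he h
    have := hM' _ he
    have h2 := congrArg (fun q => (ofLex q).2) h
    simp only [End.pt, Dart.exitPoint, ofLex_toLex, hZ, hz] at h2
    split_ifs at h2 <;> linarith
  have neV : ∀ e, IsEnd p e → e.pt ≠ V.pt := by
    intro e he h
    have := hM' _ he
    have h2 := congrArg (fun q => (ofLex q).2) h
    simp only [End.pt, Dart.exitPoint, ofLex_toLex, hV, hw] at h2
    split_ifs at h2 <;> linarith
  have neV' : ∀ e, IsEnd p e → e.pt ≠ V.rev.pt := by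
    intro e he h
    have := hM' _ he
    have h2 := congrArg (fun q => (ofLex q).2) h
    simp only [End.pt, Dart.exitPoint, ofLex_toLex, hV, hw, End.rev, Dart.flip] at h2
    split_ifs at h2 <;> linarith
  have Zrev : Z.rev.pt = Z.pt := rfl
  have lt6 : ∀ e : End S, (ofLex e.pt).1 < 6 := fun e => e.1.sideNumber_lt
  have Zpt : Z.pt = toLex (seamNumber (seamAt (S.side i b).2 !o), z) := rfl
  have Vpt : V.pt = toLex (2 * (S.side i b).2.val, w) := rfl
  have Vpt' : V.rev.pt = toLex (2 * (S.side i !b).2.val, -w) := rfl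
  have pt0 : (p 0).pt = toLex (2 * (S.side i b).2.val, (p 0).2) := by
    simp [End.pt, Dart.exitPoint, h₀, Dart.sideNumber]
  have pt1 : (p 1).rev.pt = toLex (seamNumber (seamAt (S.side i !b).2 o), (p 1).2) := by
    simp [End.pt, Dart.exitPoint, h₁, Dart.sideNumber, End.rev, Dart.rev, Dart.flip, seamNumber]
  have tgt0 : Z.1.tgt = ((S.side i b).1, !c) := rfl
  have tgt1 : V.1.tgt = ((S.side i !b).1, !c) := rfl
  have tgt1' : (p 1).1.tgt = ((S.side i !b).1, !c) := by rw [h₁]; rfl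
  have src0 : (p 0).1.src = ((S.side i b).1, c) := by rw [h₀]; rfl
  have tlast : (p (Fin.last (n + 2))).1.tgt = ((S.side i b).1, c) := by
    rw [hp.closed, e0, src0]
  -- the three new arcs are disjoint from the old ones, and from each other
  have arc₁ : ∀ k : Fin (n + 1), k ≠ Fin.last n →
      (p (Fin.last (n + 2))).1.tgt = (p k.succ.succ).1.tgt →
      ChordsDisjoint (p (Fin.last (n + 2))).rev.pt Z.pt
        (p k.succ.succ).rev.pt (p (k.succ.succ + 1)).pt := by
    intro k hk ht
    have h1 := hp.disjoint (Fin.last (n + 2)) k.succ.succ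
      (fun e => hk (by rw [← last_succ_succ] at e; simpa using e.symm)) ht
    rw [e0] at h1
    have h1' := ((chordsDisjoint_iff _ _ _ _).1 h1).1
    have key : ∀ e, IsEnd p e → e.1.src = ((S.side i b).1, c) → e.pt ≠ (p 0).pt →
        ((e.pt < (p 0).pt ↔ e.pt < Z.pt) ↔ ¬ ((S.side i b).2 = 0 ∧ (!o) = false)) := by
      intro e he hsrc hne
      rw [pt0, Zpt]
      exact (not_inCorner_iff _ _ _ _ _ (lt6 e) (pt0 ▸ hne) (Zpt ▸ neZ e he)).1
        (clear₁ e he hsrc)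
    exact h1.move (neZ _ ⟨_, Or.inr rfl⟩) (neZ _ ⟨_, Or.inl rfl⟩)
      (key _ ⟨_, Or.inr rfl⟩ (ht.symm.trans tlast) h1'.2.1)
      (key _ ⟨_, Or.inl rfl⟩ ((hp.closed _).symm.trans (ht.symm.trans tlast)) h1'.2.2.2)
  have key₂ : ∀ e, IsEnd p e → e.1.src = ((S.side i b).1, !c) →
      ((e.pt < Z.pt ↔ e.pt < V.pt) ↔ ¬ ((S.side i b).2 = 0 ∧ (!o) = false)) := by
    intro e he hsrc
    rw [Zpt, Vpt, Iff.comm (a := e.pt < _)]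
    exact (not_inCorner_iff _ _ _ _ _ (lt6 e) (Vpt ▸ neV e he) (Zpt ▸ neZ e he)).1
      (clear₂ e he hsrc)
  have arc₂ : ∀ k : Fin (n + 1), k ≠ Fin.last n → Z.1.tgt = (p k.succ.succ).1.tgt →
      ChordsDisjoint Z.rev.pt V.pt (p k.succ.succ).rev.pt (p (k.succ.succ + 1)).pt := by
    intro k hk ht
    rw [Zrev]
    exact chordsDisjoint_of_adjacent (neZ _ ⟨_, Or.inr rfl⟩) (neV _ ⟨_, Or.inr rfl⟩)
      (neZ _ ⟨_, Or.inl rfl⟩) (neV _ ⟨_, Or.inl rfl⟩)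
      (key₂ _ ⟨_, Or.inr rfl⟩ (ht.symm.trans tgt0))
      (key₂ _ ⟨_, Or.inl rfl⟩ ((hp.closed _).symm.trans (ht.symm.trans tgt0)))
  have arc₃ : ∀ k : Fin (n + 1), k ≠ Fin.last n → V.1.tgt = (p k.succ.succ).1.tgt →
      ChordsDisjoint V.rev.pt (p (0 : Fin (n + 1)).succ.succ).pt
        (p k.succ.succ).rev.pt (p (k.succ.succ + 1)).pt := by
    intro k hk ht
    have h1 := hp.disjoint 1 k.succ.succ (succ_succ_ne_one k).symm
      (tgt1'.trans (tgt1.symm.trans ht))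
    rw [one_add_one_fin] at h1
    have h1' := ((chordsDisjoint_iff _ _ _ _).1 h1).1
    have key : ∀ e, IsEnd p e → e.1.src = ((S.side i !b).1, !c) → e.pt ≠ (p 1).rev.pt →
        ((e.pt < (p 1).rev.pt ↔ e.pt < V.rev.pt) ↔ ¬ ((S.side i !b).2 = 0 ∧ o = false)) := by
      intro e he hsrc hne
      rw [pt1, Vpt', Iff.comm (a := e.pt < _)]
      exact (not_inCorner_iff _ _ _ _ _ (lt6 e) (Vpt' ▸ neV' e he) (pt1 ▸ hne)).1
        (clear₃ e he hsrc)
    exact (h1.swap_left.move (neV' _ ⟨_, Or.inr rfl⟩) (neV' _ ⟨_, Or.inl rfl⟩)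
      (key _ ⟨_, Or.inr rfl⟩ (ht.symm.trans tgt1) h1'.1)
      (key _ ⟨_, Or.inl rfl⟩ ((hp.closed _).symm.trans (ht.symm.trans tgt1)) h1'.2.2.1)).swap_left
  have arc₂₃ : Z.1.tgt = V.1.tgt →
      ChordsDisjoint Z.rev.pt V.pt V.rev.pt (p (0 : Fin (n + 1)).succ.succ).pt := by
    intro ht
    have hP : (S.side i b).1 = (S.side i !b).1 :=
      (Prod.mk.inj (tgt0.symm.trans (ht.trans tgt1))).1
    have hε : (S.side i b).2 ≠ (S.side i !b).2 := by
      intro h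
      have : (i, b) = (i, !b) := S.side_injective (Prod.ext hP h)
      simp at this
    have hside : (S.side i !b).2.val ≠ (S.side i b).2.val := fun h => hε (Fin.ext h).symm
    have hV1 : V.rev.pt ≠ V.pt := by
      rw [Vpt, Vpt', boundaryPoint_ne_iff]
      intro h
      simp only [ofLex_toLex] at h
      omega
    have hodd : ∀ s, seamNumber s % 2 = 1 := by intro s; simp only [seamNumber]; omega
    have hV2 : V.rev.pt ≠ Z.pt := by
      rw [Zpt, Vpt', boundaryPoint_ne_iff]
      intro h
      simp only [ofLex_toLex] at h
      have := hodd (seamAt (S.side i b).2 !o)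
      omega
    have hcorner : ¬ InCorner (S.side i b).2 (!o) w z V.rev.pt := by
      rintro (⟨h, -⟩ | ⟨h, -⟩)
      · simp only [Vpt', ofLex_toLex] at h; omega
      · have := hodd (seamAt (S.side i b).2 !o)
        simp only [Vpt', ofLex_toLex] at h
        omega
    have h1 := (not_inCorner_iff _ _ _ _ _ (lt6 V.rev) (Vpt ▸ hV1) (Zpt ▸ hV2)).1 hcorner
    rw [Iff.comm (a := V.rev.pt < _), ← Zpt, ← Vpt] at h1
    rw [Zrev]
    refine chordsDisjoint_of_adjacent hV2 hV1 (neZ _ ⟨_, Or.inl rfl⟩) (neV _ ⟨_, Or.inl rfl⟩)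
      h1 (key₂ _ ⟨_, Or.inl rfl⟩ ?_)
    rw [← one_add_one_fin, ← hp.closed, tgt1', hP]
  have hstep : ∀ k : Fin (n + 1), k ≠ Fin.last n →
      p' (k.succ.succ + 1) = p (k.succ.succ + 1) := by
    intro k hk
    rw [← succ_succ_add_one hk, pk]
  have hlast : p' (Fin.last (n + 2)) = p (Fin.last (n + 2)) := by
    rw [← last_succ_succ, pk]
  have p2 : p' (1 + 1) = p (0 : Fin (n + 1)).succ.succ := by rw [one_add_one_fin, pk]
  have cases : ∀ j : Fin (n + 3), j = 0 ∨ j = 1 ∨ j = Fin.last (n + 2) ∨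
      ∃ k : Fin (n + 1), k ≠ Fin.last n ∧ j = k.succ.succ := by
    intro j
    rcases eq_zero_or_one_or_succ_succ j with h | h | ⟨k, h⟩
    · exact Or.inl h
    · exact Or.inr (Or.inl h)
    · by_cases hk : k = Fin.last n
      · exact Or.inr (Or.inr (Or.inl (by rw [h, hk, last_succ_succ])))
      · exact Or.inr (Or.inr (Or.inr ⟨k, hk, h⟩))
  have hcc : c ≠ !c := by cases c <;> simp
  refine ⟨fun j => ?_, fun j => ?_, fun j j' hne ht => ?_⟩
  · rcases cases j with rfl | rfl | rfl | ⟨k, hk, rfl⟩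
    · rw [zero_add, p0, p1]; rfl
    · rw [p1, p2, ← one_add_one_fin, ← hp.closed, tgt1', tgt1]
    · rw [hlast, e0, p0, tlast]; rfl
    · rw [pk, hstep k hk, hp.closed]
  · rcases cases j with rfl | rfl | rfl | ⟨k, hk, rfl⟩
    · rw [zero_add, p0, p1, Zrev, Zpt, Vpt, boundaryPoint_ne_iff]
      intro h
      simp only [ofLex_toLex, seamNumber] at h
      omega
    · rw [p1, p2]
      exact (neV' _ ⟨_, Or.inl rfl⟩).symm
    · rw [hlast, e0, p0]
      exact neZ _ ⟨_, Or.inr rfl⟩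
    · rw [pk, hstep k hk]; exact hp.nondegenerate _
  · rcases cases j with rfl | rfl | rfl | ⟨k, hk, rfl⟩ <;>
      rcases cases j' with rfl | rfl | rfl | ⟨k', hk', rfl⟩
    · exact absurd rfl hne
    · rw [zero_add, p0, p1, p2]
      exact arc₂₃ ht
    · rw [p0, hlast, tlast, tgt0] at ht
      exact absurd (congrArg Prod.snd ht).symm hcc
    · rw [zero_add, p0, p1, pk, hstep k' hk']
      exact arc₂ k' hk' ht
    · rw [zero_add, p0, p1, p2]
      exact (arc₂₃ ht.symm).symm
    · exact absurd rfl hne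
    · rw [p1, hlast, tlast, tgt1] at ht
      exact absurd (congrArg Prod.snd ht).symm hcc
    · rw [p1, p2, pk, hstep k' hk']
      exact arc₃ k' hk' ht
    · rw [p0, hlast, tlast, tgt0] at ht
      exact absurd (congrArg Prod.snd ht) hcc
    · rw [p1, hlast, tlast, tgt1] at ht
      exact absurd (congrArg Prod.snd ht) hcc
    · exact absurd rfl hne
    · rw [hlast, e0, p0, pk, hstep k' hk']
      refine arc₁ k' hk' ?_
      rw [hlast, pk] at ht
      exact ht
    · rw [zero_add, p0, p1, pk, hstep k hk]
      exact (arc₂ k hk ht.symm).symm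
    · rw [p1, p2, pk, hstep k hk]
      exact (arc₃ k hk ht.symm).symm
    · rw [hlast, e0, p0, pk, hstep k hk]
      refine (arc₁ k hk ?_).symm
      rw [hlast, pk] at ht
      exact ht.symm
    · rw [pk, pk, hstep k hk, hstep k' hk']
      exact hp.disjoint _ _ hne ht

theorem represents_push {γ : S.Loop} {n : ℕ} {p : Fin (n + 3) → End S} (hγ : Represents γ p)
    {i : Fin S.ξ} {b c o : Bool} (h₀ : (p 0).1 = .cross i b c)
    (h₁ : (p 1).1 = .seam (S.side i !b).1 (seamAt (S.side i !b).2 o) c) (z w : ℝ) :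
    Represents γ (Fin.cons (.seam (S.side i b).1 (seamAt (S.side i b).2 !o) c, z)
      (Fin.cons (.cross i b !c, w) fun k : Fin (n + 1) => p k.succ.succ) :
        Fin (n + 3) → End S) := by
  obtain ⟨hl, hγ⟩ := hγ
  have e : (List.ofFn fun j => (p j).1) =
      [.cross i b c, .seam (S.side i !b).1 (seamAt (S.side i !b).2 o) c] ++
        List.ofFn fun k : Fin (n + 1) => (p k.succ.succ).1 := by
    rw [List.ofFn_succ, List.ofFn_succ, ← h₀, ← h₁]; rfl
  have hpush := pathHomotopic_push i b c o
  rw [Represents]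
  have e' : (List.ofFn fun j => ((Fin.cons (.seam (S.side i b).1 (seamAt (S.side i b).2 !o) c, z)
      (Fin.cons (.cross i b !c, w) fun k : Fin (n + 1) => p k.succ.succ) : Fin (n + 3) → End S)
        j).1) = [.seam (S.side i b).1 (seamAt (S.side i b).2 !o) c, .cross i b !c] ++
        List.ofFn fun k : Fin (n + 1) => (p k.succ.succ).1 := by
    rw [List.ofFn_succ, List.ofFn_succ]; rfl
  simp only [e] at hγ hl
  simp only [e']
  obtain ⟨x, hx⟩ := isLoop_iff.1 hl
  obtain ⟨y, hy, hr⟩ := isPath_append.1 hx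
  obtain ⟨rfl, -, hy⟩ := hy
  have hy' : y = ((S.side i !b).1, !c) := hy.symm
  subst hy'
  have hl' := (isPath_append.2 ⟨_, hpush.right, hr⟩ : IsPath _ _ _).isLoop
  exact ⟨hl', hγ.trans (hpush.homotopic _ hl hl' hr)⟩

/-! ### Shortest embedded representatives have no bigons -/

/-- `p` is an embedded closed path homotopic to `γ`, with the least number of crossings among these,
and `γ` is not null-homotopic. -/
structure IsTight (γ : S.Loop) {m : ℕ} (p : Fin (m + 1) → End S) : Prop where
  drawn : Drawn p
  represents : Represents γ p
  minimal : ∀ (m' : ℕ) (p' : Fin (m' + 1) → End S), Drawn p' → Represents γ p' → m ≤ m'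
  essential : ¬ FreelyHomotopic γ S.trivialLoop

/-- The crossing, from the hexagon of colour `c`, of the outgoing (`o = true`) or incoming seam at
the boundary component `β`. -/
abbrev seamDart (β : Fin S.k × Fin 3) (o c : Bool) : S.Dart := .seam β.1 (seamAt β.2 o) c

theorem Dart.rev_ne_self (D : S.Dart) : D.rev ≠ D := by
  rcases D with ⟨P, s, c⟩ | ⟨i, b, c⟩ <;> simp [Dart.rev]

theorem Dart.flip_mem_uIoo (D : S.Dart) (x y z : ℝ) :
    D.flip x ∈ Set.uIoo (D.flip y) z ↔ x ∈ Set.uIoo y (D.rev.flip z) := by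
  cases D with
  | seam P s c => rfl
  | cross i b c =>
    simp only [Dart.flip, Dart.rev, Set.uIoo, Set.mem_Ioo, inf_lt_iff, lt_sup_iff]
    grind

theorem seamAt_not_ne (ε : Fin 3) (o : Bool) : seamAt ε (!o) ≠ seamAt ε o := by
  cases o <;> fin_cases ε <;> decide

theorem beyond_or_beyond {o : Bool} {u y : ℝ} (h : y ≠ u) : Beyond o u y ∨ Beyond (!o) u y := by
  rcases lt_or_gt_of_ne h with h | h <;> cases o <;> simp [Beyond, h]

theorem Beyond.not_beyond {o : Bool} {u y : ℝ} (h : Beyond o u y) : ¬ Beyond (!o) u y := by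
  cases o <;> simp [Beyond] at * <;> exact h.le

theorem exists_extreme {A : Set ℝ} (hA : A.Finite) (hne : A.Nonempty) (o : Bool) :
    ∃ z ∈ A, ∀ z' ∈ A, ¬ Beyond o z z' := by
  cases o
  · obtain ⟨z, hz, h⟩ := Set.exists_min_image A id hA hne
    exact ⟨z, hz, fun z' hz' => by simpa [Beyond] using h z' hz'⟩
  · obtain ⟨z, hz, h⟩ := Set.exists_max_image A id hA hne
    exact ⟨z, hz, fun z' hz' => by simpa [Beyond] using h z' hz'⟩

theorem inCorner_pt_iff {i : Fin S.ξ} {b c o : Bool} {u v : ℝ} {e : End S}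
    (h : e.1.src = ((S.side i b).1, c)) :
    InCorner (S.side i b).2 o u v e.pt ↔ (e.1 = .cross i b c ∧ Beyond o u e.2) ∨
      (e.1 = seamDart (S.side i b) o c ∧ Beyond (!o) v e.2) := by
  have h1 : (ofLex e.pt).1 = 2 * (S.side i b).2.val ↔ e.1 = .cross i b c :=
    ⟨fun h' => Dart.eq_of_sideNumber h h', fun h' => by
      simp [End.pt, Dart.exitPoint, h', Dart.sideNumber]⟩
  have h2 : (ofLex e.pt).1 = seamNumber (seamAt (S.side i b).2 o) ↔
      e.1 = seamDart (S.side i b) o c :=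
    ⟨fun h' => Dart.eq_of_sideNumber h h', fun h' => by
      simp [End.pt, Dart.exitPoint, h', Dart.sideNumber, seamNumber]⟩
  rw [InCorner, h1, h2]
  rfl

theorem inRegion_pt_iff {β : Fin S.k × Fin 3} {c : Bool} {u v : ℝ} {e : End S}
    (h : e.1.src = (β.1, c)) :
    InRegion β.2 u v e.pt ↔ e.1.sideNumber = 2 * β.2.val ∨
      (e.1 = seamDart β true c ∧ e.2 < u) ∨ (e.1 = seamDart β false c ∧ v < e.2) := by
  have h2 : ∀ o, (ofLex e.pt).1 = seamNumber (seamAt β.2 o) ↔ e.1 = seamDart β o c := fun o =>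
    ⟨fun h' => Dart.eq_of_sideNumber h h', fun h' => by
      simp [End.pt, Dart.exitPoint, h', Dart.sideNumber, seamNumber]⟩
  rw [InRegion, h2, h2]
  rfl

section

variable {m : ℕ} {p : Fin (m + 1) → End S}

/-- An arc with an end in the corner cut off by another arc has both ends in it. -/
theorem Drawn.inCorner_of_arc (hp : Drawn p) {i : Fin S.ξ} {b c o : Bool} {u v : ℝ}
    (h : Arc p (.cross i b c, u) (seamDart (S.side i b) o c, v)) {e e' : End S} (he : Arc p e e')
    (hsrc : e.1.src = ((S.side i b).1, c)) (hin : InCorner (S.side i b).2 o u v e.pt) :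
    InCorner (S.side i b).2 o u v e'.pt := by
  have hne : e ≠ (.cross i b c, u) ∧ e ≠ (seamDart (S.side i b) o c, v) := by
    have hirr : ∀ o u, ¬ Beyond o u u := by intro o u; cases o <;> simp [Beyond]
    constructor <;> rintro rfl <;> rw [inCorner_pt_iff hsrc] at hin <;> simp [hirr] at hin
  have hd := hp.chordsDisjoint h he hsrc.symm hne.1 hne.2
  rw [chordsDisjoint_iff] at hd
  obtain ⟨⟨h1, h2, h3, h4⟩, hd⟩ := hd
  have k1 := not_inCorner_iff (S.side i b).2 o u v e.pt e.1.sideNumber_lt h1 h2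
  have k2 := not_inCorner_iff (S.side i b).2 o u v e'.pt e'.1.sideNumber_lt h3 h4
  by_contra hout
  have h5 := k2.1 hout
  have hpt1 : End.pt ((Dart.cross i b c, u) : End S) = toLex (2 * (S.side i b).2.val, u) := rfl
  have hpt2 : End.pt ((seamDart (S.side i b) o c, v) : End S) =
      toLex (seamNumber (seamAt (S.side i b).2 o), v) := rfl
  rw [← hpt1, ← hpt2] at h5 k1
  rw [← hd] at h5
  exact k1.2 h5 hin

/-- An arc with an end in the region cut off by an arc around a boundary component has both ends in
it. -/
theorem Drawn.inRegion_of_arc (hp : Drawn p) {β : Fin S.k × Fin 3} {c : Bool} {u v : ℝ}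
    (h : Arc p (seamDart β true c, u) (seamDart β false c, v)) {e e' : End S} (he : Arc p e e')
    (hsrc : e.1.src = (β.1, c)) (hin : InRegion β.2 u v e.pt) : InRegion β.2 u v e'.pt := by
  have hside : ∀ o c, (seamDart β o c : S.Dart).sideNumber ≠ 2 * β.2.val := by
    intro o c; simp only [Dart.sideNumber]; omega
  have hs : seamAt β.2 true ≠ seamAt β.2 false := seamAt_not_ne β.2 false
  have hne : e ≠ (seamDart β true c, u) ∧ e ≠ (seamDart β false c, v) := by
    constructor <;> rintro rfl <;> rw [inRegion_pt_iff hsrc] at hin <;>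
      simp [hside, hs, hs.symm] at hin
  have hd := hp.chordsDisjoint h he hsrc.symm hne.1 hne.2
  rw [chordsDisjoint_iff] at hd
  obtain ⟨⟨h1, h2, h3, h4⟩, hd⟩ := hd
  have k1 := not_inRegion_iff β.2 u v e.pt e.1.sideNumber_lt h1 h2
  have k2 := not_inRegion_iff β.2 u v e'.pt e'.1.sideNumber_lt h3 h4
  by_contra hout
  have h5 := k2.1 hout
  have hpt : ∀ o y, End.pt ((seamDart β o c, y) : End S) = toLex (seamNumber (seamAt β.2 o), y) :=
    fun o y => rfl
  rw [← hpt, ← hpt] at h5 k1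
  rw [← hd] at h5
  exact k1.2 h5 hin

theorem Arc.mem_coordinates {e e' : End S} (h : Arc p e e') :
    e.2 ∈ (Set.range fun j => (p j).2) ∪ (Set.range fun j => (p j).rev.2) := by
  obtain ⟨j, rfl | rfl⟩ := h.isEnd
  · exact Or.inl ⟨j, rfl⟩
  · exact Or.inr ⟨j, rfl⟩

theorem finite_coordinates :
    ((Set.range fun j => (p j).2) ∪ (Set.range fun j => (p j).rev.2)).Finite :=
  (Set.finite_range _).union (Set.finite_range _)

variable {γ : S.Loop}

theorem IsTight.add (h : IsTight γ p) (k : Fin (m + 1)) : IsTight γ (fun j => p (j + k)) :=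
  ⟨(drawn_represents_add h.drawn h.represents k).1, (drawn_represents_add h.drawn h.represents k).2,
    h.minimal, h.essential⟩

/-- A shortest embedded closed path does not cross an edge back and forth: a backtrack at which the
two crossings have minimal distance could be deleted. -/
theorem IsTight.no_backtrack (h : IsTight γ p) {e e' : End S} (he : Arc p e e') : e.1 ≠ e'.1 := by
  classical
  intro hD
  obtain ⟨j₀, hj₀⟩ : ∃ j, (p j).1.rev = (p (j + 1)).1 := by
    obtain ⟨j, ⟨rfl, rfl⟩ | ⟨rfl, rfl⟩⟩ := he
    · exact ⟨j, hD⟩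
    · exact ⟨j, hD.symm⟩
  have hne : (Finset.univ.filter fun j => (p j).1.rev = (p (j + 1)).1).Nonempty :=
    ⟨j₀, by simpa using hj₀⟩
  obtain ⟨j, hj, hmin⟩ := Finset.exists_min_image _
    (fun j => |(p j).rev.2 - (p (j + 1)).2|) hne
  simp only [Finset.mem_filter, Finset.mem_univ, true_and] at hj hmin
  have hclear : ∀ z, IsEnd p ((p (j + 1)).1, z) → z ∉ Set.uIoo (p j).rev.2 (p (j + 1)).2 := by
    intro z hz hzu
    obtain ⟨f, hf⟩ := hz.exists_arc
    have hrev : (p j).rev = ((p (j + 1)).1, (p j).rev.2) := Prod.ext hj rfl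
    have harc : Arc p ((p (j + 1)).1, (p j).rev.2) ((p (j + 1)).1, (p (j + 1)).2) :=
      ⟨j, Or.inl ⟨hrev.symm, rfl⟩⟩
    have hd := h.drawn.chordsDisjoint harc hf rfl
      (fun e => by
        have : z = (p j).rev.2 := congrArg Prod.snd e
        rw [this] at hzu; simp at hzu)
      (fun e => by
        have : z = (p (j + 1)).2 := congrArg Prod.snd e
        rw [this] at hzu; simp at hzu)
    have hsrc := h.drawn.src_eq hf
    rw [chordsDisjoint_iff] at hd
    obtain ⟨⟨h1, h2, h3, h4⟩, hd⟩ := hd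
    simp only [End.pt, Dart.exitPoint] at hd h1 h2 h3 h4
    rw [boundaryPoint_ne_iff] at h3 h4
    simp only [boundaryPoint_lt_iff, ofLex_toLex, lt_irrefl, false_or, true_and] at hd h3 h4
    have hside : f.1.sideNumber = (p (j + 1)).1.sideNumber := by
      by_contra hside
      simp only [hside, false_and, or_false] at hd
      rcases le_total (p j).rev.2 (p (j + 1)).2 with hle | hle
      · rw [Set.uIoo_of_le hle, Set.mem_Ioo] at hzu
        grind
      · rw [Set.uIoo_of_ge hle, Set.mem_Ioo] at hzu
        grind
    have hfD : f.1 = (p (j + 1)).1 := Dart.eq_of_sideNumber hsrc.symm hside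
    simp only [hside, lt_irrefl, false_or, true_and] at hd
    have h3 := h3 hside
    have h4 := h4 hside
    have hlt : |z - f.2| < |(p j).rev.2 - (p (j + 1)).2| := by
      rw [abs_lt, lt_abs, neg_lt, lt_abs]
      rcases le_total (p j).rev.2 (p (j + 1)).2 with hle | hle
      · rw [Set.uIoo_of_le hle, Set.mem_Ioo] at hzu
        have : (p j).rev.2 < f.2 ∧ f.2 < (p (j + 1)).2 := by grind
        constructor <;> right <;> linarith
      · rw [Set.uIoo_of_ge hle, Set.mem_Ioo] at hzu
        have : (p (j + 1)).2 < f.2 ∧ f.2 < (p j).rev.2 := by grind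
        constructor <;> left <;> linarith
    obtain ⟨k, ⟨hk1, hk2⟩ | ⟨hk1, hk2⟩⟩ := hf
    · have := hmin k (by rw [← hk2, hfD]; exact (congrArg Prod.fst hk1).symm)
      rw [← hk1, ← hk2] at this
      exact absurd hlt (not_lt.2 this)
    · have := hmin k (by rw [← hk2, ← hfD]; exact (congrArg Prod.fst hk1).symm)
      rw [← hk1, ← hk2, abs_sub_comm f.2] at this
      exact absurd hlt (not_lt.2 this)
  have htight := h.add j
  rcases m with _ | _ | n
  · have : j + 1 = j := Fin.ext (by omega)
    rw [this] at hj
    exact Dart.rev_ne_self _ hj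
  · obtain ⟨hl, hγ⟩ := htight.represents
    apply h.essential
    have e : (List.ofFn fun k : Fin 2 => (p (k + j)).1) = [(p j).1, (p j).1.rev] := by
      rw [hj, List.ofFn_succ, List.ofFn_succ]
      simp [add_comm]
    simp only [e] at hγ
    exact hγ.trans ((PathHomotopic.backtrack (p j).1).freelyHomotopic _ _)
  · have h1 : (p (1 + j)).1 = (p (0 + j)).1.rev := by rw [zero_add, add_comm, hj]
    have hd := htight.drawn.delete h1 (by
      intro z hz hzu
      rw [zero_add] at hz hzu
      rw [add_comm 1 j] at hzu
      rw [End.rev, ← hj, ← Dart.flip_mem_uIoo] at hzu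
      have hz' : IsEnd p ((p j).1, z) := by
        obtain ⟨k, hk⟩ := hz
        exact ⟨k + j, hk⟩
      exact hclear _ (hj ▸ hz'.rev) hzu)
    have := h.minimal n _ hd (represents_delete htight.represents h1)
    omega

/-- An arc in the corner cut off by another arc cuts off a smaller corner. -/
theorem IsTight.corner (h : IsTight γ p) {i : Fin S.ξ} {b c o : Bool} {u v v' : ℝ} {e : End S}
    (h₁ : Arc p (.cross i b c, u) (seamDart (S.side i b) o c, v))
    (h₂ : Arc p (seamDart (S.side i b) o c, v') e) (hv : Beyond (!o) v v') :
    ∃ u', e = (.cross i b c, u') ∧ Beyond o u u' := by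
  have hin := h.drawn.inCorner_of_arc h₁ h₂ rfl ((inCorner_pt_iff rfl).2 (Or.inr ⟨rfl, hv⟩))
  rw [inCorner_pt_iff (h.drawn.src_eq h₂).symm] at hin
  rcases hin with ⟨he, hu⟩ | ⟨he, -⟩
  · exact ⟨e.2, Prod.ext he rfl, hu⟩
  · exact absurd he.symm (h.no_backtrack h₂)

theorem IsTight.corner' (h : IsTight γ p) {i : Fin S.ξ} {b c o : Bool} {u v u' : ℝ} {e : End S}
    (h₁ : Arc p (.cross i b c, u) (seamDart (S.side i b) o c, v))
    (h₂ : Arc p (.cross i b c, u') e) (hu : Beyond o u u') :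
    ∃ v', e = (seamDart (S.side i b) o c, v') ∧ Beyond (!o) v v' := by
  have hin := h.drawn.inCorner_of_arc h₁ h₂ rfl ((inCorner_pt_iff rfl).2 (Or.inl ⟨rfl, hu⟩))
  rw [inCorner_pt_iff (h.drawn.src_eq h₂).symm] at hin
  rcases hin with ⟨he, -⟩ | ⟨he, hv⟩
  · exact absurd he.symm (h.no_backtrack h₂)
  · exact ⟨e.2, Prod.ext he rfl, hv⟩

/-- An arc that starts between a boundary component and an arc around it either ends at the boundary
component, or is an arc around it, too. -/
theorem IsTight.region (h : IsTight γ p) {β : Fin S.k × Fin 3} {c o : Bool} {u v u' : ℝ} {e : End S}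
    (h₁ : Arc p (seamDart β o c, u) (seamDart β (!o) c, v))
    (h₂ : Arc p (seamDart β o c, u') e) (hu : Beyond (!o) u u') :
    e.1.sideNumber = 2 * β.2.val ∨ ∃ v', e = (seamDart β (!o) c, v') ∧ Beyond o v v' := by
  have hb := h.no_backtrack h₂
  cases o
  · have hin := h.drawn.inRegion_of_arc h₁.symm h₂ rfl
      ((inRegion_pt_iff rfl).2 (Or.inr (Or.inr ⟨rfl, hu⟩)))
    rw [inRegion_pt_iff (h.drawn.src_eq h₂).symm] at hin
    rcases hin with he | ⟨he, hv⟩ | ⟨he, -⟩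
    · exact Or.inl he
    · exact Or.inr ⟨e.2, Prod.ext he rfl, hv⟩
    · exact absurd he.symm hb
  · have hin := h.drawn.inRegion_of_arc h₁ h₂ rfl
      ((inRegion_pt_iff rfl).2 (Or.inr (Or.inl ⟨rfl, hu⟩)))
    rw [inRegion_pt_iff (h.drawn.src_eq h₂).symm] at hin
    rcases hin with he | ⟨he, -⟩ | ⟨he, hv⟩
    · exact Or.inl he
    · exact absurd he.symm hb
    · exact Or.inr ⟨e.2, Prod.ext he rfl, hv⟩

theorem eq_cross_of_sideNumber {i : Fin S.ξ} {b c : Bool} {D : S.Dart}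
    (h : D.sideNumber = 2 * (S.side i b).2.val) (h' : D.src = ((S.side i b).1, c)) :
    D = .cross i b c :=
  Dart.eq_of_sideNumber h' h

end

/-- Pushing a shortest embedded closed path across a vertex. -/
theorem IsTight.push {γ : S.Loop} {n : ℕ} {p : Fin (n + 3) → End S} (h : IsTight γ p)
    (j : Fin (n + 3)) {i : Fin S.ξ} {b c o : Bool} (h₀ : (p j).1 = .cross i (!b) c)
    (h₁ : (p (j + 1)).1 = seamDart (S.side i b) o c)
    (hclear : ∀ e, IsEnd p e → e.1.src = ((S.side i b).1, c) →
      ¬ InCorner (S.side i b).2 o (p j).rev.2 (p (j + 1)).2 e.pt) :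
    ∃ z w : ℝ, IsTight γ (Fin.cons (seamDart (S.side i !b) (!o) c, z) (Fin.cons
      (.cross i (!b) !c, w) fun k : Fin (n + 1) => p (k.succ.succ + j)) : Fin (n + 3) → End S) := by
  have h' := h.add j
  have e₀ : (p (0 + j)).1 = .cross i (!b) c := by rw [zero_add, h₀]
  have e₁ : (p (1 + j)).1 = .seam (S.side i !!b).1 (seamAt (S.side i !!b).2 o) c := by
    rw [add_comm, h₁, Bool.not_not]
  obtain ⟨z, w, hd⟩ := h'.drawn.push e₀ e₁ (by
    intro e ⟨k, hk⟩ hsrc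
    rw [Bool.not_not] at hsrc ⊢
    rw [zero_add, add_comm 1 j]
    exact hclear e ⟨k + j, hk⟩ hsrc)
  exact ⟨z, w, hd, represents_push h'.represents e₀ e₁ z w, h.minimal, h.essential⟩

section

variable {γ : S.Loop} {m : ℕ} {p : Fin (m + 1) → End S} {i : Fin S.ξ} {b c o : Bool} {z : ℝ}

/-- The path `p` crosses into a pair of pants at the boundary component `S.side i b`, crosses its
seam `seamAt _ o` at the coordinate `z`, and returns through the same boundary component. -/
def OneBigon (p : Fin (m + 1) → End S) (i : Fin S.ξ) (b o c : Bool) (z : ℝ) : Prop :=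
  ∃ y y', Arc p (.cross i b c, y) (seamDart (S.side i b) o c, z) ∧
    Arc p (seamDart (S.side i b) o !c, z) (.cross i b !c, y')

theorem OneBigon.symm (h : OneBigon p i b o c z) : OneBigon p i b o (!c) z := by
  obtain ⟨y, y', h₁, h₂⟩ := h
  exact ⟨y', y, h₂.symm, by simpa using h₁.symm⟩

/-- A corner cut off by an arc contains no ends of arcs if it is innermost, i.e. if it contains no
arc that cuts off a smaller corner. -/
theorem IsTight.not_inCorner (h : IsTight γ p) {y : ℝ}
    (h₁ : Arc p (.cross i b c, y) (seamDart (S.side i b) o c, z))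
    (hz : ∀ x z', Arc p (.cross i b c, x) (seamDart (S.side i b) o c, z') → ¬ Beyond (!o) z z')
    (e : End S) (he : IsEnd p e) (hsrc : e.1.src = ((S.side i b).1, c)) :
    ¬ InCorner (S.side i b).2 o y z e.pt := by
  intro hin
  obtain ⟨e', he'⟩ := he.exists_arc
  rcases (inCorner_pt_iff hsrc).1 hin with ⟨hD, hy⟩ | ⟨hD, hy⟩ <;> obtain ⟨D, x⟩ := e <;>
    subst hD
  · obtain ⟨z', rfl, hz'⟩ := h.corner' h₁ he' hy
    exact hz _ _ he' hz'
  · obtain ⟨x, rfl, -⟩ := h.corner h₁ he' hy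
    exact hz _ _ he'.symm hy

/-- Pushing an innermost bigon with one seam across the vertex creates a backtrack. -/
theorem IsTight.false_of_innermost_one_bigon (h : IsTight γ p) {j : Fin (m + 1)} {y y' : ℝ}
    (h₀ : p j = End.rev (.cross i b c, y)) (h₁ : p (j + 1) = (seamDart (S.side i b) o c, z))
    (h₂ : p (j + 1 + 1) = (.cross i b !c, y'))
    (hz : ∀ x z', Arc p (.cross i b c, x) (seamDart (S.side i b) o c, z') → ¬ Beyond (!o) z z') :
    False := by
  have harc : Arc p (.cross i b c, y) (seamDart (S.side i b) o c, z) :=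
    ⟨j, Or.inl ⟨by rw [h₀, End.rev_rev], h₁.symm⟩⟩
  rcases m with _ | _ | n
  · have : j + 1 = j := Fin.ext (by omega)
    rw [this, h₀] at h₁
    cases congrArg Prod.fst h₁
  · have : j + 1 + 1 = j := (add_assoc j 1 1).trans (add_zero j)
    rw [this, h₀] at h₂
    have := congrArg Prod.fst h₂
    simp [End.rev, Dart.rev] at this
  · have e₀ : (p j).1 = .cross i (!b) c := by rw [h₀]; rfl
    have e₀' : (p j).rev.2 = y := by rw [h₀, End.rev_rev]
    obtain ⟨z₁, w, hp'⟩ := h.push j e₀ (by rw [h₁]) (by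
      rw [e₀', h₁]
      exact h.not_inCorner harc hz)
    refine hp'.no_backtrack ⟨1, Or.inl ⟨rfl, rfl⟩⟩ ?_
    rw [one_add_one_fin]
    have : (0 : Fin (n + 1)).succ.succ + j = j + 1 + 1 := by
      rw [← one_add_one_fin]
      exact (add_comm _ j).trans (add_assoc j 1 1).symm
    simp only [Fin.cons_succ, this, h₂]
    change Dart.rev (.cross i (!b) !c) = _
    simp [Dart.rev]

theorem exists_extreme_arc_coordinate {Q : ℝ → Prop} (o : Bool)
    (hQ : ∀ z, Q z → ∃ e D, Arc p (D, z) e) (hz : Q z) :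
    ∃ z, Q z ∧ ∀ z', Q z' → ¬ Beyond o z z' := by
  have hfin : {z | Q z}.Finite := finite_coordinates.subset fun z hz => by
    obtain ⟨e, D, he⟩ := hQ z hz
    exact he.mem_coordinates
  exact exists_extreme hfin ⟨z, hz⟩ o

theorem IsTight.no_one_bigon (h : IsTight γ p) : ¬ OneBigon p i b o c z := by
  intro hz
  obtain ⟨z, hz, hmax⟩ := exists_extreme_arc_coordinate (!o)
    (fun z hz => by obtain ⟨y, y', h₁, h₂⟩ := hz; exact ⟨_, _, h₂⟩) hz
  -- a crossing of the seam in the corner belongs to another bigon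
  have hclear : ∀ c', OneBigon p i b o c' z → (∀ z', OneBigon p i b o c' z' → ¬ Beyond (!o) z z') →
      ∀ x z', Arc p (.cross i b c', x) (seamDart (S.side i b) o c', z') → ¬ Beyond (!o) z z' := by
    intro c' ⟨y, y', h₁, h₂⟩ hmax x z' hx hz'
    have he : IsEnd p (seamDart (S.side i b) o !c', z') := hx.symm.isEnd.rev
    obtain ⟨e, he⟩ := he.exists_arc
    obtain ⟨x', rfl, -⟩ := h.corner h₂.symm he hz'
    exact hmax z' ⟨x, x', hx, he⟩ hz'
  obtain ⟨y, y', h₁, h₂⟩ := id hz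
  obtain ⟨j, ⟨e₀, e₁, e₂⟩ | ⟨e₀, e₁, e₂⟩⟩ := h.drawn.exists_index h₁ h₂
  · exact h.false_of_innermost_one_bigon e₀ e₁ e₂ (hclear c hz hmax)
  · refine h.false_of_innermost_one_bigon e₀ e₁ (by rw [Bool.not_not]; exact e₂)
      (hclear (!c) hz.symm ?_)
    intro z' hz'
    exact hmax z' (by simpa using hz'.symm)

/-- The path `p` crosses into a pair of pants at the boundary component `S.side i b`, crosses its
seam `seamAt _ o` at the coordinate `z`, crosses the other seam that meets this boundary component,
and returns through the same boundary component. -/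
def TwoBigon (p : Fin (m + 1) → End S) (i : Fin S.ξ) (b o c : Bool) (z : ℝ) : Prop :=
  ∃ y₀ y₂ y₃, Arc p (.cross i b c, y₀) (seamDart (S.side i b) o c, z) ∧
    Arc p (seamDart (S.side i b) o !c, z) (seamDart (S.side i b) (!o) !c, y₂) ∧
    Arc p (seamDart (S.side i b) (!o) c, y₂) (.cross i b c, y₃)

theorem TwoBigon.symm {y₀ y₂ y₃ : ℝ}
    (h₁ : Arc p (.cross i b c, y₀) (seamDart (S.side i b) o c, z))
    (h₂ : Arc p (seamDart (S.side i b) o !c, z) (seamDart (S.side i b) (!o) !c, y₂))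
    (h₃ : Arc p (seamDart (S.side i b) (!o) c, y₂) (.cross i b c, y₃)) :
    TwoBigon p i b (!o) c y₂ := by
  refine ⟨y₃, z, y₀, h₃.symm, ?_, ?_⟩
  · simpa using h₂.symm
  · simpa using h₁.symm

/-- A crossing of a seam in the corner at a bigon with two seams belongs to another one. -/
theorem IsTight.two_bigon_of_corner (h : IsTight γ p) {y₂ y₃ x z' : ℝ}
    (h₂ : Arc p (seamDart (S.side i b) o !c, z) (seamDart (S.side i b) (!o) !c, y₂))
    (h₃ : Arc p (seamDart (S.side i b) (!o) c, y₂) (.cross i b c, y₃))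
    (hx : Arc p (.cross i b c, x) (seamDart (S.side i b) o c, z')) (hz : Beyond (!o) z z') :
    TwoBigon p i b o c z' ∧ ∃ v, TwoBigon p i b (!o) c v ∧ Beyond o y₂ v := by
  have he : IsEnd p (seamDart (S.side i b) o !c, z') := hx.symm.isEnd.rev
  obtain ⟨e, he⟩ := he.exists_arc
  rcases h.region h₂ he hz with hs | ⟨v, rfl, hv⟩
  · have hD := eq_cross_of_sideNumber hs (h.drawn.src_eq he).symm
    obtain ⟨D, x'⟩ := e
    subst hD
    exact absurd ⟨_, _, hx, he⟩ h.no_one_bigon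
  · have hf : IsEnd p (seamDart (S.side i b) (!o) c, v) := by
      have := he.symm.isEnd.rev
      simpa [End.rev, Dart.rev, Dart.flip] using this
    obtain ⟨f, hf⟩ := hf.exists_arc
    obtain ⟨u, rfl, -⟩ := h.corner h₃.symm hf (by simpa using hv)
    exact ⟨⟨_, _, _, hx, he, hf⟩, v, TwoBigon.symm hx he hf, hv⟩

/-- Pushing the corner at an innermost bigon with two seams across the vertex creates a bigon with
one seam. -/
theorem IsTight.false_of_innermost_two_bigon (h : IsTight γ p) {j : Fin (m + 1)} {y₀ y₂ y₃ : ℝ}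
    (e₀ : p j = End.rev (.cross i b c, y₀)) (e₁ : p (j + 1) = (seamDart (S.side i b) o c, z))
    (e₂ : p (j + 1 + 1) = (seamDart (S.side i b) (!o) !c, y₂))
    (e₃ : p (j + 1 + 1 + 1) = (.cross i b c, y₃))
    (hz : ∀ x z', Arc p (.cross i b c, x) (seamDart (S.side i b) o c, z') → ¬ Beyond (!o) z z') :
    False := by
  have harc : Arc p (.cross i b c, y₀) (seamDart (S.side i b) o c, z) :=
    ⟨j, Or.inl ⟨by rw [e₀, End.rev_rev], e₁.symm⟩⟩
  rcases m with _ | _ | _ | n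
  · have : j + 1 = j := Fin.ext (by omega)
    rw [this, e₀] at e₁
    cases congrArg Prod.fst e₁
  · have : j + 1 + 1 = j := (add_assoc j 1 1).trans (add_zero j)
    rw [this, e₀] at e₂
    cases congrArg Prod.fst e₂
  · have : j + 1 + 1 + 1 = j :=
      ((add_assoc (j + 1) 1 1).trans (add_assoc j 1 (1 + 1))).trans (add_zero j)
    rw [this, e₀] at e₃
    have := congrArg Prod.fst e₃
    simp [End.rev, Dart.rev] at this
  · have e₀' : (p j).rev.2 = y₀ := by rw [e₀, End.rev_rev]
    obtain ⟨z₁, w, hp'⟩ := h.push j (by rw [e₀]; rfl) (by rw [e₁]) (by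
      rw [e₀', e₁]
      exact h.not_inCorner harc hz)
    -- after the push, the path has a bigon with one seam
    set p' := (Fin.cons (seamDart (S.side i !b) (!o) c, z₁) (Fin.cons
      (.cross i (!b) !c, w) fun k : Fin (n + 2) => p (k.succ.succ + j)) : Fin (n + 4) → End S)
    have q₂ : p' (1 + 1) = (seamDart (S.side i b) (!o) !c, y₂) := by
      rw [one_add_one_fin, ← e₂]
      change p ((0 : Fin (n + 2)).succ.succ + j) = _
      rw [← one_add_one_fin]
      exact congrArg p ((add_comm _ j).trans (add_assoc j 1 1).symm)
    have q₃ : p' (1 + 1 + 1) = (.cross i b c, y₃) := by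
      rw [one_add_one_fin, ← succ_succ_add_one (by simp [Fin.ext_iff]), ← e₃]
      change p ((0 + 1 : Fin (n + 2)).succ.succ + j) = _
      rw [succ_succ_add_one (by simp [Fin.ext_iff]), ← one_add_one_fin]
      exact congrArg p ((add_comm _ j).trans
        ((add_assoc (j + 1) 1 1).trans (add_assoc j 1 (1 + 1))).symm)
    refine hp'.no_one_bigon (i := i) (b := b) (o := !o) (c := !c) (z := y₂) ⟨-w, y₃, ⟨1, ?_⟩,
      ⟨1 + 1, ?_⟩⟩
    · left
      refine ⟨?_, q₂.symm⟩
      change _ = End.rev (.cross i (!b) !c, w)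
      simp [End.rev, Dart.rev, Dart.flip]
    · left
      rw [q₂, q₃]
      simp [End.rev, Dart.rev, Dart.flip]

theorem IsTight.no_two_bigon (h : IsTight γ p) : ¬ TwoBigon p i b o c z := by
  intro hz
  obtain ⟨z, ⟨y₀, y₂, y₃, h₁, h₂, h₃⟩, hmax⟩ := exists_extreme_arc_coordinate (!o)
    (fun z hz => by obtain ⟨y₀, y₂, y₃, h₁, h₂, h₃⟩ := hz; exact ⟨_, _, h₂⟩) hz
  obtain ⟨j, ⟨e₀, e₁, e₂⟩ | ⟨e₀, e₁, e₂⟩⟩ := h.drawn.exists_index h₁ h₂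
  · refine h.false_of_innermost_two_bigon (y₃ := y₃) e₀ e₁ e₂ ?_ fun x z' hx hz' =>
      hmax z' (h.two_bigon_of_corner h₂ h₃ hx hz').1 hz'
    refine h.drawn.arc_unique ⟨j + 1 + 1, Or.inl ⟨?_, rfl⟩⟩ h₃
    rw [e₂]; simp [End.rev, Dart.rev, Dart.flip]
  · have e₀' : p j = (seamDart (S.side i b) (!o) c, y₂) := by
      rw [e₀]; simp [End.rev, Dart.rev, Dart.flip]
    have hj : p (j - 1) = End.rev (.cross i b c, y₃) := by
      rw [← h.drawn.arc_unique ⟨j - 1, Or.inr ⟨rfl, by rw [sub_add_cancel, e₀']⟩⟩ h₃, End.rev_rev]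
    have hj' : j - 1 + 1 = j := sub_add_cancel _ _
    refine h.false_of_innermost_two_bigon (o := !o) (z := y₂) (y₂ := z) (y₃ := y₀) hj
      (by rw [hj', e₀'])
      (by rw [hj', e₁, Bool.not_not]; rfl) (by rw [hj', e₂]) ?_
    intro x z' hx hz'
    obtain ⟨-, v, hv, hb⟩ := h.two_bigon_of_corner (o := !o) (y₃ := y₀) (z := y₂) (y₂ := z)
      (by simpa using h₂.symm) (by simpa using h₁.symm) hx hz'
    exact hmax v (by simpa using hv) hb

end

section

variable {γ : S.Loop} {m : ℕ} {p : Fin (m + 1) → End S}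

theorem exists_seamAt_eq {s ε : Fin 3} (h : s ≠ ε) : ∃ o, s = seamAt ε o := by
  revert s ε; decide

/-- An arc that ends at a boundary component lies between it and every arc around it. -/
theorem IsTight.beyond_of_cross (h : IsTight γ p) {i : Fin S.ξ} {b c o : Bool} {u v w x : ℝ}
    (h₁ : Arc p (seamDart (S.side i b) o c, u) (seamDart (S.side i b) (!o) c, v))
    (h₂ : Arc p (seamDart (S.side i b) o c, w) (.cross i b c, x)) : Beyond (!o) u w := by
  have hs : seamAt (S.side i b).2 true ≠ seamAt (S.side i b).2 false := seamAt_not_ne _ false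
  have hside : (seamDart (S.side i b) o c : S.Dart).sideNumber ≠ 2 * (S.side i b).2.val := by
    simp only [Dart.sideNumber]; omega
  cases o
  · have hin := h.drawn.inRegion_of_arc h₁.symm h₂.symm rfl ((inRegion_pt_iff rfl).2 (Or.inl rfl))
    rw [inRegion_pt_iff rfl] at hin
    simpa [hside, hs.symm, Beyond] using hin
  · have hin := h.drawn.inRegion_of_arc h₁ h₂.symm rfl ((inRegion_pt_iff rfl).2 (Or.inl rfl))
    rw [inRegion_pt_iff rfl] at hin
    simpa [hside, hs, Beyond] using hin

/-- A shortest embedded closed path does not enter a pair of pants, spiral around the boundary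
component, and return through it: each turn would be farther away from the boundary component than
the preceding one. -/
theorem IsTight.no_spiral (h : IsTight γ p) {i : Fin S.ξ} {b o c : Bool} {L : ℕ} {x x' : ℝ}
    {y : ℕ → ℝ} (hfirst : Arc p (.cross i b c, x) (seamDart (S.side i b) o c, y 0))
    (harc : ∀ k < L + 2, Arc p (seamDart (S.side i b) (not^[k] o) !(not^[k] c), y k)
      (seamDart (S.side i b) (!(not^[k] o)) !(not^[k] c), y (k + 1)))
    (hlast : Arc p (seamDart (S.side i b) (not^[L + 2] o) !(not^[L + 2] c), y (L + 2))
      (.cross i b !(not^[L + 2] c), x')) :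
    False := by
  have hfar : ∀ k ≤ L, Beyond (not^[k] o) (y k) (y (k + 2)) := by
    intro k
    induction k with
    | zero =>
      intro _
      have h₂ : Arc p (seamDart (S.side i b) o c, y 2) (seamDart (S.side i b) (!o) c, y 1) := by
        simpa using (harc 1 (by omega)).symm
      have hne : y 2 ≠ y 0 := by
        intro e
        rw [e] at h₂
        cases congrArg Prod.fst (h.drawn.arc_unique hfirst.symm h₂)
      refine (beyond_or_beyond hne).resolve_right fun hb => ?_
      obtain ⟨_, he, -⟩ := h.corner hfirst h₂ hb
      cases congrArg Prod.fst he
    | succ k ih =>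
      intro hk
      have hb := ih (by omega)
      have h₁ := (harc k (by omega)).symm
      have h₂ := (harc (k + 2) (by omega)).symm
      simp only [Function.iterate_succ_apply', Bool.not_not] at h₂ ⊢
      have hs : y (k + 2) ≠ y k := by
        intro e
        rw [e] at hb
        generalize not^[k] o = o' at hb
        cases o' <;> simp [Beyond] at hb
      have hne : y (k + 1 + 2) ≠ y (k + 1) := by
        intro e
        rw [show k + 2 + 1 = k + 1 + 2 from rfl, e] at h₂
        exact hs (congrArg Prod.snd (h.drawn.arc_unique h₂ h₁))
      refine (beyond_or_beyond hne).resolve_right fun hb' => ?_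
      rcases h.region (β := S.side i b) (o := !(not^[k] o)) (v := y k)
        (by rw [Bool.not_not]; exact h₁) h₂ hb' with hside | ⟨v, hv, hbv⟩
      · simp only [Dart.sideNumber] at hside
        omega
      · obtain rfl : y (k + 2) = v := congrArg Prod.snd hv
        exact hb.not_beyond hbv
  have hb := hfar L le_rfl
  have h₁ := harc L (by omega)
  simp only [Function.iterate_succ_apply', Bool.not_not] at hlast
  exact hb.not_beyond (h.beyond_of_cross h₁ hlast)

/-- A shortest embedded closed path has no bigons. -/
theorem IsTight.not_isBigon (h : IsTight γ p) {e : ℕ → End S}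
    (harc : ∀ k, Arc p (e k).rev (e (k + 1))) {t n : ℕ} (htn : t < n) :
    ¬ IsBigon (fun k => (e k).1) t n := by
  rintro ⟨i, b, c, c', ht, hn, hseam⟩
  beta_reduce at ht hn hseam
  obtain ⟨L, rfl⟩ : ∃ L, n = t + 1 + L := ⟨n - t - 1, by omega⟩
  have hback : ∀ k, (e (k + 1)).1 ≠ (e k).1.rev := fun k => (h.no_backtrack (harc k)).symm
  have hsrc : ∀ k, (e (k + 1)).1.src = (e k).1.rev.src := fun k => (h.drawn.src_eq (harc k)).symm
  have hstart : (e t).rev = (.cross i (!b) c, (e t).rev.2) :=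
    Prod.ext (by change (e t).1.rev = _; rw [ht]; rfl) rfl
  have hsrc₀ : (e (t + 1)).1.src = ((S.side i !b).1, c) := by
    rw [hsrc]; exact congrArg _ (congrArg Prod.fst hstart)
  rcases L with _ | L
  · apply h.no_backtrack (harc t)
    rw [hstart]
    rw [hn] at hsrc₀ ⊢
    simp only [Dart.src, Prod.mk.injEq, true_and] at hsrc₀
    rw [hsrc₀]
  obtain ⟨o, ho⟩ : ∃ o, (e (t + 1)).1 = seamDart (S.side i !b) o c := by
    obtain ⟨P, s, c'', hD, hs⟩ := hseam (t + 1) (by omega) (by omega)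
    obtain ⟨o, rfl⟩ := exists_seamAt_eq hs
    rw [hD] at hsrc₀
    cases hsrc₀
    exact ⟨o, hD⟩
  have hall : ∀ k ≤ L, (e (t + 1 + k)).1 = seamDart (S.side i !b) (not^[k] o) (not^[k] c) := by
    intro k
    induction k with
    | zero => exact fun _ => ho
    | succ k ih =>
      intro hk
      have ih := ih (by omega)
      obtain ⟨P, s, c'', hD, hs⟩ := hseam (t + 1 + (k + 1)) (by omega) (by omega)
      obtain ⟨o', rfl⟩ := exists_seamAt_eq hs
      have h₁ := hsrc (t + 1 + k)
      have h₂ := hback (t + 1 + k)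
      rw [ih, show t + 1 + k + 1 = t + 1 + (k + 1) from rfl, hD] at h₁ h₂
      cases h₁
      simp only [Function.iterate_succ_apply']
      rw [hD]
      have : o' = !(not^[k] o) := by
        refine Bool.eq_not_iff.2 ?_
        rintro rfl
        exact h₂ rfl
      rw [this]
  set y : ℕ → ℝ := fun k => (e (t + 1 + k)).2 with hy
  have hpt : ∀ k ≤ L, e (t + 1 + k) = (seamDart (S.side i !b) (not^[k] o) (not^[k] c), y k) :=
    fun k hk => Prod.ext (hall k hk) rfl
  have hrev : ∀ k ≤ L, (e (t + 1 + k)).rev =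
      (seamDart (S.side i !b) (not^[k] o) !(not^[k] c), y k) := by
    intro k hk; rw [hpt k hk]; rfl
  have hend : e (t + 1 + (L + 1)) =
      (.cross i (!b) !(not^[L] c), (e (t + 1 + (L + 1))).2) := by
    refine Prod.ext ?_ rfl
    have h₁ := hsrc (t + 1 + L)
    change (e (t + 1 + (L + 1))).1.src = _ at h₁
    rw [hn, hall L le_rfl] at h₁
    rw [hn]
    simp only [Dart.rev, Dart.src, Prod.mk.injEq, true_and] at h₁
    rw [h₁]
  have hfirst : Arc p (.cross i (!b) c, (e t).rev.2) (seamDart (S.side i !b) o c, y 0) := by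
    have := harc t
    rwa [hstart, show e (t + 1) = _ from hpt 0 (by omega)] at this
  have hmid : ∀ k < L, Arc p (seamDart (S.side i !b) (not^[k] o) !(not^[k] c), y k)
      (seamDart (S.side i !b) (!(not^[k] o)) !(not^[k] c), y (k + 1)) := by
    intro k hk
    have := harc (t + 1 + k)
    rwa [hrev k hk.le, show e (t + 1 + k + 1) = _ from hpt (k + 1) hk,
      Function.iterate_succ_apply', Function.iterate_succ_apply'] at this
  have hlast := harc (t + 1 + L)
  rw [hrev L le_rfl, show e (t + 1 + L + 1) = _ from hend] at hlast
  rcases L with _ | _ | L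
  · exact h.no_one_bigon ⟨_, _, hfirst, hlast⟩
  · have hlast : Arc p (seamDart (S.side i !b) (!o) c, y 1)
        (.cross i (!b) c, (e (t + 1 + 2)).2) := by simpa using hlast
    exact h.no_two_bigon ⟨_, _, _, hfirst, hmid 0 (by omega), hlast⟩
  · exact h.no_spiral hfirst hmid hlast

end

/-! ### Curves that do not intersect the pants curves -/

section

variable {γ : S.Loop} {m : ℕ} {p : Fin (m + 1) → End S}

theorem ofNat_add_one (m k : ℕ) : Fin.ofNat (m + 1) (k + 1) = Fin.ofNat (m + 1) k + 1 := by
  apply Fin.ext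
  simp [Fin.val_add]

/-- If `γ` can be homotoped off every single pants curve, then a shortest embedded representative
does not cross any of them, as the leading coefficient of the trace vanishes. -/
theorem IsTight.not_isCross (h : IsTight γ p) (hq : ∀ i, intersectionNumber γ i = 0)
    (j : Fin (m + 1)) : ¬ (p j).1.isCross := by
  intro hj
  have h' := h.add j
  set p' : Fin (m + 1) → End S := fun k => p (k + j) with hp'
  obtain ⟨hl, hγ⟩ := h'.represents
  have harc : ∀ k, Arc p' (p' (Fin.ofNat (m + 1) k)).rev (p' (Fin.ofNat (m + 1) (k + 1))) :=
    fun k => ⟨Fin.ofNat (m + 1) k, Or.inl ⟨rfl, by rw [ofNat_add_one]⟩⟩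
  have hj' : (p' 0).1.isCross := by simpa [hp'] using hj
  have h0 := trace_leading_eq_zero hq hγ (by
    rw [← Nat.pos_iff_ne_zero, List.countP_pos_iff]
    exact ⟨(p' 0).1, by simp, hj'⟩)
  have h1 := trace_leading_ne_zero (fun k => (p' (Fin.ofNat (m + 1) k)).1) m hj'
    (by
      have : Fin.ofNat (m + 1) (m + 1) = Fin.ofNat (m + 1) 0 := Fin.ext (by simp)
      rw [this])
    (fun k => h'.drawn.src_eq (harc k)) (fun k => (h'.no_backtrack (harc k)).symm)
    fun t n htn => h'.not_isBigon (e := fun k => p' (Fin.ofNat (m + 1) k)) harc htn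
  apply h1
  refine Eq.trans ?_ h0
  congr 2
  refine List.ext_getElem (by simp) fun k hk hk' => ?_
  have : Fin.ofNat (m + 1) k = ⟨k, by simpa using hk⟩ :=
    Fin.ext (Nat.mod_eq_of_lt (by simpa using hk))
  simp only [List.getElem_map, List.getElem_range, List.getElem_ofFn, this]

theorem Dart.isCross_rev (D : S.Dart) : D.rev.isCross = D.isCross := by
  cases D <;> rfl

theorem Dart.isCross_of_sideNumber {D : S.Dart} {ε : ℕ} (h : D.sideNumber = 2 * ε) : D.isCross := by
  cases D with
  | seam P s c => simp only [Dart.sideNumber] at h; omega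
  | cross i b c => rfl

/-- If a shortest embedded closed path has arcs around a boundary component on both sides of the
seams, it is homotopic to this boundary component: the arcs next to it fit together. -/
theorem IsTight.parallelToBoundary (h : IsTight γ p) {β : Fin S.k × Fin 3}
    (hseam : ∀ j, ¬ (p j).1.isCross)
    (harc : ∀ c, ∃ u v, Arc p (seamDart β true c, u) (seamDart β false c, v)) :
    ParallelToBoundary γ β := by
  -- the outermost crossings of the two seams
  have hflip : ∀ {o x} (c c' : Bool), IsEnd p (seamDart β o c, x) →
      IsEnd p (seamDart β o c', x) := by
    intro o x c c' hx
    by_cases hc : c' = c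
    · rwa [hc]
    · rw [Bool.eq_not_iff.2 hc]
      exact hx.rev
  have hextreme : ∀ o, ∃ x, IsEnd p (seamDart β o true, x) ∧
      ∀ x', IsEnd p (seamDart β o true, x') → ¬ Beyond (!o) x x' := by
    intro o
    obtain ⟨u, v, huv⟩ := harc true
    have hx : ∃ x, IsEnd p (seamDart β o true, x) := by
      cases o
      · exact ⟨v, huv.symm.isEnd⟩
      · exact ⟨u, huv.isEnd⟩
    obtain ⟨x, hx⟩ := hx
    exact exists_extreme_arc_coordinate (!o)
      (fun z hz => by obtain ⟨e, he⟩ := hz.exists_arc; exact ⟨e, _, he⟩) hx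
  obtain ⟨x, hx, hxmin⟩ := hextreme true
  obtain ⟨y, hy, hymax⟩ := hextreme false
  have hside : ∀ {e}, IsEnd p e → e.1.sideNumber ≠ 2 * β.2.val := by
    rintro e ⟨j, rfl | rfl⟩ hs
    · exact hseam j (Dart.isCross_of_sideNumber hs)
    · exact hseam j ((Dart.isCross_rev _).symm.trans (Dart.isCross_of_sideNumber hs))
  have hmatch : ∀ c, Arc p (seamDart β true c, x) (seamDart β false c, y) := by
    intro c
    obtain ⟨u, v, huv⟩ := harc c
    obtain ⟨v', hv'⟩ : ∃ v', Arc p (seamDart β true c, x) (seamDart β false c, v') := by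
      by_cases hxu : x = u
      · exact ⟨v, hxu ▸ huv⟩
      · obtain ⟨e, he⟩ := (hflip _ c hx).exists_arc
        have hb : x < u := lt_of_le_of_ne (not_lt.1 (hxmin u (hflip _ _ huv.isEnd))) hxu
        rcases h.region huv he hb with hs | ⟨v', rfl, -⟩
        · exact absurd hs (hside he.symm.isEnd)
        · exact ⟨v', he⟩
    by_cases hvy : v' = y
    · exact hvy ▸ hv'
    · obtain ⟨e, he⟩ := (hflip _ c hy).exists_arc
      have hb : v' < y :=
        lt_of_le_of_ne (not_lt.1 (hymax v' (hflip _ _ hv'.symm.isEnd))) hvy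
      rcases h.region (o := false) hv'.symm he hb with hs | ⟨u', rfl, hu'⟩
      · exact absurd hs (hside he.symm.isEnd)
      · exact absurd hu' (hxmin u' (hflip _ _ he.symm.isEnd))
  -- hence the path consists of two arcs
  have hclosed : ∀ j, p (j + 1 + 1) = p j → (p j).1 ≠ (p (j + 1)).1 → ∀ dir,
      (p j).1 = seamDart β dir true → (p (j + 1)).1 = seamDart β (!dir) false →
        ParallelToBoundary γ β := by
    intro j hj hne dir h₁ h₂
    rcases m with _ | _ | n
    · exact absurd (by rw [show j + 1 = j from Fin.ext (by omega)]) hne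
    · obtain ⟨hl, hγ⟩ := (h.add j).represents
      refine ⟨dir, ?_⟩
      have e : (List.ofFn fun k : Fin 2 => (p (k + j)).1) = (S.boundaryLoop β.1 β.2 dir).1 := by
        rw [List.ofFn_succ, List.ofFn_succ]
        simp only [zero_add, Fin.succ_zero_eq_one, List.ofFn_zero, add_comm 1 j, h₁, h₂]
        rfl
      simpa only [e] using hγ
    · have := h.drawn.injective hj
      rw [(add_assoc j 1 1 : j + 1 + 1 = _), one_add_one_fin] at this
      exact absurd (add_eq_left.1 this) (succ_succ_ne_zero _)
  obtain ⟨j, ⟨e₁, e₂, e₃⟩ | ⟨e₁, e₂, e₃⟩⟩ :=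
    h.drawn.exists_index (hmatch true).symm (hmatch false)
  · have hj : j + 1 + 1 = j := h.drawn.injective (by rw [e₁, e₃]; rfl)
    refine hclosed (j + 1) (by rw [hj]) ?_ true (by rw [e₂]) (by rw [e₃]; rfl)
    rw [e₂, e₃]
    simp
  · refine hclosed j (by rw [e₁, e₃]; rfl) ?_ false (by rw [e₁]; rfl) (by rw [e₂]; rfl)
    rw [e₁, e₂]
    simp [End.rev, Dart.rev]

/-- A shortest embedded closed path that only crosses seams is homotopic to a boundary component of
a pair of pants, namely the one opposite to the seam that is crossed least often: as no arc returns
to the seam from which it starts, not all arcs at the other two seams can end at this one. -/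
theorem IsTight.exists_parallelToBoundary (h : IsTight γ p) (hseam : ∀ j, ¬ (p j).1.isCross) :
    ∃ β, ParallelToBoundary γ β := by
  have hdart : ∀ j, ∃ P s c, (p j).1 = .seam P s c := by
    intro j
    have := hseam j
    rcases hD : (p j).1 with ⟨P, s, c⟩ | ⟨i, b, c⟩
    · exact ⟨P, s, c, rfl⟩
    · rw [hD] at this
      exact absurd rfl this
  choose P s c hD using hdart
  have hclosed : ∀ j, P (j + 1) = P j ∧ c (j + 1) = !(c j) := by
    intro j
    have := h.drawn.closed j
    rw [hD, hD] at this
    have := Prod.mk.inj this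
    exact ⟨this.1.symm, this.2.symm⟩
  have hP : ∀ k : ℕ, P (Fin.ofNat (m + 1) k) = P 0 := by
    intro k
    induction k with
    | zero => rfl
    | succ k ih => rw [ofNat_add_one, (hclosed _).1, ih]
  have hP : ∀ j, P j = P 0 := fun j => by
    rw [← hP j.val]
    congr 1
    exact Fin.ext (Nat.mod_eq_of_lt j.2).symm
  have hc : ∀ j, c (j - 1) = !(c j) := fun j => by
    have := (hclosed (j - 1)).2
    rw [sub_add_cancel] at this
    rw [this, Bool.not_not]
  obtain ⟨ε, -, hε⟩ := Finset.exists_min_image Finset.univ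
    (fun ε => (Finset.univ.filter fun j => s j = ε).card) Finset.univ_nonempty
  refine ⟨(P 0, ε), h.parallelToBoundary hseam fun c₀ => ?_⟩
  -- in the tile of colour `c₀`, the crossing `j` is joined to the crossing `π j`
  set π : Fin (m + 1) → Fin (m + 1) := fun j => if c j = c₀ then j - 1 else j + 1 with hπ
  have hinv : Function.Involutive π := by
    intro j
    by_cases hj : c j = c₀
    · simp [hπ, hj, hc]
    · have hj' : (!(c j)) = c₀ := by rw [Bool.eq_not_iff.2 hj, Bool.not_not]
      simp [hπ, hj, (hclosed j).2, hj']
  have harc : ∀ j, Arc p (.seam (P 0) (s j) c₀, (p j).2)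
      (.seam (P 0) (s (π j)) c₀, (p (π j)).2) := by
    intro j
    by_cases hj : c j = c₀
    · refine ⟨j - 1, Or.inr ⟨?_, ?_⟩⟩
      · rw [End.rev, hD]
        simp [hπ, hj, Dart.rev, hc, hP, Dart.flip]
      · rw [sub_add_cancel]
        refine Prod.ext ?_ rfl
        rw [hD, hj, ← hP j]
    · have hj' : (!(c j)) = c₀ := by rw [Bool.eq_not_iff.2 hj, Bool.not_not]
      refine ⟨j, Or.inl ⟨?_, ?_⟩⟩
      · rw [End.rev, hD]
        simp [hj', Dart.rev, hP, Dart.flip]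
      · simp only [hπ, hj, if_false]
        refine Prod.ext ?_ rfl
        rw [hD, (hclosed j).2, hj', ← hP (j + 1)]
  have hne : ∀ j, s (π j) ≠ s j := fun j e => h.no_backtrack (harc j) (by rw [e])
  by_contra hno
  have hto : ∀ j, s j ≠ ε → s (π j) = ε := by
    intro j hj
    by_contra hj'
    obtain ⟨o, ho⟩ := exists_seamAt_eq hj
    obtain ⟨o', ho'⟩ := exists_seamAt_eq hj'
    have ha := harc j
    have hn := hne j
    rw [ho, ho'] at ha hn
    cases o <;> cases o'
    · exact hn rfl
    · exact hno ⟨_, _, ha.symm⟩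
    · exact hno ⟨_, _, ha⟩
    · exact hn rfl
  have hcard : (Finset.univ.filter fun j => ¬ s j = ε).card ≤
      (Finset.univ.filter fun j => s j = ε).card :=
    Finset.card_le_card_of_injOn π (fun j hj => by simpa using hto j (by simpa using hj))
      hinv.injective.injOn
  have hsub : ∀ ε₁ ε₂, ε₁ ≠ ε → ε₂ ≠ ε → ε₁ ≠ ε₂ →
      (Finset.univ.filter fun j => s j = ε₁).card + (Finset.univ.filter fun j => s j = ε₂).card ≤
      (Finset.univ.filter fun j => ¬ s j = ε).card := by
    intro ε₁ ε₂ h₁ h₂ h₁₂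
    rw [← Finset.card_union_of_disjoint
      (Finset.disjoint_filter.2 fun j _ e₁ e₂ => h₁₂ (e₁.symm.trans e₂))]
    refine Finset.card_le_card fun j hj => ?_
    simp only [Finset.mem_union, Finset.mem_filter, Finset.mem_univ, true_and] at hj ⊢
    rcases hj with hj | hj <;> rw [hj] <;> assumption
  have hdistinct : ε + 1 ≠ ε ∧ ε + 2 ≠ ε ∧ ε + 1 ≠ ε + 2 :=
    (by decide : ∀ ε : Fin 3, ε + 1 ≠ ε ∧ ε + 2 ≠ ε ∧ ε + 1 ≠ ε + 2) ε
  have h₁ := hε (ε + 1) (Finset.mem_univ _)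
  have h₂ := hε (ε + 2) (Finset.mem_univ _)
  have h₃ := hsub (ε + 1) (ε + 2) hdistinct.1 hdistinct.2.1 hdistinct.2.2
  have htot := Finset.card_filter_add_card_filter_not (s := Finset.univ) fun j => s j = ε
  rw [Finset.card_univ, Fintype.card_fin] at htot
  omega

end

theorem tgt_eq_src_of_isLoop {m : ℕ} {d : Fin (m + 1) → S.Dart} (h : S.IsLoop (List.ofFn d))
    (j : Fin (m + 1)) : (d j).tgt = (d (j + 1)).src := by
  rw [IsLoop, List.ofFn_succ, Cycle.chain_coe_cons, ← ofFn_add_one, List.isChain_iff_getElem] at h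
  have := h j.val (by simpa using j.is_le)
  rw [List.getElem_cons_succ, List.getElem_ofFn] at this
  convert this using 2
  obtain ⟨j, hj⟩ := j
  cases j with
  | zero => rfl
  | succ j =>
    rw [List.getElem_cons_succ, List.getElem_ofFn]
    congr 1
    apply Fin.ext
    rw [Fin.val_add_one_of_lt (Fin.lt_def.2 (by simpa using hj))]

/-- An essential simple closed curve has a shortest embedded representative. -/
theorem IsCurve.exists_isTight {γ : S.Loop} (hγ : IsCurve γ) :
    ∃ (m : ℕ) (p : Fin (m + 1) → End S), IsTight γ p := by
  classical
  obtain ⟨⟨l, hl⟩, hc, x, hx, hx'⟩ := hγ.simple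
  have hex : ∃ m, ∃ p : Fin (m + 1) → End S, Drawn p ∧ Represents γ p := by
    have key : ∀ n (d : Fin n → S.Dart) (hl : S.IsLoop (List.ofFn d)),
        FreelyHomotopic γ ⟨List.ofFn d, hl⟩ → IsEmbedded d →
          ∃ m, ∃ p : Fin (m + 1) → End S, Drawn p ∧ Represents γ p := by
      rintro (_ | m) d hl hc ⟨x, hx, hx'⟩
      · exact absurd (by simpa [trivialLoop] using hc) hγ.essential
      · simp only [finRotate_apply] at hx hx'
        exact ⟨m, fun j => (d j, x j), ⟨tgt_eq_src_of_isLoop hl, hx, hx'⟩, hl, hc⟩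
    exact key l.length l.get (by rwa [List.ofFn_get]) (by simpa only [List.ofFn_get] using hc)
      ⟨x, hx, hx'⟩
  obtain ⟨p, hp, hr⟩ := Nat.find_spec hex
  exact ⟨Nat.find hex, p, hp, hr, fun m' p' h h' => Nat.find_min' hex ⟨p', h, h'⟩, hγ.essential⟩

theorem IsCurve.exists_parallelToPantsCurve {γ : S.Loop} (hγ : IsCurve γ)
    (hq : ∀ i, intersectionNumber γ i = 0) : ∃ i, ParallelToPantsCurve γ i := by
  obtain ⟨m, p, hp⟩ := hγ.exists_isTight
  obtain ⟨β, hβ⟩ := hp.exists_parallelToBoundary (hp.not_isCross hq)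
  by_contra hno
  refine hγ.nonperipheral β (fun i b hb => hno ⟨i, ?_⟩) hβ
  exact ParallelToBoundary.parallelToPantsCurve (b := b) (hb ▸ hβ)

end PantsDecomposition

open PantsDecomposition MvPolynomial in
theorem theoremA (S : PantsDecomposition) (γ : S.Loop) (hγ : IsCurve γ) :
    ((¬ ∃ i, ParallelToPantsCurve γ i) →
      0 < ∑ i, intersectionNumber γ i ∧
      ∃ f : MvPolynomial (Fin S.ξ) ℂ,
        (∀ (τ : Fin S.ξ → ℂ) (A : Matrix.SpecialLinearGroup (Fin 2) ℂ),
          (A : Matrix.ProjectiveSpecialLinearGroup (Fin 2) ℂ) = holonomy τ γ →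
            A.1.trace = eval τ f ∨ A.1.trace = - eval τ f) ∧
        ∀ (p : Fin S.ξ → ℤ) (h : ℕ), HasTwistsAndSccArcs γ p h →
          ∃ s : ℂ, (s = 1 ∨ s = -1) ∧ ∃ R R' : MvPolynomial (Fin S.ξ) ℂ,
            f = C (s * Complex.I ^ (∑ i, intersectionNumber γ i) * 2 ^ h) *
                ∏ i, (X i + C (((p i : ℂ) - intersectionNumber γ i) / intersectionNumber γ i)) ^
                  intersectionNumber γ i + R ∧
            f = C (s * Complex.I ^ (∑ i, intersectionNumber γ i) * 2 ^ h) *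
                (∏ i, X i ^ intersectionNumber γ i +
                  ∑ i, C ((p i : ℂ) - intersectionNumber γ i) *
                    (X i ^ (intersectionNumber γ i - 1) *
                      ∏ j ∈ Finset.univ.erase i, X j ^ intersectionNumber γ j)) + R' ∧
            (∀ m ∈ R.support, (∑ i, m i) + 2 ≤ ∑ i, intersectionNumber γ i ∧
              ∀ i, m i ≤ intersectionNumber γ i) ∧
            (∀ m ∈ R'.support, (∑ i, m i) + 2 ≤ ∑ i, intersectionNumber γ i ∧
              ∀ i, m i ≤ intersectionNumber γ i)) ∧
    (∑ i, intersectionNumber γ i = 0 →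
      (∃ i, ParallelToPantsCurve γ i) ∧
      ∀ (τ : Fin S.ξ → ℂ) (A : Matrix.SpecialLinearGroup (Fin 2) ℂ),
        (A : Matrix.ProjectiveSpecialLinearGroup (Fin 2) ℂ) = holonomy τ γ →
          A.1.IsParabolic ∧ (A.1.trace = 2 ∨ A.1.trace = -2)) := by
  have hpar : ∑ i, intersectionNumber γ i = 0 → ∃ i, ParallelToPantsCurve γ i := fun hq =>
    hγ.exists_parallelToPantsCurve fun i => Finset.sum_eq_zero_iff.1 hq i (Finset.mem_univ i)
  refine ⟨fun hno => ?_, fun hq => ?_⟩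
  · have hq : 0 < ∑ i, intersectionNumber γ i :=
      Nat.pos_of_ne_zero fun hq => hno (hpar hq)
    exact ⟨hq, exists_topTerms γ hq⟩
  · obtain ⟨i, hi⟩ := hpar hq
    exact ⟨⟨i, hi⟩, fun τ A hA => isParabolic_of_parallelToBoundary hi τ A hA⟩
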